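/- **Setting.** An *obstacle* $\omega\subset\mathbb R^2$ is the closed bounded region enclosed by a simple polygon all of whose edges are horizontal or vertical and no three of whose vertices are collinear; it is *rectilinearly convex* if any two of its points are joined by a shortest rectilinear path inside $\omega$. The bounding box $B(A)$ of a set $A$ is the smallest closed axis-parallel rectangle containing $A$. An *extreme edge* of $\omega$ is an edge lying along the boundary of $B(\omega)$; an *extreme corner* is a vertex lying on two extreme edges. A *staircase obstacle* is a rectilinearly convex obstacle with exactly two extreme corners $c_1,c_2$, and these are opposite corners of $B(\omega)$. A *skeleton* for $\omega$ is a set $S$ of closed line segments inside $\omega$ such that, for all points $p,q$ outside the interior of $\omega$: if every shortest rectilinear path between $p$ and $q$ with at most one corner point meets the interior of $\omega$, then each such path intersects an element of $S$. A *minimum skeleton* is a skeleton with the smallest possible number of segments. A *visibility edge* is a line segment inside $\omega$ that is not properly contained in another line segment inside $\omega$. The *horizontal (vertical) advancement* of a segment $s$ over a set $S$ of segments is the length of the part of the horizontal (vertical) projection of $s$ that is not covered by that of $S$. A *frontier* of $S$ is the closure of a connected component of $\partial B(S)\cap \operatorname{int}\omega$. A *maximal frontier visibility edge* for a frontier $f$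 of $S$ is a visibility edge meeting $f$ that, among all visibility edges meeting $f$, maximises the horizontal advancement over $S$ and, subject to this, the vertical one, if $f$ is a vertical segment; the vertical advancement and, subject to this, the horizontal one, if $f$ is a horizontal segment; either of the two if $f$ is neither. A *maximal extreme corner visibility edge* at $c_1$ is a visibility edge with an endpoint at $c_1$ that, for one of the two extreme edges $e$ at $c_1$, is maximal among all visibility edges with an endpoint on $e$: it maximises the length of its projection orthogonal to $e$ and, subject to this, the length by which it advances from its endpoint on $e$, parallel to $e$, in the direction from $c_1$ to $c_2$ (zero if it goes the other way). **Procedure** $\mathrm{StaircaseSkeleton}(\omega,c_1,c_2)$. Start with $S^*=\{s\}$, where $s$ is a maximal extreme corner visibility edge at $c_1$. Stop as soon as the edge added last contains $c_2$ or $S^*$ has no frontier; otherwise let $f$ be the frontier of $S^*$, add to $S^*$ a maximal frontier visibility edge for $f$, and repeat. Return $S^*$. **Theorem.** Let $\omega$ be a staircase obstacle with extreme corners $c_1,c_2$. Then $\mathrm{StaircaseSkeleton}(\omega,c_1,c_2)$ computes a minimum skeleton for $\omega$. That is, whatever choices are made among the maximal edges: a maximal edge to start with exists; as long as the procedure has started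 and not stopped, $S^*$ has exactly one frontier and a maximal frontier visibility edge for it exists; the number of steps is bounded in terms of $\omega$ and $c_1,c_2$; and the set $S^*$ returned is a minimum skeleton for $\omega$. Moreover, from every state in which the procedure has not stopped, the remaining choices can be made so that the last edge contains $c_2$. -/

import Mathlib

open MeasureTheory

noncomputable section

namespace RectSkeleton

/-- The plane.  Only its topology, affine structure and coordinates matter here. -/
abbrev Plane : Type := ℝ × ℝ

/-- The rectilinear distance. -/
def rectDist (p q : Plane) : ℝ := |p.1 - q.1| + |p.2 - q.2|

/-! ### Rectilinearly-convex obstacles -/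

/-- `P` is a simple closed polygonal curve: at least three vertices, pairwise distinct; consecutive
edges share only their common vertex and all other pairs of edges are disjoint. -/
structure IsSimple {n : ℕ} (P : Polygon Plane n) : Prop where
  three_le : 3 ≤ n
  injective : Function.Injective P.vertices
  adjacent : ∀ i : Fin n,
    P.edgeSet ℝ i ∩ P.edgeSet ℝ (finRotate n i) = {P (finRotate n i)}
  nonadjacent : ∀ i j : Fin n, i ≠ j → finRotate n i ≠ j → finRotate n j ≠ i →
    Disjoint (P.edgeSet ℝ i) (P.edgeSet ℝ j)

/-- `ω` is the closed bounded region (without holes) whose boundary is the simple closed polygonal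
curve `P`. -/
structure IsRegion {n : ℕ} (P : Polygon Plane n) (ω : Set Plane) : Prop where
  simple : IsSimple P
  compact : IsCompact ω
  regular : closure (interior ω) = ω
  boundary : frontier ω = P.boundary ℝ

/-- The `i`-th edge is horizontal. -/
def IsHorizontalEdge {n : ℕ} (P : Polygon Plane n) (i : Fin n) : Prop :=
  (P i).2 = (P (finRotate n i)).2

/-- The `i`-th edge is vertical. -/
def IsVerticalEdge {n : ℕ} (P : Polygon Plane n) (i : Fin n) : Prop :=
  (P i).1 = (P (finRotate n i)).1

/-- Some shortest rectilinear path from `p` to `q` lies in `ω`: a polygonal path made of horizontal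
and vertical segments inside `ω`, whose total length is the rectilinear distance. -/
def ShortestPathInside (ω : Set Plane) (p q : Plane) : Prop :=
  ∃ (m : ℕ) (u : ℕ → Plane), u 0 = p ∧ u m = q ∧
    (∀ i < m, (u i).1 = (u (i + 1)).1 ∨ (u i).2 = (u (i + 1)).2) ∧
    (∀ i < m, segment ℝ (u i) (u (i + 1)) ⊆ ω) ∧
    ∑ i ∈ Finset.range m, rectDist (u i) (u (i + 1)) = rectDist p q

/-- `ω` is a rectilinearly-convex obstacle in general position, with boundary polygon `P`. -/
structure IsObstacle {n : ℕ} (P : Polygon Plane n) (ω : Set Plane) : Prop where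
  region : IsRegion P ω
  rectilinear : ∀ i, IsHorizontalEdge P i ∨ IsVerticalEdge P i
  general_position : ∀ i j k : Fin n, i ≠ j → j ≠ k → i ≠ k → ¬ Collinear ℝ {P i, P j, P k}
  convex : ∀ p ∈ ω, ∀ q ∈ ω, ShortestPathInside ω p q

/-- The bounding box: the smallest closed axis-oriented rectangle that contains `A`. -/
def boundingBox (A : Set Plane) : Set Plane :=
  ⋂₀ {R | (∃ a b : Plane, R = Set.Icc a b) ∧ A ⊆ R}

/-- An extreme edge of `ω`: an edge that lies along the boundary of the bounding box of `ω`. -/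
def IsExtremeEdge {n : ℕ} (P : Polygon Plane n) (ω : Set Plane) (i : Fin n) : Prop :=
  P.edgeSet ℝ i ⊆ frontier (boundingBox ω)

/-- An extreme corner of `ω`: a vertex at the intersection of two extreme edges. -/
def IsExtremeCorner {n : ℕ} (P : Polygon Plane n) (ω : Set Plane) (c : Plane) : Prop :=
  (∃ k, P k = c) ∧ ∃ i j : Fin n, i ≠ j ∧ IsExtremeEdge P ω i ∧ IsExtremeEdge P ω j ∧
    c ∈ P.edgeSet ℝ i ∧ c ∈ P.edgeSet ℝ j

/-- `ω` is a staircase obstacle with extreme corners `c₁` and `c₂`: these are its only extreme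
corners, and they are opposite corners of the bounding box. -/
structure IsStaircase {n : ℕ} (P : Polygon Plane n) (ω : Set Plane) (c₁ c₂ : Plane) : Prop where
  obstacle : IsObstacle P ω
  corners : ∀ c, IsExtremeCorner P ω c ↔ c = c₁ ∨ c = c₂
  opposite : c₁.1 ≠ c₂.1 ∧ c₁.2 ≠ c₂.2

/-! ### Skeletons -/

/-- A closed line segment. -/
def IsLineSegment (s : Set Plane) : Prop := ∃ a b : Plane, a ≠ b ∧ s = segment ℝ a b

/-- The rectilinear shortest paths between `p` and `q` with at most one corner point.  The two
paths coincide with the segment `pq` if that segment is horizontal or vertical. -/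
def shortPaths (p q : Plane) : Set (Set Plane) :=
  {γ | ∃ c : Plane, (c = (p.1, q.2) ∨ c = (q.1, p.2)) ∧ γ = segment ℝ p c ∪ segment ℝ c q}

/-- `S` is a skeleton for `ω`. -/
structure IsSkeleton (ω : Set Plane) (S : Set (Set Plane)) : Prop where
  segments : ∀ s ∈ S, IsLineSegment s
  inside : ∀ s ∈ S, s ⊆ ω
  meets : ∀ p q : Plane, p ∉ interior ω → q ∉ interior ω →
    (∀ γ ∈ shortPaths p q, (γ ∩ interior ω).Nonempty) →
    ∀ γ ∈ shortPaths p q, ∃ s ∈ S, (γ ∩ s).Nonempty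

/-- `S` is a minimum skeleton for `ω`: a finite skeleton with the smallest possible number of
line segments. -/
structure IsMinimumSkeleton (ω : Set Plane) (S : Set (Set Plane)) : Prop where
  skeleton : IsSkeleton ω S
  finite : S.Finite
  minimum : ∀ T, IsSkeleton ω T → S.encard ≤ T.encard

/-! ### Visibility edges and advancement -/

/-- A (maximum length) visibility edge: a line segment inside `ω` that is not properly contained in
another line segment inside `ω`. -/
structure IsVisibilityEdge (ω : Set Plane) (s : Set Plane) : Prop where
  segment : IsLineSegment s
  inside : s ⊆ ω
  maximal : ∀ t, IsLineSegment t → t ⊆ ω → s ⊆ t → t = s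

/-- Horizontal advancement of `s` over `S`: the length of the part of the horizontal projection of
`s` that is not covered by the horizontal projection of `S`. -/
def hAdvance (S : Set (Set Plane)) (s : Set Plane) : ℝ :=
  (volume ((Prod.fst '' s) \ (Prod.fst '' ⋃₀ S))).toReal

/-- Vertical advancement of `s` over `S`. -/
def vAdvance (S : Set (Set Plane)) (s : Set Plane) : ℝ :=
  (volume ((Prod.snd '' s) \ (Prod.snd '' ⋃₀ S))).toReal

/-- Going from coordinate `a` to coordinate `b`, the length advanced in the direction that leads
from `x` to `y` (zero when going the wrong way). -/
def advanceTowards (x y a b : ℝ) : ℝ := if x ≤ y then max 0 (b - a) else max 0 (a - b)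

/-- `s` maximises `g` on `C` and, subject to this, maximises `h`. -/
def IsLexMax {α : Type*} (C : Set α) (g h : α → ℝ) (s : α) : Prop :=
  s ∈ C ∧ ∀ t ∈ C, g t ≤ g s ∧ (g t = g s → h t ≤ h s)

/-- The extreme visibility edges for the extreme edge `i`, given by their endpoints, the first one
on the extreme edge. -/
def extremeEdges {n : ℕ} (P : Polygon Plane n) (ω : Set Plane) (i : Fin n) :
    Set (Plane × Plane) :=
  {e | e.1 ∈ P.edgeSet ℝ i ∧ IsVisibilityEdge ω (segment ℝ e.1 e.2)}

/-- The segment `e` is a maximal extreme visibility edge for the extreme edge `i` of a staircase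
obstacle, where `c` is the extreme corner on the edge `i` and `c'` is the other one: it maximises
its advancement orthogonally to the edge `i` and, subject to this, the advancement along the edge
`i` towards the other extreme edge parallel to it, which is the one at `c'`. -/
def IsMaximalExtremeEdge {n : ℕ} (P : Polygon Plane n) (ω : Set Plane) (c c' : Plane) (i : Fin n)
    (e : Plane × Plane) : Prop :=
  (IsHorizontalEdge P i ∧
    IsLexMax (extremeEdges P ω i) (fun t => vAdvance ∅ (segment ℝ t.1 t.2))
      (fun t => advanceTowards c.1 c'.1 t.1.1 t.2.1) e) ∨
  (IsVerticalEdge P i ∧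
    IsLexMax (extremeEdges P ω i) (fun t => hAdvance ∅ (segment ℝ t.1 t.2))
      (fun t => advanceTowards c.2 c'.2 t.1.2 t.2.2) e)

/-- `s` is a maximal extreme corner visibility edge at `c`: a maximal extreme visibility edge, for
an extreme edge incident with `c`, that has `c` as an endpoint. -/
def IsMaximalCornerEdge {n : ℕ} (P : Polygon Plane n) (ω : Set Plane) (c c' : Plane)
    (s : Set Plane) : Prop :=
  ∃ (i : Fin n) (b : Plane), IsExtremeEdge P ω i ∧ c ∈ P.edgeSet ℝ i ∧
    IsMaximalExtremeEdge P ω c c' i (c, b) ∧ s = segment ℝ c b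

/-! ### Frontiers -/

/-- `f` is a frontier of `S`: the closure of a maximal connected component of the intersection of
the boundary of the bounding box of `S` with the interior of `ω`. -/
def IsFrontierOf (ω : Set Plane) (S : Set (Set Plane)) (f : Set Plane) : Prop :=
  ∃ x ∈ frontier (boundingBox (⋃₀ S)) ∩ interior ω,
    f = closure (connectedComponentIn (frontier (boundingBox (⋃₀ S)) ∩ interior ω) x)

/-- All points of `f` have the same second coordinate. -/
def IsHorizontal (f : Set Plane) : Prop := ∀ p ∈ f, ∀ q ∈ f, p.2 = q.2

/-- All points of `f` have the same first coordinate. -/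
def IsVertical (f : Set Plane) : Prop := ∀ p ∈ f, ∀ q ∈ f, p.1 = q.1

/-- The frontier visibility edges for `f`: the visibility edges that intersect `f`. -/
def frontierEdges (ω f : Set Plane) : Set (Set Plane) :=
  {s | IsVisibilityEdge ω s ∧ (s ∩ f).Nonempty}

/-- `s` is a maximal frontier visibility edge for the frontier `f` of `S`.  The last case is that
of an L-shaped frontier. -/
def IsMaximalFrontierEdge (ω : Set Plane) (S : Set (Set Plane)) (f s : Set Plane) : Prop :=
  (IsVertical f ∧ IsLexMax (frontierEdges ω f) (hAdvance S) (vAdvance S) s) ∨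
  (IsHorizontal f ∧ IsLexMax (frontierEdges ω f) (vAdvance S) (hAdvance S) s) ∨
  (¬ IsVertical f ∧ ¬ IsHorizontal f ∧
    (IsLexMax (frontierEdges ω f) (hAdvance S) (vAdvance S) s ∨
     IsLexMax (frontierEdges ω f) (vAdvance S) (hAdvance S) s))

/-! ### The procedure `StaircaseSkeleton(ω, c₁, c₂)`

A state of the procedure is the list of the edges chosen so far, the latest one first. -/

/-- The set of edges chosen so far. -/
def edges (l : List (Set Plane)) : Set (Set Plane) := {s | s ∈ l}

/-- The latest edge meets the termination frontier, the point `c₂`. -/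
def ReachesCorner (c₂ : Plane) : List (Set Plane) → Prop
  | [] => False
  | s :: _ => c₂ ∈ s

/-- The procedure stops: an edge has been chosen and either the latest one meets the termination
frontier, or the set of chosen edges has no frontier left. -/
def Terminated (ω : Set Plane) (c₂ : Plane) (l : List (Set Plane)) : Prop :=
  l ≠ [] ∧ (ReachesCorner c₂ l ∨ ¬ ∃ f, IsFrontierOf ω (edges l) f)

/-- The edge `s` may be chosen in the state `l`: at the start a maximal extreme corner visibility
edge at `c₁`, later a maximal frontier visibility edge for the current frontier. -/
def Selects {n : ℕ} (P : Polygon Plane n) (ω : Set Plane) (c₁ c₂ : Plane)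
    (l : List (Set Plane)) (s : Set Plane) : Prop :=
  (l = [] ∧ IsMaximalCornerEdge P ω c₁ c₂ s) ∨
  (l ≠ [] ∧ ∃ f, IsFrontierOf ω (edges l) f ∧ IsMaximalFrontierEdge ω (edges l) f s)

/-- The states that the procedure can reach, for all possible choices of the edges. -/
inductive Run {n : ℕ} (P : Polygon Plane n) (ω : Set Plane) (c₁ c₂ : Plane) :
    List (Set Plane) → Prop
  | start : Run P ω c₁ c₂ []
  | step (l : List (Set Plane)) (s : Set Plane) : Run P ω c₁ c₂ l → ¬ Terminated ω c₂ l →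
      Selects P ω c₁ c₂ l s → Run P ω c₁ c₂ (s :: l)

end RectSkeleton

end

/-!
The procedure is analysed for a region with the extreme corner `c` at the lower left and `d` at the
upper right; reflections and the exchange of the coordinates preserve all notions involved
(`IsSymm`, `PreStair.correct`). The polygon serves only to derive a few properties of `ω`, collected
in `PreStair` and `Stair` (`IsStaircase.preStair`): rectilinear convexity in terms of the two
projections, and the fact that every line strictly between two opposite sides of the bounding box
meets the interior of `ω`. The latter is where general position is used
(`Outline.exists_interior`).

Throughout the procedure the bounding box of the chosen edges has `c` as its lower left corner. Let
`z` be the upper right one. The part of the boundary of the box inside the interior of `ω` is then a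
single chord of `ω`, ending at `z`: the vertical one or the horizontal one. So the frontier is a
segment, a `Gate`. The main point is that among the points that can be seen from a gate there is a
greatest one, `z'`, in both coordinates at once (`Gate.exists_reach`): if one segment from the gate
reaches farther to the right and another one farther up, interpolating between the two gives a
segment that does both. Hence all maximal frontier visibility edges enlarge the box to the same box
with the corner `z'`, whichever is chosen, and one of them contains `z'` (`StepResult`). The edge
rises to `z'`, unless the box is already as high or as wide as `ω`, in which case `z'` is `d`. Where
a rising visibility edge ends, it is blocked by the boundary, and this shows that there is again
exactly one frontier at `z'`, unless `z'` is `d` (`Stair.nextState`). The first edge is similar, with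
an extreme edge at `c` as the gate; that `c` itself sees as far as all of the left side, or as far as
all of the bottom side, follows from another interpolation (`Stair.seen_from_corner`).

For the lower bound, let `T` be a finite skeleton. Slightly beyond the frontier `T` has to meet all
chords of `ω`, so some segment of `T` starts on the frontier and leads out of the box of `z`
(`Stair.skeleton_covers`, `exists_limit_from_right`). Since it meets the gate, it stays below `z'`.
So every step is paid for by a new segment of `T`, and no state has more edges than `T` has segments.
The edges of the polygon form a finite skeleton (`Outline.isSkeleton`), which bounds the number of
steps.

For the upper bound, consider a path with one corner that enters the interior of `ω`. Its corner
opens to the lower left or to the upper right, or the path crosses `ω` along a straight chord. The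
edges rise from one box to the next without a gap, so they meet the boundary of every quadrant below
a point `ζ` of the box other than `d`, and likewise of the quadrants above `ζ`, except for some that
no path forces a skeleton to meet (`UpperCuts`). Applied to quadrants whose
corners are close to the corner of the path, this shows that the edges come arbitrarily close to the
path inside `ω`, and by compactness they meet it (`Stair.isSkeleton_of_cuts`). The facts about the
boxes, the cuts and the count are maintained together (`Invariant`).
-/

noncomputable section

namespace RectSkeleton

open Set Topology

/-! ### Staircase regions -/

/-- The exchange of the two coordinates. -/
def swapL : Plane ≃L[ℝ] Plane := ContinuousLinearEquiv.prodComm ℝ ℝ ℝ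

@[simp] lemma swapL_apply (p : Plane) : swapL p = (p.2, p.1) := rfl

lemma mem_swapL_image {A : Set Plane} {p : Plane} : p ∈ swapL '' A ↔ (p.2, p.1) ∈ A := by
  constructor
  · rintro ⟨q, hq, rfl⟩
    exact hq
  · intro h
    exact ⟨_, h, rfl⟩

lemma swapL_image_swapL_image (A : Set Plane) : swapL '' (swapL '' A) = A := by
  ext p
  rw [mem_swapL_image, mem_swapL_image]

lemma mem_interior_swapL_image {A : Set Plane} {p : Plane} :
    p ∈ interior (swapL '' A) ↔ (p.2, p.1) ∈ interior A := by
  rw [← mem_swapL_image]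
  exact (congrArg (p ∈ ·) (swapL.toHomeomorph.image_interior A)).symm.to_iff

/-- A compact region in which any two points are joined by a shortest rectilinear path, as far as
this is visible in the two projections: over every coordinate between those of the two points there
is a point of the region in the rectangle that they span. -/
structure RectConvex (ω : Set Plane) : Prop where
  compact : IsCompact ω
  regular : closure (interior ω) = ω
  path₁ : ∀ p ∈ ω, ∀ q ∈ ω, ∀ x ∈ uIcc p.1 q.1, ∃ y ∈ uIcc p.2 q.2, (x, y) ∈ ω
  path₂ : ∀ p ∈ ω, ∀ q ∈ ω, ∀ y ∈ uIcc p.2 q.2, ∃ x ∈ uIcc p.1 q.1, (x, y) ∈ ω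

/-- A staircase region with extreme corners `c` and `d`, described without reference to its
boundary polygon and to the relative position of the two corners: `dense₁` and `dense₂` exclude the
places where the region is pinched to a point or to a boundary segment. -/
structure PreStair (ω : Set Plane) (c d : Plane) : Prop extends RectConvex ω where
  ne₁ : c.1 ≠ d.1
  ne₂ : c.2 ≠ d.2
  low_mem : c ∈ ω
  high_mem : d ∈ ω
  sub₁ : ∀ p ∈ ω, p.1 ∈ uIcc c.1 d.1
  sub₂ : ∀ p ∈ ω, p.2 ∈ uIcc c.2 d.2
  dense₁ : ∀ x ∈ uIcc c.1 d.1, x ≠ c.1 → x ≠ d.1 → ∃ y, (x, y) ∈ interior ω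
  dense₂ : ∀ y ∈ uIcc c.2 d.2, y ≠ c.2 → y ≠ d.2 → ∃ x, (x, y) ∈ interior ω
  side₁ : ∃ x, x ≠ c.1 ∧ (x, c.2) ∈ ω
  side₂ : ∃ y, y ≠ c.2 ∧ (c.1, y) ∈ ω

/-- A staircase region whose corner `c` is the lower left one. -/
structure Stair (ω : Set Plane) (c d : Plane) : Prop extends PreStair ω c d where
  lt₁ : c.1 < d.1
  lt₂ : c.2 < d.2

lemma RectConvex.swap {ω : Set Plane} (h : RectConvex ω) : RectConvex (swapL '' ω) where
  compact := h.compact.image swapL.continuous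
  regular := by
    have h1 : interior (swapL '' ω) = swapL '' interior ω :=
      (swapL.toHomeomorph.image_interior ω).symm
    have h2 : closure (swapL '' interior ω) = swapL '' closure (interior ω) :=
      (swapL.toHomeomorph.image_closure _).symm
    rw [h1, h2, h.regular]
  path₁ p hp q hq x hx := by
    obtain ⟨y, hy, hm⟩ := h.path₂ _ (mem_swapL_image.1 hp) _ (mem_swapL_image.1 hq) x hx
    exact ⟨y, hy, mem_swapL_image.2 hm⟩
  path₂ p hp q hq x hx := by
    obtain ⟨y, hy, hm⟩ := h.path₁ _ (mem_swapL_image.1 hp) _ (mem_swapL_image.1 hq) x hx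
    exact ⟨y, hy, mem_swapL_image.2 hm⟩

lemma RectConvex.vert {ω : Set Plane} (h : RectConvex ω) {x y₁ y₂ y : ℝ} (h₁ : (x, y₁) ∈ ω)
    (h₂ : (x, y₂) ∈ ω) (hy₁ : y₁ ≤ y) (hy₂ : y ≤ y₂) : (x, y) ∈ ω := by
  obtain ⟨x', hx', hm⟩ := h.path₂ _ h₁ _ h₂ y (by
    rw [uIcc_of_le (hy₁.trans hy₂)]; exact ⟨hy₁, hy₂⟩)
  have : x' = x := by simpa using hx'
  rwa [this] at hm

lemma RectConvex.horiz {ω : Set Plane} (h : RectConvex ω) {x₁ x₂ x y : ℝ} (h₁ : (x₁, y) ∈ ω)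
    (h₂ : (x₂, y) ∈ ω) (hx₁ : x₁ ≤ x) (hx₂ : x ≤ x₂) : (x, y) ∈ ω :=
  mem_swapL_image.1 (h.swap.vert (x := y) (mem_swapL_image.2 h₁) (mem_swapL_image.2 h₂) hx₁ hx₂)

lemma PreStair.swap {ω : Set Plane} {c d : Plane} (h : PreStair ω c d) :
    PreStair (swapL '' ω) (swapL c) (swapL d) where
  toRectConvex := h.toRectConvex.swap
  ne₁ := h.ne₂
  ne₂ := h.ne₁
  low_mem := mem_image_of_mem _ h.low_mem
  high_mem := mem_image_of_mem _ h.high_mem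
  sub₁ p hp := h.sub₂ _ (mem_swapL_image.1 hp)
  sub₂ p hp := h.sub₁ _ (mem_swapL_image.1 hp)
  dense₁ x hx h1 h2 := by
    obtain ⟨y, hy⟩ := h.dense₂ x hx h1 h2
    exact ⟨y, mem_interior_swapL_image.2 hy⟩
  dense₂ x hx h1 h2 := by
    obtain ⟨y, hy⟩ := h.dense₁ x hx h1 h2
    exact ⟨y, mem_interior_swapL_image.2 hy⟩
  side₁ := by
    obtain ⟨y, hy, hm⟩ := h.side₂
    exact ⟨y, hy, mem_swapL_image.2 hm⟩
  side₂ := by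
    obtain ⟨y, hy, hm⟩ := h.side₁
    exact ⟨y, hy, mem_swapL_image.2 hm⟩

/-- Membership in the interior, tested on small axis-parallel squares. -/
lemma mem_interior_iff_square {A : Set Plane} {p : Plane} :
    p ∈ interior A ↔ ∃ ε > 0, ∀ x y, |x - p.1| < ε → |y - p.2| < ε → (x, y) ∈ A := by
  rw [mem_interior_iff_mem_nhds, Metric.mem_nhds_iff]
  constructor
  · rintro ⟨ε, hε, h⟩
    refine ⟨ε, hε, fun x y hx hy => h ?_⟩
    rw [Metric.mem_ball, Prod.dist_eq, max_lt_iff, Real.dist_eq, Real.dist_eq]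
    exact ⟨hx, hy⟩
  · rintro ⟨ε, hε, h⟩
    refine ⟨ε, hε, fun q hq => ?_⟩
    rw [Metric.mem_ball, Prod.dist_eq, max_lt_iff, Real.dist_eq, Real.dist_eq] at hq
    exact h q.1 q.2 hq.1 hq.2

/-- Interior points stay in the set when they are moved a little, by a common amount. -/
lemma interior_translate {A : Set Plane} {p q r : Plane} (hp : p ∈ interior A)
    (hq : q ∈ interior A)
    (h : ∀ u v, (p.1 + u, p.2 + v) ∈ A → (q.1 + u, q.2 + v) ∈ A → (r.1 + u, r.2 + v) ∈ A) :
    r ∈ interior A := by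
  rw [mem_interior_iff_square] at *
  obtain ⟨ε, hε, h1⟩ := hp
  obtain ⟨δ, hδ, h2⟩ := hq
  refine ⟨min ε δ, lt_min hε hδ, fun x y hx hy => ?_⟩
  have := h (x - r.1) (y - r.2) (h1 _ _ (by simpa using lt_of_lt_of_le hx (min_le_left _ _))
    (by simpa using lt_of_lt_of_le hy (min_le_left _ _)))
    (h2 _ _ (by simpa using lt_of_lt_of_le hx (min_le_right _ _))
    (by simpa using lt_of_lt_of_le hy (min_le_right _ _)))
  simpa using this

namespace Stair

variable {ω : Set Plane} {c d : Plane}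

lemma swap (h : Stair ω c d) : Stair (swapL '' ω) (swapL c) (swapL d) where
  toPreStair := h.toPreStair.swap
  lt₁ := h.lt₂
  lt₂ := h.lt₁

lemma bounds (h : Stair ω c d) {p : Plane} (hp : p ∈ ω) :
    c.1 ≤ p.1 ∧ p.1 ≤ d.1 ∧ c.2 ≤ p.2 ∧ p.2 ≤ d.2 := by
  have h1 := h.sub₁ p hp
  have h2 := h.sub₂ p hp
  rw [uIcc_of_le h.lt₁.le] at h1
  rw [uIcc_of_le h.lt₂.le] at h2
  exact ⟨h1.1, h1.2, h2.1, h2.2⟩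

/-- The upper right corner of the rectangle spanned by an upper left and a lower right point. -/
lemma upper_right (h : Stair ω c d) {x y x' y' : ℝ} (h₁ : (x, y) ∈ ω) (h₂ : (x', y') ∈ ω)
    (hx : x ≤ x') (hy : y' ≤ y) : (x', y) ∈ ω := by
  have hb := h.bounds h₂
  have hb' := h.bounds h₁
  obtain ⟨y'', hy'', hm⟩ := h.path₁ _ h₁ _ h.high_mem x' (by
    rw [uIcc_of_le hb'.2.1]; exact ⟨hx, hb.2.1⟩)
  rw [uIcc_of_le hb'.2.2.2] at hy''
  exact h.vert h₂ hm hy hy''.1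

/-- The lower left corner of the rectangle spanned by an upper left and a lower right point. -/
lemma lower_left (h : Stair ω c d) {x y x' y' : ℝ} (h₁ : (x, y) ∈ ω) (h₂ : (x', y') ∈ ω)
    (hx : x ≤ x') (hy : y' ≤ y) : (x, y') ∈ ω := by
  have hb := h.bounds h₂
  have hb' := h.bounds h₁
  obtain ⟨y'', hy'', hm⟩ := h.path₁ _ h.low_mem _ h₂ x (by
    rw [uIcc_of_le hb.1]; exact ⟨hb'.1, hx⟩)
  rw [uIcc_of_le hb.2.2.1] at hy''
  exact h.vert hm h₁ hy''.2 hy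

lemma vert_int (h : Stair ω c d) {x y₁ y₂ y : ℝ} (h₁ : (x, y₁) ∈ interior ω)
    (h₂ : (x, y₂) ∈ interior ω) (hy₁ : y₁ ≤ y) (hy₂ : y ≤ y₂) : (x, y) ∈ interior ω :=
  interior_translate h₁ h₂ fun u v h₁ h₂ => h.vert (y₁ := y₁ + v) (y₂ := y₂ + v) h₁ h₂
    (by simpa using hy₁) (by simpa using hy₂)

lemma upper_right_int (h : Stair ω c d) {x y x' y' : ℝ} (h₁ : (x, y) ∈ interior ω)
    (h₂ : (x', y') ∈ interior ω) (hx : x ≤ x') (hy : y' ≤ y) : (x', y) ∈ interior ω :=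
  interior_translate h₁ h₂ fun u v h₁ h₂ => h.upper_right (x := x + u) (y' := y' + v) h₁ h₂
    (by simpa using hx) (by simpa using hy)

lemma lower_left_int (h : Stair ω c d) {x y x' y' : ℝ} (h₁ : (x, y) ∈ interior ω)
    (h₂ : (x', y') ∈ interior ω) (hx : x ≤ x') (hy : y' ≤ y) : (x, y') ∈ interior ω :=
  interior_translate h₁ h₂ fun u v h₁ h₂ => h.lower_left (x' := x' + u) (y := y + v) h₁ h₂
    (by simpa using hx) (by simpa using hy)

lemma bounds_int (h : Stair ω c d) {p : Plane} (hp : p ∈ interior ω) :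
    c.1 < p.1 ∧ p.1 < d.1 ∧ c.2 < p.2 ∧ p.2 < d.2 := by
  obtain ⟨ε, hε, hs⟩ := mem_interior_iff_square.1 hp
  have h1 := h.bounds (hs (p.1 + ε / 2) (p.2 + ε / 2)
    (by rw [add_sub_cancel_left, abs_of_pos (by positivity)]; linarith)
    (by rw [add_sub_cancel_left, abs_of_pos (by positivity)]; linarith))
  have h2 := h.bounds (hs (p.1 - ε / 2) (p.2 - ε / 2)
    (by rw [sub_sub_cancel_left, abs_neg, abs_of_pos (by positivity)]; linarith)
    (by rw [sub_sub_cancel_left, abs_neg, abs_of_pos (by positivity)]; linarith))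
  simp only at h1 h2
  refine ⟨?_, ?_, ?_, ?_⟩ <;> linarith

/-- Points of a staircase region are limits of interior points. -/
lemma approx (h : Stair ω c d) {p : Plane} (hp : p ∈ ω) {ε : ℝ} (hε : 0 < ε) :
    ∃ q ∈ interior ω, |q.1 - p.1| < ε ∧ |q.2 - p.2| < ε := by
  rw [← h.regular, Metric.mem_closure_iff] at hp
  obtain ⟨q, hq, hd⟩ := hp ε hε
  rw [dist_comm, Prod.dist_eq, max_lt_iff, Real.dist_eq, Real.dist_eq] at hd
  exact ⟨q, hq, hd⟩

/-- If the upper left point is in `ω` and the lower right one in the interior, then the right side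
of the rectangle they span is in the interior, up to its upper end. -/
lemma right_side_int (h : Stair ω c d) {p k : Plane} (hp : p ∈ ω) (hk : k ∈ interior ω)
    (hx : p.1 < k.1) {t : ℝ} (ht : k.2 ≤ t) (ht' : t < p.2) : (k.1, t) ∈ interior ω := by
  obtain ⟨q, hq, h1, h2⟩ := h.approx hp (lt_min (sub_pos.2 hx) (sub_pos.2 ht'))
  rw [lt_min_iff] at h1 h2
  have h3 := (abs_lt.1 h1.1).2
  have h4 := (abs_lt.1 h2.2).1
  exact h.vert_int hk (h.upper_right_int hq hk (by linarith) (by linarith)) ht (by linarith)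

/-- If the lower right point is in `ω` and the upper left one in the interior, then the left side
of the rectangle they span is in the interior, down to its lower end. -/
lemma left_side_int (h : Stair ω c d) {p k : Plane} (hp : p ∈ ω) (hk : k ∈ interior ω)
    (hx : k.1 < p.1) {t : ℝ} (ht : t ≤ k.2) (ht' : p.2 < t) : (k.1, t) ∈ interior ω := by
  obtain ⟨q, hq, h1, h2⟩ := h.approx hp (lt_min (sub_pos.2 hx) (sub_pos.2 ht'))
  rw [lt_min_iff] at h1 h2
  have h3 := (abs_lt.1 h1.1).1
  have h4 := (abs_lt.1 h2.2).2
  exact h.vert_int (h.lower_left_int hk hq (by linarith) (by linarith)) hk (by linarith) ht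

/-- If the lower right point is in `ω` and the upper left one in the interior, then the upper side
of the rectangle they span is in the interior, up to its right end. -/
lemma upper_side_int (h : Stair ω c d) {p k : Plane} (hp : p ∈ ω) (hk : k ∈ interior ω)
    (hy : p.2 < k.2) {t : ℝ} (ht : k.1 ≤ t) (ht' : t < p.1) : (t, k.2) ∈ interior ω :=
  mem_interior_swapL_image.1 (h.swap.right_side_int (p := (p.2, p.1)) (k := (k.2, k.1))
    (mem_swapL_image.2 hp) (mem_interior_swapL_image.2 hk) hy ht ht')

/-- If the upper left point is in `ω` and the lower right one in the interior, then the lower side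
of the rectangle they span is in the interior, up to its left end. -/
lemma lower_side_int (h : Stair ω c d) {p k : Plane} (hp : p ∈ ω) (hk : k ∈ interior ω)
    (hy : k.2 < p.2) {t : ℝ} (ht : t ≤ k.1) (ht' : p.1 < t) : (t, k.2) ∈ interior ω :=
  mem_interior_swapL_image.1 (h.swap.left_side_int (p := (p.2, p.1)) (k := (k.2, k.1))
    (mem_swapL_image.2 hp) (mem_interior_swapL_image.2 hk) hy ht ht')

end Stair

/-! ### Segments and visibility edges -/

lemma mem_segment_iff {a b p : Plane} :
    p ∈ segment ℝ a b ↔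
      ∃ t ∈ Icc (0 : ℝ) 1, p.1 = a.1 + t * (b.1 - a.1) ∧ p.2 = a.2 + t * (b.2 - a.2) := by
  rw [segment_eq_image']
  constructor
  · rintro ⟨t, ht, rfl⟩
    exact ⟨t, ht, by simp, by simp⟩
  · rintro ⟨t, ht, h1, h2⟩
    exact ⟨t, ht, Prod.ext (by simp [h1]) (by simp [h2])⟩

/-- Two affine functions compare on an interval as they do at its ends. -/
lemma affine_le {m k n j a b x : ℝ} (ha : m * a + k ≤ n * a + j) (hb : m * b + k ≤ n * b + j)
    (hax : a ≤ x) (hxb : x ≤ b) : m * x + k ≤ n * x + j := by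
  rcases le_total m n with h | h
  · nlinarith [mul_nonneg (sub_nonneg.2 h) (sub_nonneg.2 hax)]
  · nlinarith [mul_nonneg (sub_nonneg.2 h) (sub_nonneg.2 hxb)]

lemma segment_subset_of_graph {A : Set Plane} {m k x₀ x₁ : ℝ} (hx : x₀ ≤ x₁)
    (h : ∀ x ∈ Icc x₀ x₁, (x, m * x + k) ∈ A) :
    segment ℝ (x₀, m * x₀ + k) (x₁, m * x₁ + k) ⊆ A := by
  intro p hp
  obtain ⟨t, ht, h1, h2⟩ := mem_segment_iff.1 hp
  simp only at h1 h2
  have : p = (p.1, m * p.1 + k) := Prod.ext rfl (by simp only; rw [h1, h2]; ring)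
  rw [this]
  refine h _ ⟨?_, ?_⟩ <;> rw [h1] <;> nlinarith [ht.1, ht.2]

lemma graph_of_segment_subset {A : Set Plane} {a b : Plane} (hab : a.1 < b.1)
    (h : segment ℝ a b ⊆ A) : ∃ m k : ℝ, a.2 = m * a.1 + k ∧ b.2 = m * b.1 + k ∧
      ∀ x ∈ Icc a.1 b.1, (x, m * x + k) ∈ A := by
  have h0 : b.1 - a.1 ≠ 0 := (sub_pos.2 hab).ne'
  refine ⟨(b.2 - a.2) / (b.1 - a.1), a.2 - (b.2 - a.2) / (b.1 - a.1) * a.1, by ring,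
    by field_simp; ring, fun x hx => h ?_⟩
  refine mem_segment_iff.2 ⟨(x - a.1) / (b.1 - a.1),
    ⟨div_nonneg (sub_nonneg.2 hx.1) (sub_pos.2 hab).le,
      (div_le_one (sub_pos.2 hab)).2 (by linarith [hx.2])⟩, ?_, ?_⟩
  · simp only; field_simp; ring
  · simp only; field_simp; ring

lemma segment_subset_of_mem {u v p q : Plane} (hp : p ∈ segment ℝ u v)
    (hq : q ∈ segment ℝ u v) : segment ℝ p q ⊆ segment ℝ u v :=
  (convex_segment u v).segment_subset hp hq

/-- A segment, parametrised by the line through two of its points. -/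
lemma segment_param {u v w z : Plane} (hw : w ∈ segment ℝ u v) (hz : z ∈ segment ℝ u v)
    (hwz : w ≠ z) : ∃ α β : ℝ, α ≤ 0 ∧ 1 ≤ β ∧
      ∀ p, p ∈ segment ℝ u v ↔ ∃ t ∈ Icc α β, p = w + t • (z - w) := by
  have main : ∀ u v : Plane, ∀ r s : ℝ, r ∈ Icc (0 : ℝ) 1 → s ∈ Icc (0 : ℝ) 1 → r < s →
      w = u + r • (v - u) → z = u + s • (v - u) → ∃ α β : ℝ, α ≤ 0 ∧ 1 ≤ β ∧
      ∀ p, p ∈ segment ℝ u v ↔ ∃ t ∈ Icc α β, p = w + t • (z - w) := by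
    intro u v r s hr hs hrs hw hz
    have h0 : 0 < s - r := sub_pos.2 hrs
    have key : ∀ t : ℝ, w + t • (z - w) = u + (r + t * (s - r)) • (v - u) := by
      intro t
      rw [hz, hw]
      module
    refine ⟨-r / (s - r), (1 - r) / (s - r), ?_, ?_, fun p => ?_⟩
    · exact div_nonpos_of_nonpos_of_nonneg (by linarith [hr.1]) h0.le
    · rw [le_div_iff₀ h0]; linarith [hs.2]
    · rw [segment_eq_image']
      constructor
      · rintro ⟨θ, hθ, rfl⟩
        refine ⟨(θ - r) / (s - r), ⟨?_, ?_⟩, ?_⟩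
        · exact div_le_div_of_nonneg_right (by linarith [hθ.1]) h0.le
        · exact div_le_div_of_nonneg_right (by linarith [hθ.2]) h0.le
        · rw [key, div_mul_cancel₀ _ h0.ne']
          congr 2; ring
      · rintro ⟨t, ht, rfl⟩
        have h1 := (div_le_iff₀ h0).1 ht.1
        have h2 := (le_div_iff₀ h0).1 ht.2
        exact ⟨r + t * (s - r), ⟨by linarith, by linarith⟩, (key t).symm⟩
  obtain ⟨r, hr, hw'⟩ := (segment_eq_image' ℝ u v).subset hw
  obtain ⟨s, hs, hz'⟩ := (segment_eq_image' ℝ u v).subset hz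
  rcases lt_trichotomy r s with hrs | hrs | hrs
  · exact main u v r s hr hs hrs hw'.symm hz'.symm
  · subst hrs
    exact absurd (hw'.symm.trans hz') hwz
  · rw [segment_symm]
    refine main v u (1 - r) (1 - s) ⟨by linarith [hr.2], by linarith [hr.1]⟩
      ⟨by linarith [hs.2], by linarith [hs.1]⟩ (by linarith) ?_ ?_
    · rw [← hw']; module
    · rw [← hz']; module

/-- A visibility edge cannot be prolonged inside `ω`. -/
lemma visibilityEdge_prolong {ω s : Set Plane} (hs : IsVisibilityEdge ω s) {w z : Plane}
    (hw : w ∈ s) (hz : z ∈ s) (hwz : w ≠ z) {t : ℝ} (ht : 1 ≤ t)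
    (h : segment ℝ z (w + t • (z - w)) ⊆ ω) : w + t • (z - w) ∈ s := by
  obtain ⟨⟨u, v, huv, rfl⟩, hin, hmax⟩ := hs
  obtain ⟨α, β, hα, hβ, hp⟩ := segment_param hw hz hwz
  by_cases htβ : t ≤ β
  · exact (hp _).2 ⟨t, ⟨by linarith, htβ⟩, rfl⟩
  push Not at htβ
  have hsub : segment ℝ (w + α • (z - w)) (w + t • (z - w)) ⊆ ω := by
    rw [segment_eq_image']
    rintro _ ⟨θ, hθ, rfl⟩
    have e : w + α • (z - w) + θ • (w + t • (z - w) - (w + α • (z - w)))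
        = w + (α + θ * (t - α)) • (z - w) := by module
    simp only [e]
    by_cases h1 : α + θ * (t - α) ≤ β
    · exact hin ((hp _).2 ⟨_, ⟨by nlinarith [hθ.1], h1⟩, rfl⟩)
    · push Not at h1
      apply h
      rw [segment_eq_image']
      have ht1 : 0 < t - 1 := by linarith
      refine ⟨(α + θ * (t - α) - 1) / (t - 1), ⟨div_nonneg (by linarith) ht1.le,
        (div_le_one ht1).2 (by nlinarith [hθ.2])⟩, ?_⟩
      have e2 : z + ((α + θ * (t - α) - 1) / (t - 1)) • (w + t • (z - w) - z)
        = w + (1 + (α + θ * (t - α) - 1) / (t - 1) * (t - 1)) • (z - w) := by module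
      simp only [e2]
      rw [div_mul_cancel₀ _ ht1.ne']
      congr 2; ring
  have hle : segment ℝ u v ⊆ segment ℝ (w + α • (z - w)) (w + t • (z - w)) := by
    intro p hps
    obtain ⟨r, hr, rfl⟩ := (hp p).1 hps
    rw [segment_eq_image']
    have h0 : 0 < t - α := by linarith
    refine ⟨(r - α) / (t - α), ⟨div_nonneg (by linarith [hr.1]) h0.le,
      (div_le_one h0).2 (by linarith [hr.2])⟩, ?_⟩
    have e2 : w + α • (z - w) + ((r - α) / (t - α)) • (w + t • (z - w) - (w + α • (z - w)))
        = w + (α + (r - α) / (t - α) * (t - α)) • (z - w) := by module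
    simp only [e2]
    rw [div_mul_cancel₀ _ h0.ne']
    congr 2; ring
  have hne : w + α • (z - w) ≠ w + t • (z - w) := by
    intro e
    have e1 : (t - α) • (z - w) = 0 := by
      have := sub_eq_zero.2 e.symm
      rw [← this]; module
    rcases smul_eq_zero.1 e1 with h1 | h1
    · linarith
    · exact hwz (sub_eq_zero.1 h1).symm
  rw [← hmax _ ⟨_, _, hne, rfl⟩ hsub hle]
  exact right_mem_segment _ _ _

/-- The pairs of endpoints of the segments in a closed set form a closed set. -/
lemma isClosed_segment_subset {ω : Set Plane} (h : IsClosed ω) :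
    IsClosed {e : Plane × Plane | segment ℝ e.1 e.2 ⊆ ω} := by
  have : {e : Plane × Plane | segment ℝ e.1 e.2 ⊆ ω} =
      ⋂ t ∈ Icc (0 : ℝ) 1, {e : Plane × Plane | e.1 + t • (e.2 - e.1) ∈ ω} := by
    ext e
    simp only [mem_ofPred_eq, mem_iInter, segment_eq_image', image_subset_iff]
    rfl
  rw [this]
  exact isClosed_biInter fun t _ => h.preimage (by fun_prop)

/-- Every segment in a compact set extends to a visibility edge. -/
lemma exists_visibilityEdge {ω s : Set Plane} (hω : IsCompact ω) (hs : IsLineSegment s)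
    (hsub : s ⊆ ω) : ∃ t, IsVisibilityEdge ω t ∧ s ⊆ t := by
  obtain ⟨a, b, hab, rfl⟩ := hs
  have hclosed : IsClosed {e : Plane × Plane | segment ℝ e.1 e.2 ⊆ ω ∧
      a ∈ segment ℝ e.1 e.2 ∧ b ∈ segment ℝ e.1 e.2} := by
    have key : ∀ p : Plane, IsClosed {e : Plane × Plane | p ∈ segment ℝ e.1 e.2} := by
      intro p
      have : {e : Plane × Plane | p ∈ segment ℝ e.1 e.2} =
          (Prod.fst : (Plane × Plane) × Icc (0 : ℝ) 1 → _) ''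
            {x : (Plane × Plane) × Icc (0 : ℝ) 1 | x.1.1 + (x.2 : ℝ) • (x.1.2 - x.1.1) = p} := by
        ext e
        rw [mem_ofPred_eq, segment_eq_image']
        constructor
        · rintro ⟨t, ht, h1⟩
          exact ⟨(e, ⟨t, ht⟩), h1, rfl⟩
        · rintro ⟨⟨y, t⟩, h1, rfl⟩
          exact ⟨t, t.2, h1⟩
      rw [this]
      exact isClosedMap_fst_of_compactSpace _ (isClosed_eq (by fun_prop) continuous_const)
    exact (isClosed_segment_subset hω.isClosed).inter ((key a).inter (key b))
  have hcomp := (hω.prod hω).of_isClosed_subset hclosed (fun e he =>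
    ⟨he.1 (left_mem_segment _ _ _), he.1 (right_mem_segment _ _ _)⟩)
  obtain ⟨e, he, hmax⟩ := hcomp.exists_isMaxOn
    ⟨(a, b), hsub, left_mem_segment _ _ _, right_mem_segment _ _ _⟩
    (f := fun e => dist e.1 e.2) (by fun_prop)
  have hne : e.1 ≠ e.2 := by
    intro h0
    have h1 := he.2.1
    have h2 := he.2.2
    rw [h0, segment_same] at h1 h2
    exact hab (h1.trans h2.symm)
  refine ⟨segment ℝ e.1 e.2, ⟨⟨_, _, hne, rfl⟩, he.1, ?_⟩, segment_subset_of_mem he.2.1 he.2.2⟩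
  rintro _ ⟨u, v, huv, rfl⟩ htω hle
  have hd : dist u v ≤ dist e.1 e.2 := hmax (a := (u, v)) ⟨htω, hle he.2.1, hle he.2.2⟩
  obtain ⟨α, β, hα, hβ, hp⟩ := segment_param (hle (left_mem_segment _ _ _))
    (hle (right_mem_segment _ _ _)) hne
  obtain ⟨r, hr, hu⟩ := (hp u).1 (left_mem_segment _ _ _)
  obtain ⟨r', hr', hv⟩ := (hp v).1 (right_mem_segment _ _ _)
  -- the parameters of the ends of the longer segment are at distance at most one, so both
  -- segments have the same ends
  have hbig : ∀ x y : ℝ, x ∈ Icc α β → y ∈ Icc α β →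
      dist (e.1 + x • (e.2 - e.1)) (e.1 + y • (e.2 - e.1)) = |x - y| * dist e.1 e.2 := by
    intro x y _ _
    rw [dist_eq_norm, dist_comm e.1, dist_eq_norm, ← Real.norm_eq_abs, ← norm_smul]
    congr 1; module
  have hpos : 0 < dist e.1 e.2 := dist_pos.2 hne
  have hfull : ∀ x ∈ Icc α β, ∃ θ ∈ Icc (0 : ℝ) 1, x = r + θ * (r' - r) := by
    intro x hx
    have := (hp (e.1 + x • (e.2 - e.1))).2 ⟨x, hx, rfl⟩
    rw [segment_eq_image'] at this
    obtain ⟨θ, hθ, h1⟩ := this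
    refine ⟨θ, hθ, ?_⟩
    simp only [hu, hv] at h1
    have h2 : (x - (r + θ * (r' - r))) • (e.2 - e.1) = 0 := by
      rw [← sub_eq_zero.2 h1.symm]; module
    rcases smul_eq_zero.1 h2 with h3 | h3
    · linarith
    · exact absurd (sub_eq_zero.1 h3).symm hne
  have h1 : |r - r'| ≤ 1 := by
    rw [hu, hv, hbig _ _ hr hr'] at hd
    by_contra hcon
    push Not at hcon
    nlinarith
  obtain ⟨θ, hθ, hθ'⟩ := hfull α ⟨le_rfl, by linarith⟩
  obtain ⟨θ₁, hθ₁, hθ₁'⟩ := hfull β ⟨by linarith, le_rfl⟩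
  have h2 : β - α ≤ 1 := by
    have : β - α = (θ - θ₁) * (r - r') := by rw [hθ', hθ₁']; ring
    rw [this]
    calc (θ - θ₁) * (r - r') ≤ |(θ - θ₁) * (r - r')| := le_abs_self _
      _ = |θ - θ₁| * |r - r'| := abs_mul _ _
      _ ≤ 1 * 1 := mul_le_mul (abs_le.2 ⟨by linarith [hθ.1, hθ₁.2], by linarith [hθ.2, hθ₁.1]⟩) h1
          (abs_nonneg _) zero_le_one
      _ = 1 := one_mul _
  have hα0 : α = 0 := by linarith
  have hβ1 : β = 1 := by linarith
  ext p
  rw [hp, segment_eq_image', hα0, hβ1]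
  exact ⟨fun ⟨t, h1, h2⟩ => ⟨t, h1, h2.symm⟩, fun ⟨t, h1, h2⟩ => ⟨t, h1, h2.symm⟩⟩

/-- A segment that crosses a region from a leftmost point to a rightmost visible point is a
visibility edge. -/
lemma isVisibilityEdge_of_extreme {ω : Set Plane} {w z : Plane} (hwz : w.1 < z.1)
    (hsub : segment ℝ w z ⊆ ω) (hl : ∀ q ∈ ω, w.1 ≤ q.1)
    (hr : ∀ q, segment ℝ w q ⊆ ω → q.1 ≤ z.1) : IsVisibilityEdge ω (segment ℝ w z) := by
  have hne : w ≠ z := fun h => by rw [h] at hwz; exact lt_irrefl _ hwz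
  refine ⟨⟨w, z, hne, rfl⟩, hsub, ?_⟩
  rintro _ ⟨u, v, huv, rfl⟩ htω hle
  have hw := hle (left_mem_segment ℝ w z)
  have hz := hle (right_mem_segment ℝ w z)
  refine Subset.antisymm (fun q hq => ?_) hle
  obtain ⟨α, β, -, -, hp⟩ := segment_param hw hz hne
  have h1 := hl q (htω hq)
  have h2 := hr q ((segment_subset_of_mem hw hq).trans htω)
  obtain ⟨t, -, rfl⟩ := (hp q).1 hq
  simp only [Prod.fst_add, Prod.smul_fst, Prod.fst_sub, smul_eq_mul] at h1 h2
  rw [segment_eq_image']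
  exact ⟨t, ⟨by nlinarith, by nlinarith⟩, rfl⟩

/-! ### What can be seen from a vertical gate -/

/-- A vertical gate of `ω`: a closed vertical segment `F` in `ω` on the line `x = a` that reaches up
to the highest point `(a, b)` of `ω` on that line. -/
structure Gate (ω F : Set Plane) (a b : ℝ) : Prop where
  closed : IsClosed F
  sub : F ⊆ ω
  line : ∀ p ∈ F, p.1 = a
  convex : ∀ y₁ y₂ y, (a, y₁) ∈ F → (a, y₂) ∈ F → y₁ ≤ y → y ≤ y₂ → (a, y) ∈ F
  top_mem : (a, b) ∈ F
  top : ∀ y, (a, y) ∈ ω → y ≤ b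

namespace Gate

variable {ω F : Set Plane} {c d : Plane} {a b : ℝ}

/-- If one segment from a gate reaches farther to the right and another one farther up, then the
point that combines their reaches can be seen from the gate as well: interpolate between the two
segments. -/
lemma join (g : Gate ω F a b) (h : Stair ω c d) {w₁ p w₂ q : Plane} (hw₁ : w₁ ∈ F)
    (hp : segment ℝ w₁ p ⊆ ω) (hw₂ : w₂ ∈ F) (hq : segment ℝ w₂ q ⊆ ω) (haq : a ≤ q.1)
    (hqp : q.1 ≤ p.1) (hpq : p.2 ≤ q.2) (hbq : b ≤ q.2) :
    ∃ w ∈ F, segment ℝ w (p.1, q.2) ⊆ ω := by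
  have hpω : p ∈ ω := hp (right_mem_segment _ _ _)
  have hqω : q ∈ ω := hq (right_mem_segment _ _ _)
  have htop : (a, b) ∈ ω := g.sub g.top_mem
  rcases hpq.eq_or_lt with hpq | hpq
  · rw [← hpq]
    exact ⟨w₁, hw₁, hp⟩
  rcases haq.eq_or_lt with haq | haq
  · have hqb : q.2 = b := le_antisymm (g.top _ (by rw [haq]; exact hqω)) hbq
    refine ⟨(a, b), g.top_mem, ?_⟩
    have h1 : (p.1, b) ∈ ω := h.upper_right htop hpω (by linarith) (by linarith)
    have h2 := segment_subset_of_graph (A := ω) (m := 0) (k := b) (x₀ := a) (x₁ := p.1)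
      (by linarith) (fun x hx => by simpa using h.horiz htop h1 hx.1 hx.2)
    simpa [hqb] using h2
  have e₁ := g.line _ hw₁
  have e₂ := g.line _ hw₂
  obtain ⟨m, k, hm₁, hm₂, hm⟩ := graph_of_segment_subset (a := w₁) (b := p) (by linarith) hp
  obtain ⟨n, j, hn₁, hn₂, hn⟩ := graph_of_segment_subset (a := w₂) (b := q) (by linarith) hq
  rw [e₁] at hm₁ hm
  rw [e₂] at hn₁ hn
  have hw₁' : w₁ = (a, m * a + k) := Prod.ext e₁ hm₁
  have hw₂' : w₂ = (a, n * a + j) := Prod.ext e₂ hn₁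
  have hb₁ : m * a + k ≤ b := g.top _ (by rw [← hw₁']; exact g.sub hw₁)
  have hb₂ : n * a + j ≤ b := g.top _ (by rw [← hw₂']; exact g.sub hw₂)
  -- the first segment stays below the height of `q`
  have hσ : ∀ x ∈ Icc a p.1, m * x + k ≤ q.2 := by
    intro x hx
    have := affine_le (m := m) (k := k) (n := 0) (j := q.2) (by linarith) (by linarith) hx.1 hx.2
    linarith
  -- the part of `ω` above the first segment and below the height of `q`
  have hup : ∀ x ∈ Icc q.1 p.1, ∀ y, m * x + k ≤ y → y ≤ q.2 → (x, y) ∈ ω := by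
    intro x hx y hy₁ hy₂
    have hx' : x ∈ Icc a p.1 := ⟨by linarith [hx.1], hx.2⟩
    exact h.vert (hm x hx') (h.upper_right hqω (hm x hx') hx.1 (hσ x hx')) hy₁ hy₂
  have hq₁ : m * q.1 + k ≤ n * q.1 + j := hn₂ ▸ hσ _ ⟨by linarith, hqp⟩
  rcases le_or_gt (m * a + k) (n * a + j) with hcase | hcase
  · -- the segment from `w₁` to the combined point
    have h0 : 0 < p.1 - a := by linarith
    set n' := (q.2 - (m * a + k)) / (p.1 - a) with hn'
    have hn'0 : 0 ≤ n' := div_nonneg (by linarith) h0.le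
    set j' := m * a + k - n' * a with hj'
    have ha' : n' * a + j' = m * a + k := by rw [hj']; ring
    have hp' : n' * p.1 + j' = q.2 := by rw [hj', hn']; field_simp; ring
    refine ⟨w₁, hw₁, ?_⟩
    rw [hw₁', ← ha', ← hp']
    refine segment_subset_of_graph (by linarith) fun x hx => ?_
    have hlow : m * x + k ≤ n' * x + j' := affine_le ha'.ge (by linarith) hx.1 hx.2
    rcases le_total x q.1 with hxq | hxq
    · refine h.vert (hm x hx) (hn x ⟨hx.1, hxq⟩) hlow ?_
      refine affine_le (by linarith) ?_ hx.1 hxq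
      nlinarith
    · exact hup x ⟨hxq, hx.2⟩ _ hlow (by nlinarith [hx.2])
  · -- a convex combination of the two lines
    have hn0 : 0 ≤ n := by
      by_contra hcon
      push Not at hcon
      nlinarith
    have hτp : q.2 ≤ n * p.1 + j := by nlinarith
    have hpos : 0 < n * p.1 + j - (m * p.1 + k) := by linarith
    obtain ⟨r, hr⟩ : ∃ r, r = (q.2 - p.2) / (n * p.1 + j - (m * p.1 + k)) := ⟨_, rfl⟩
    have hr0 : 0 ≤ r := hr ▸ div_nonneg (by linarith) hpos.le
    have hr1 : r ≤ 1 := hr ▸ (div_le_one hpos).2 (by linarith)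
    have hrp : r * (n * p.1 + j - (m * p.1 + k)) = q.2 - p.2 := by
      rw [hr, div_mul_cancel₀ _ hpos.ne']
    obtain ⟨m', hm'⟩ : ∃ m', m' = (1 - r) * m + r * n := ⟨_, rfl⟩
    obtain ⟨k', hk'⟩ : ∃ k', k' = (1 - r) * k + r * j := ⟨_, rfl⟩
    have hl : ∀ x, m' * x + k' = (m * x + k) + r * (n * x + j - (m * x + k)) := by
      intro x; rw [hm', hk']; ring
    have hp' : m' * p.1 + k' = q.2 := by rw [hl, hrp]; linarith
    have hup₁ : ∀ u v : ℝ, u ≤ v → u ≤ u + r * (v - u) ∧ u + r * (v - u) ≤ v := fun u v huv =>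
      ⟨by linarith [mul_nonneg hr0 (sub_nonneg.2 huv)],
        by linarith [mul_nonneg (sub_nonneg.2 hr1) (sub_nonneg.2 huv)]⟩
    have hup₂ : ∀ u v : ℝ, v ≤ u → v ≤ u + r * (v - u) ∧ u + r * (v - u) ≤ u := fun u v huv =>
      ⟨by linarith [mul_nonneg (sub_nonneg.2 hr1) (sub_nonneg.2 huv)],
        by linarith [mul_nonneg hr0 (sub_nonneg.2 huv)]⟩
    refine ⟨(a, m' * a + k'), ?_, ?_⟩
    · rw [hw₁'] at hw₁
      rw [hw₂'] at hw₂
      rw [hl]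
      exact g.convex _ _ _ hw₂ hw₁ (hup₂ _ _ hcase.le).1 (hup₂ _ _ hcase.le).2
    · rw [← hp']
      refine segment_subset_of_graph (by linarith) fun x hx => ?_
      rcases le_total x q.1 with hxq | hxq
      · have h1 := hm x hx
        have h2 := hn x ⟨hx.1, hxq⟩
        rw [hl]
        rcases le_total (m * x + k) (n * x + j) with h3 | h3
        · exact h.vert h1 h2 (hup₁ _ _ h3).1 (hup₁ _ _ h3).2
        · exact h.vert h2 h1 (hup₂ _ _ h3).1 (hup₂ _ _ h3).2
      · refine hup x ⟨hxq, hx.2⟩ _ ?_ ?_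
        · have h3 : m * x + k ≤ n * x + j := affine_le hq₁ (by linarith) hxq hx.2
          rw [hl]; exact (hup₁ _ _ h3).1
        · have := affine_le (m := m') (k := k') (n := 0) (j := q.2) (a := q.1) (b := p.1) (x := x)
            (by rw [hl]; linarith [(hup₁ _ _ hq₁).2]) (by linarith) hxq hx.2
          linarith

/-- The points seen from a gate have a greatest element for the product order; it is the common
target of all maximal edges that cross the gate. -/
lemma exists_reach (g : Gate ω F a b) (h : Stair ω c d) :
    ∃ z, (∃ w ∈ F, segment ℝ w z ⊆ ω) ∧ (∀ w ∈ F, ∀ q, segment ℝ w q ⊆ ω → q ≤ z) ∧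
      a ≤ z.1 ∧ b ≤ z.2 := by
  have hcomp : IsCompact {e : Plane × Plane | e.1 ∈ F ∧ segment ℝ e.1 e.2 ⊆ ω} :=
    (h.compact.prod h.compact).of_isClosed_subset
      ((g.closed.preimage continuous_fst).inter (isClosed_segment_subset h.compact.isClosed))
      (fun e he => ⟨g.sub he.1, he.2 (right_mem_segment _ _ _)⟩)
  have htriv : segment ℝ ((a, b) : Plane) (a, b) ⊆ ω := by
    rw [segment_same, singleton_subset_iff]
    exact g.sub g.top_mem
  have hne : {e : Plane × Plane | e.1 ∈ F ∧ segment ℝ e.1 e.2 ⊆ ω}.Nonempty :=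
    ⟨((a, b), (a, b)), g.top_mem, htriv⟩
  obtain ⟨⟨w₁, p⟩, ⟨hw₁, hp⟩, hpmax⟩ := hcomp.exists_isMaxOn hne (f := fun e => e.2.1)
    (by fun_prop)
  obtain ⟨⟨w₂, q⟩, ⟨hw₂, hq⟩, hqmax⟩ := hcomp.exists_isMaxOn hne (f := fun e => e.2.2)
    (by fun_prop)
  have hp1 : ∀ w ∈ F, ∀ q, segment ℝ w q ⊆ ω → q.1 ≤ p.1 := fun w hw q hq =>
    hpmax (a := (w, q)) ⟨hw, hq⟩
  have hq1 : ∀ w ∈ F, ∀ r, segment ℝ w r ⊆ ω → r.2 ≤ q.2 := fun w hw r hr =>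
    hqmax (a := (w, r)) ⟨hw, hr⟩
  have hap := hp1 _ g.top_mem _ htriv
  have hbq := hq1 _ g.top_mem _ htriv
  simp only at hap hbq
  obtain ⟨w, hw, hsub⟩ : ∃ w ∈ F, segment ℝ w (p.1, q.2) ⊆ ω := by
    rcases le_or_gt a q.1 with haq | haq
    · exact g.join h hw₁ hp hw₂ hq haq (hp1 _ hw₂ _ hq) (hq1 _ hw₁ _ hp) hbq
    · -- points to the left of the gate are not higher than its top
      have hqb : q.2 = b := by
        refine le_antisymm ?_ hbq
        by_contra hcon
        push Not at hcon
        have h1 : (a, q.2) ∈ ω := h.upper_right (hq (right_mem_segment _ _ _)) (g.sub g.top_mem)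
          haq.le hcon.le
        linarith [g.top _ h1]
      rw [hqb]
      exact g.join h hw₁ hp (q := (a, b)) g.top_mem htriv le_rfl hap
        (by simpa [hqb] using hq1 _ hw₁ _ hp) le_rfl
  exact ⟨(p.1, q.2), ⟨w, hw, hsub⟩, fun w' hw' r hr => ⟨hp1 _ hw' _ hr, hq1 _ hw' _ hr⟩, hap, hbq⟩

/-- Below the height of the upper corner, some segment from the gate leads to the right and above
the gate: there is an interior point at the height of the top of the gate, and a line that rises
slightly from just below the top leads beyond it. -/
lemma exists_rising (g : Gate ω F a b) (h : Stair ω c d) (hb : c.2 < b) (hb' : b < d.2)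
    {y₀ : ℝ} (hy₀ : y₀ < b) (hF : (a, y₀) ∈ F) :
    ∃ w ∈ F, ∃ q, segment ℝ w q ⊆ ω ∧ a < q.1 ∧ b < q.2 := by
  obtain ⟨x, hx⟩ := h.dense₂ b (by rw [uIcc_of_le h.lt₂.le]; exact ⟨hb.le, hb'.le⟩) hb.ne' hb'.ne
  obtain ⟨ε, hε, hsq⟩ := mem_interior_iff_square.1 hx
  simp only at hsq
  have htop : (a, b) ∈ ω := g.sub g.top_mem
  have hax : a < x := by
    by_contra hcon
    push Not at hcon
    have h1 : (x, b + ε / 2) ∈ ω := hsq _ _ (by simpa using hε)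
      (by rw [add_sub_cancel_left, abs_of_pos (by positivity)]; linarith)
    have h2 := g.top _ (h.upper_right h1 htop hcon (by linarith))
    linarith
  have hax0 : 0 < x - a := sub_pos.2 hax
  obtain ⟨η, hη, hη₁, hη₂, hη₃⟩ : ∃ η > 0, η ≤ b - y₀ ∧ η ≤ ε / 2 ∧ η ≤ x - a :=
    ⟨min (b - y₀) (min (ε / 2) (x - a)), lt_min (by linarith) (lt_min (by linarith) hax0),
      min_le_left _ _, (min_le_right _ _).trans (min_le_left _ _),
      (min_le_right _ _).trans (min_le_right _ _)⟩
  obtain ⟨m, hm⟩ : ∃ m, m = η / (x - a) := ⟨_, rfl⟩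
  have hm0 : 0 < m := hm ▸ div_pos hη hax0
  have hm1 : m ≤ 1 := hm ▸ (div_le_one hax0).2 hη₃
  have hmx : m * (x - a) = η := by rw [hm, div_mul_cancel₀ _ hax0.ne']
  obtain ⟨k, hk⟩ : ∃ k, k = b - m * x := ⟨_, rfl⟩
  have ha : m * a + k = b - η := by rw [hk, ← hmx]; ring
  have hwF : (a, b - η) ∈ F := g.convex _ _ _ hF g.top_mem (by linarith) (by linarith)
  refine ⟨(a, m * a + k), by rw [ha]; exact hwF, (x + ε / 2, m * (x + ε / 2) + k),
    segment_subset_of_graph (by linarith) fun t ht => ?_, ?_, ?_⟩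
  · rcases le_total t x with htx | htx
    · have h1 : (x, b) ∈ ω := interior_subset hx
      have h2 : (x, b - η) ∈ ω := hsq _ _ (by simpa using hε)
        (by rw [sub_sub_cancel_left, abs_neg, abs_of_pos hη]; linarith)
      refine h.vert (h.horiz (g.sub hwF) h2 ht.1 htx) (h.horiz htop h1 ht.1 htx) ?_ ?_
      · nlinarith [ht.1]
      · rw [hk]; nlinarith
    · refine hsq _ _ ?_ ?_
      · rw [abs_of_nonneg (by linarith)]; linarith [ht.2]
      · have : m * t + k - b = m * (t - x) := by rw [hk]; ring
        rw [this, abs_of_nonneg (mul_nonneg hm0.le (by linarith))]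
        nlinarith [ht.2]
  · simp only; linarith
  · simp only; rw [hk]; nlinarith

end Gate

/-! ### The corner of the bounding box of the chosen edges -/

/-- The position of the upper right corner `z` of the bounding box of the chosen edges for which
the frontier is vertical: `z` lies on the upper part of the boundary of `ω`, it is the top of the
vertical chord of `ω` through it, and the upper end of that chord is interior below `z`. -/
structure VState (ω : Set Plane) (c d z : Plane) : Prop where
  mem : z ∈ ω
  lt₁ : c.1 < z.1
  lt₂ : c.2 < z.2
  lt_right : z.1 < d.1
  top : ∀ y, (z.1, y) ∈ ω → y ≤ z.2
  below : ∃ y₀ < z.2, ∀ y, y₀ ≤ y → y < z.2 → (z.1, y) ∈ interior ω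

/-- The position of the corner `z` for which the frontier is horizontal: the mirror image of
`VState`. -/
def HState (ω : Set Plane) (c d z : Plane) : Prop :=
  VState (swapL '' ω) (swapL c) (swapL d) (swapL z)

/-- The vertical frontier below `z`. -/
def vGate (ω : Set Plane) (z : Plane) : Set Plane := closure (interior ω ∩ {p | p.1 = z.1})

lemma Stair.convex_chord {ω : Set Plane} {c d : Plane} (h : Stair ω c d) (a : ℝ) :
    Convex ℝ (interior ω ∩ {p : Plane | p.1 = a}) := by
  rw [convex_iff_segment_subset]
  rintro p ⟨hp, hpa⟩ q ⟨hq, hqa⟩ r hr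
  obtain ⟨t, ht, h1, h2⟩ := mem_segment_iff.1 hr
  simp only [mem_ofPred_eq] at hpa hqa
  have hr1 : r.1 = a := by rw [h1, hpa, hqa]; ring
  have e : r = (a, r.2) := Prod.ext hr1 rfl
  have hp' : (a, p.2) ∈ interior ω := by rw [← hpa]; exact hp
  have hq' : (a, q.2) ∈ interior ω := by rw [← hqa]; exact hq
  refine ⟨?_, hr1⟩
  rw [e]
  rcases le_total p.2 q.2 with hpq | hpq
  · exact h.vert_int hp' hq' (by nlinarith [ht.1]) (by nlinarith [ht.2])
  · exact h.vert_int hq' hp' (by nlinarith [ht.2]) (by nlinarith [ht.1])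

lemma vGate_subset {ω : Set Plane} {c d : Plane} (h : Stair ω c d) (z : Plane) :
    vGate ω z ⊆ ω :=
  (closure_mono inter_subset_left).trans h.regular.subset

lemma fst_of_mem_vGate {ω : Set Plane} {z p : Plane} (hp : p ∈ vGate ω z) : p.1 = z.1 :=
  closure_minimal (t := {p : Plane | p.1 = z.1}) inter_subset_right
    (isClosed_eq continuous_fst continuous_const) hp

namespace VState

variable {ω : Set Plane} {c d z : Plane}

lemma mem_vGate (v : VState ω c d z) : z ∈ vGate ω z := by
  obtain ⟨y₀, hy₀, hy⟩ := v.below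
  rw [vGate, Metric.mem_closure_iff]
  intro ε hε
  have hm : 0 < min (ε / 2) (z.2 - y₀) := lt_min (by positivity) (by linarith)
  refine ⟨(z.1, z.2 - min (ε / 2) (z.2 - y₀)), ⟨hy _ ?_ (by linarith), rfl⟩, ?_⟩
  · linarith [min_le_right (ε / 2) (z.2 - y₀)]
  · rw [Prod.dist_eq, Real.dist_eq, Real.dist_eq, max_lt_iff]
    refine ⟨by simpa using hε, ?_⟩
    rw [sub_sub_cancel, abs_of_pos hm]
    linarith [min_le_left (ε / 2) (z.2 - y₀)]

lemma gate (v : VState ω c d z) (h : Stair ω c d) : Gate ω (vGate ω z) z.1 z.2 where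
  closed := isClosed_closure
  sub := vGate_subset h z
  line _ hp := fst_of_mem_vGate hp
  convex y₁ y₂ y h₁ h₂ hy₁ hy₂ := by
    refine (h.convex_chord z.1).closure.segment_subset h₁ h₂ ?_
    have hy : y ∈ segment ℝ y₁ y₂ := by
      rw [segment_eq_Icc (hy₁.trans hy₂)]; exact ⟨hy₁, hy₂⟩
    obtain ⟨a, b, ha, hb, hab, e⟩ := hy
    exact ⟨a, b, ha, hb, hab, Prod.ext (by simp [← add_mul, hab]) (by simpa using e)⟩
  top_mem := v.mem_vGate
  top := v.top

/-- Limits from the right of points of `ω` belong to the frontier. -/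
lemma mem_vGate_of_limit (v : VState ω c d z) (h : Stair ω c d) {p : Plane} (hp : p.1 = z.1)
    (hpω : p ∈ ω) (hlim : ∀ ε > 0, ∃ q ∈ ω, z.1 < q.1 ∧ |q.2 - p.2| < ε) : p ∈ vGate ω z := by
  obtain ⟨y₀, hy₀, hy⟩ := v.below
  have hpz : p.2 ≤ z.2 := v.top _ (by rw [← hp]; exact hpω)
  rcases hpz.eq_or_lt with hpz | hpz
  · rw [show p = z from Prod.ext hp hpz]
    exact v.mem_vGate
  rw [vGate, Metric.mem_closure_iff]
  intro ε hε
  obtain ⟨δ, hδ, hδ₁, hδ₂⟩ : ∃ δ > 0, δ < ε ∧ δ < z.2 - p.2 :=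
    ⟨min ε (z.2 - p.2) / 2, by have := lt_min hε (sub_pos.2 hpz); positivity,
      by linarith [min_le_left ε (z.2 - p.2), lt_min hε (sub_pos.2 hpz)],
      by linarith [min_le_right ε (z.2 - p.2), lt_min hε (sub_pos.2 hpz)]⟩
  obtain ⟨q, hq, hq1, hq2⟩ := hlim δ hδ
  refine ⟨(z.1, p.2 + δ), ⟨?_, rfl⟩, ?_⟩
  · have hk : (z.1, max y₀ (p.2 + δ)) ∈ interior ω :=
      hy _ (le_max_left _ _) (max_lt hy₀ (by linarith))
    exact h.left_side_int hq hk hq1 (le_max_right _ _) (by linarith [(abs_lt.1 hq2).2])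
  · rw [Prod.dist_eq, Real.dist_eq, Real.dist_eq, max_lt_iff]
    refine ⟨by simpa [hp] using hε, ?_⟩
    rw [sub_add_cancel_left, abs_neg, abs_of_pos hδ]
    exact hδ₁

end VState

/-- A point `z` that a rising segment reaches, but cannot pass, is the top of the vertical chord
through it if that chord has an interior point below `z`. -/
lemma Stair.vState_of_blocked {ω : Set Plane} {c d : Plane} (h : Stair ω c d) {w z : Plane}
    (hsub : segment ℝ w z ⊆ ω) (hwz₁ : w.1 < z.1) (hwz₂ : w.2 < z.2)
    (hblock : ∀ δ > 0, ∃ t ∈ Icc (1 : ℝ) (1 + δ), w + t • (z - w) ∉ ω)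
    {y : ℝ} (hy : (z.1, y) ∈ interior ω) (hyz : y < z.2) : VState ω c d z := by
  have hw := h.bounds (hsub (left_mem_segment _ _ _))
  have hz := h.bounds_int hy
  have hw1 : 0 < z.1 - w.1 := sub_pos.2 hwz₁
  have hw2 : 0 < z.2 - w.2 := sub_pos.2 hwz₂
  refine ⟨hsub (right_mem_segment _ _ _), by linarith, by linarith, hz.2.1, ?_,
    y, hyz, fun v hv hvz => ?_⟩
  · intro v hv
    by_contra hcon
    push Not at hcon
    obtain ⟨ε, hε, hsq⟩ := mem_interior_iff_square.1 hy
    simp only at hsq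
    have hv0 : 0 < v - z.2 := sub_pos.2 hcon
    obtain ⟨t, ht, hn⟩ := hblock (min (ε / 2 / (z.1 - w.1)) ((v - z.2) / (z.2 - w.2)))
      (lt_min (by positivity) (by positivity))
    have ht1 : t - 1 ≤ ε / 2 / (z.1 - w.1) := by
      linarith [ht.2, min_le_left (ε / 2 / (z.1 - w.1)) ((v - z.2) / (z.2 - w.2))]
    have ht2 : t - 1 ≤ (v - z.2) / (z.2 - w.2) := by
      linarith [ht.2, min_le_right (ε / 2 / (z.1 - w.1)) ((v - z.2) / (z.2 - w.2))]
    rw [le_div_iff₀ hw1] at ht1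
    rw [le_div_iff₀ hw2] at ht2
    have ht0 : 0 ≤ t - 1 := by linarith [ht.1]
    have hx0 := mul_nonneg ht0 hw1.le
    have hy0 := mul_nonneg ht0 hw2.le
    refine hn ?_
    have e : w + t • (z - w) = (z.1 + (t - 1) * (z.1 - w.1), z.2 + (t - 1) * (z.2 - w.2)) :=
      Prod.ext (by simp; ring) (by simp; ring)
    rw [e]
    have h1 : (z.1 + (t - 1) * (z.1 - w.1), y) ∈ ω := hsq _ _
      (by rw [add_sub_cancel_left, abs_of_nonneg hx0]; linarith) (by simpa using hε)
    exact h.vert h1 (h.upper_right hv h1 (by linarith) (by linarith)) (by linarith) (by linarith)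
  · obtain ⟨r, hr, hr1, hr2⟩ : ∃ r > 0, r ≤ 1 ∧ r ≤ (z.2 - v) / 2 / (z.2 - w.2) :=
      ⟨min 1 ((z.2 - v) / 2 / (z.2 - w.2)),
        lt_min one_pos (div_pos (by linarith) hw2), min_le_left _ _, min_le_right _ _⟩
    rw [le_div_iff₀ hw2] at hr2
    have hp : (z.1 - r * (z.1 - w.1), z.2 - r * (z.2 - w.2)) ∈ ω :=
      hsub (mem_segment_iff.2 ⟨1 - r, ⟨by linarith, by linarith⟩, by simp only; ring,
        by simp only; ring⟩)
    have hr3 := mul_pos hr hw1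
    exact h.right_side_int hp hy (by simp only; linarith) hv (by simp only; linarith)

/-- Where a rising visibility edge ends, the frontier is vertical or horizontal, unless the upper
corner of `ω` has been reached. -/
lemma Stair.nextState {ω : Set Plane} {c d : Plane} (h : Stair ω c d) {s : Set Plane}
    (hs : IsVisibilityEdge ω s) {w z : Plane} (hw : w ∈ s) (hz : z ∈ s) (hwz₁ : w.1 < z.1)
    (hwz₂ : w.2 < z.2) (hle : ∀ p ∈ s, p ≤ z) (hzd : z ≠ d) :
    VState ω c d z ∨ HState ω c d z := by
  have hne : w ≠ z := fun e => by rw [e] at hwz₁; exact lt_irrefl _ hwz₁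
  have hsub : segment ℝ w z ⊆ ω := by
    obtain ⟨⟨u, v, -, rfl⟩, hin, -⟩ := hs
    exact (segment_subset_of_mem hw hz).trans hin
  have hblock : ∀ δ > 0, ∃ t ∈ Icc (1 : ℝ) (1 + δ), w + t • (z - w) ∉ ω := by
    intro δ hδ
    by_contra hcon
    push Not at hcon
    have h1 : segment ℝ z (w + (1 + δ) • (z - w)) ⊆ ω := by
      rw [segment_eq_image']
      rintro _ ⟨θ, hθ, rfl⟩
      have e : z + θ • (w + (1 + δ) • (z - w) - z) = w + (1 + θ * δ) • (z - w) := by module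
      simp only [e]
      exact hcon _ ⟨by nlinarith [hθ.1], by nlinarith [hθ.2]⟩
    have h2 := (hle _ (visibilityEdge_prolong hs hw hz hne (by linarith) h1)).1
    simp only [Prod.fst_add, Prod.smul_fst, Prod.fst_sub, smul_eq_mul] at h2
    nlinarith
  have hint : z ∉ interior ω := by
    intro hi
    obtain ⟨ε, hε, hsq⟩ := mem_interior_iff_square.1 hi
    have hw1 : 0 < z.1 - w.1 := sub_pos.2 hwz₁
    have hw2 : 0 < z.2 - w.2 := sub_pos.2 hwz₂
    have hw3 : 0 < z.1 - w.1 + (z.2 - w.2) := by linarith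
    obtain ⟨t, ht, hn⟩ := hblock (ε / 2 / (z.1 - w.1 + (z.2 - w.2))) (by positivity)
    have ht1 : t - 1 ≤ ε / 2 / (z.1 - w.1 + (z.2 - w.2)) := by linarith [ht.2]
    rw [le_div_iff₀ hw3] at ht1
    have ht0 : 0 ≤ t - 1 := by linarith [ht.1]
    have hx0 := mul_nonneg ht0 hw1.le
    have hy0 := mul_nonneg ht0 hw2.le
    refine hn ?_
    have e : w + t • (z - w) = (z.1 + (t - 1) * (z.1 - w.1), z.2 + (t - 1) * (z.2 - w.2)) :=
      Prod.ext (by simp; ring) (by simp; ring)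
    rw [e]
    refine hsq _ _ ?_ ?_
    · rw [add_sub_cancel_left, abs_of_nonneg hx0]; linarith
    · rw [add_sub_cancel_left, abs_of_nonneg hy0]; linarith
  have hzω : z ∈ ω := hsub (right_mem_segment _ _ _)
  have hwb := h.bounds (hsub (left_mem_segment _ _ _))
  have hzb := h.bounds hzω
  have hV : ∀ y, (z.1, y) ∈ interior ω → y < z.2 → VState ω c d z := fun y hy hyz =>
    h.vState_of_blocked hsub hwz₁ hwz₂ hblock hy hyz
  have hH : ∀ x, (x, z.2) ∈ interior ω → x < z.1 → HState ω c d z := by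
    intro x hx hxz
    refine h.swap.vState_of_blocked (w := swapL w) (z := swapL z) ?_ hwz₂ hwz₁ ?_ (y := x)
      (mem_interior_swapL_image.2 hx) hxz
    · have := image_segment ℝ swapL.toLinearEquiv.toLinearMap.toAffineMap w z
      exact this.ge.trans (image_mono hsub)
    · intro δ hδ
      obtain ⟨t, ht, hn⟩ := hblock δ hδ
      refine ⟨t, ht, fun hm => hn ?_⟩
      rw [mem_swapL_image] at hm
      exact hm
  by_cases hz1 : z.1 = d.1
  · have hz2 : z.2 ≠ d.2 := fun e => hzd (Prod.ext hz1 e)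
    obtain ⟨x, hx⟩ := h.dense₂ z.2 (by rw [uIcc_of_le h.lt₂.le]; exact ⟨hzb.2.2.1, hzb.2.2.2⟩)
      (by linarith : c.2 < z.2).ne' hz2
    exact Or.inr (hH x hx (by rw [hz1]; exact (h.bounds_int hx).2.1))
  obtain ⟨y, hy⟩ := h.dense₁ z.1 (by rw [uIcc_of_le h.lt₁.le]; exact ⟨hzb.1, hzb.2.1⟩)
    (by linarith : c.1 < z.1).ne' hz1
  rcases lt_trichotomy y z.2 with hyz | hyz | hyz
  · exact Or.inl (hV y hy hyz)
  · rw [hyz] at hy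
    exact absurd hy hint
  have hz2 : z.2 < d.2 := lt_trans hyz (h.bounds_int hy).2.2.2
  obtain ⟨x, hx⟩ := h.dense₂ z.2 (by rw [uIcc_of_le h.lt₂.le]; exact ⟨hzb.2.2.1, hzb.2.2.2⟩)
    (by linarith : c.2 < z.2).ne' hz2.ne
  rcases lt_trichotomy x z.1 with hxz | hxz | hxz
  · exact Or.inr (hH x hx hxz)
  · rw [hxz] at hx
    exact absurd hx hint
  · exact absurd (h.lower_left_int hy hx hxz.le hyz.le) hint

/-! ### The first edge -/

/-- The segments that start on the vertical extreme edge at `c` and are maximal there. -/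
def LeftMax (ω : Set Plane) (c d : Plane) : Plane × Plane → Prop :=
  IsLexMax {e : Plane × Plane | e.1 ∈ ω ∧ e.1.1 = c.1 ∧ IsVisibilityEdge ω (segment ℝ e.1 e.2)}
    (fun t => hAdvance ∅ (segment ℝ t.1 t.2)) (fun t => advanceTowards c.2 d.2 t.1.2 t.2.2)

/-- The segments that start on the horizontal extreme edge at `c` and are maximal there. -/
def BottomMax (ω : Set Plane) (c d : Plane) : Plane × Plane → Prop :=
  IsLexMax {e : Plane × Plane | e.1 ∈ ω ∧ e.1.2 = c.2 ∧ IsVisibilityEdge ω (segment ℝ e.1 e.2)}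
    (fun t => vAdvance ∅ (segment ℝ t.1 t.2)) (fun t => advanceTowards c.1 d.1 t.1.1 t.2.1)

/-- The maximal extreme corner visibility edges at `c`, described without reference to the boundary
polygon. -/
def CornerEdge (ω : Set Plane) (c d : Plane) (s : Set Plane) : Prop :=
  ∃ b, s = segment ℝ c b ∧ (LeftMax ω c d (c, b) ∨ BottomMax ω c d (c, b))

/-- `z` is the greatest point seen from the left side of `ω`. It is higher than the left side,
unless the left side has the full height of `ω`. -/
structure LeftReach (ω : Set Plane) (c d z : Plane) : Prop where
  seen : ∃ w ∈ ω, w.1 = c.1 ∧ segment ℝ w z ⊆ ω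
  max : ∀ w ∈ ω, w.1 = c.1 → ∀ q, segment ℝ w q ⊆ ω → q ≤ z
  lt₁ : c.1 < z.1
  lt₂ : c.2 < z.2
  above : (c.1, d.2) ∈ ω ∨ ∀ w ∈ ω, w.1 = c.1 → w.2 < z.2

lemma swapL_image_segment (a b : Plane) :
    swapL '' segment ℝ a b = segment ℝ (swapL a) (swapL b) :=
  image_segment ℝ swapL.toLinearEquiv.toLinearMap.toAffineMap a b

lemma segment_subset_swapL_image {ω : Set Plane} {a b : Plane} :
    segment ℝ (swapL a) (swapL b) ⊆ swapL '' ω ↔ segment ℝ a b ⊆ ω := by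
  rw [← swapL_image_segment]
  exact image_subset_image_iff swapL.injective

lemma hAdvance_empty_segment (a b : Plane) : hAdvance ∅ (segment ℝ a b) = |b.1 - a.1| := by
  have e : Prod.fst '' segment ℝ a b = segment ℝ a.1 b.1 :=
    image_segment ℝ (LinearMap.fst ℝ ℝ ℝ).toAffineMap a b
  rw [hAdvance, e, sUnion_empty, image_empty, sdiff_empty, segment_eq_uIcc, Real.volume_interval,
    ENNReal.toReal_ofReal (abs_nonneg _)]

variable {ω : Set Plane} {c d : Plane}

lemma Stair.exists_leftReach (h : Stair ω c d) : ∃ z, LeftReach ω c d z := by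
  have hcl : IsClosed (ω ∩ {p : Plane | p.1 = c.1}) :=
    h.compact.isClosed.inter (isClosed_eq continuous_fst continuous_const)
  obtain ⟨q, ⟨hqω, hqc⟩, hq⟩ := (h.compact.of_isClosed_subset hcl inter_subset_left).exists_isMaxOn
    ⟨c, h.low_mem, rfl⟩ (f := Prod.snd) (by fun_prop)
  simp only [mem_ofPred_eq] at hqc
  have hqe : (c.1, q.2) = q := Prod.ext hqc.symm rfl
  have hmax : ∀ y, (c.1, y) ∈ ω → y ≤ q.2 := fun y hy => hq (a := (c.1, y)) ⟨hy, rfl⟩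
  have g : Gate ω (ω ∩ {p : Plane | p.1 = c.1}) c.1 q.2 :=
    ⟨hcl, inter_subset_left, fun p hp => hp.2,
      fun y₁ y₂ y h₁ h₂ hy₁ hy₂ => ⟨h.vert h₁.1 h₂.1 hy₁ hy₂, rfl⟩,
      ⟨by rw [hqe]; exact hqω, rfl⟩, hmax⟩
  obtain ⟨z, ⟨w, ⟨hw, hwc⟩, hwz⟩, hz, hz1, hz2⟩ := g.exists_reach h
  obtain ⟨y, hyc, hy⟩ := h.side₂
  have hyc' : c.2 < y := lt_of_le_of_ne (h.bounds hy).2.2.1 hyc.symm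
  have hqy := hmax y hy
  obtain ⟨x, hxc, hx⟩ := h.side₁
  have hxc' : c.1 < x := lt_of_le_of_ne (h.bounds hx).1 hxc.symm
  have hcx : segment ℝ c (x, c.2) ⊆ ω := by
    have h1 := segment_subset_of_graph (A := ω) (m := 0) (k := c.2) (x₀ := c.1) (x₁ := x)
      hxc'.le (fun t ht => by simpa using h.horiz h.low_mem hx ht.1 ht.2)
    simpa using h1
  have hzx := (hz c ⟨h.low_mem, rfl⟩ _ hcx).1
  refine ⟨z, ⟨w, hw, hwc, hwz⟩, fun w hw hwc => hz w ⟨hw, hwc⟩, hxc'.trans_le hzx,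
    by linarith, ?_⟩
  have hqd := (h.bounds hqω).2.2.2
  rcases hqd.eq_or_lt with hqd | hqd
  · left
    rw [← hqd, hqe]
    exact hqω
  · right
    intro w hw hwc
    obtain ⟨w', hw', r, hr, -, hr2⟩ := g.exists_rising h (by linarith) hqd (y₀ := c.2)
      (by linarith) ⟨h.low_mem, rfl⟩
    have h1 := (hz w' hw' r hr).2
    have h2 : w.2 ≤ q.2 := hmax _ (by rw [← hwc]; exact hw)
    linarith

lemma LeftReach.isVisibilityEdge {z w : Plane} (h : Stair ω c d) (r : LeftReach ω c d z)
    (hw : w ∈ ω) (hwc : w.1 = c.1) {q : Plane} (hq : segment ℝ w q ⊆ ω) (hqz : q.1 = z.1) :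
    IsVisibilityEdge ω (segment ℝ w q) :=
  isVisibilityEdge_of_extreme (by rw [hwc, hqz]; exact r.lt₁) hq
    (fun p hp => by rw [hwc]; exact (h.bounds hp).1)
    (fun p hp => by rw [hqz]; exact (r.max w hw hwc p hp).1)

lemma LeftReach.leftMax {z : Plane} (h : Stair ω c d) (r : LeftReach ω c d z)
    (hcz : segment ℝ c z ⊆ ω) : LeftMax ω c d (c, z) := by
  refine ⟨⟨h.low_mem, rfl, r.isVisibilityEdge h h.low_mem rfl hcz rfl⟩, ?_⟩
  rintro ⟨a, b⟩ ⟨ha, hac, hab⟩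
  simp only at ha hac hab
  have h1 := r.max a ha hac b hab.inside
  have h2 := h.bounds (hab.inside (right_mem_segment _ _ _))
  have h3 := h.bounds ha
  refine ⟨?_, fun _ => ?_⟩
  · simp only [hAdvance_empty_segment]
    rw [hac, abs_of_nonneg (by linarith), abs_of_pos (by linarith [r.lt₁])]
    linarith [h1.1]
  · simp only [advanceTowards, if_pos h.lt₂.le]
    exact max_le_max le_rfl (by linarith [h1.2])

lemma LeftReach.eq_of_leftMax {z b : Plane} (h : Stair ω c d) (r : LeftReach ω c d z)
    (hb : LeftMax ω c d (c, b)) : b = z := by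
  obtain ⟨⟨-, -, hvis⟩, hmax⟩ := hb
  simp only at hvis
  have hbz := r.max c h.low_mem rfl b hvis.inside
  obtain ⟨w, hw, hwc, hwz⟩ := r.seen
  have hb' := h.bounds (hvis.inside (right_mem_segment _ _ _))
  have hw' := h.bounds hw
  have h1 := (hmax (w, z) ⟨hw, hwc, r.isVisibilityEdge h hw hwc hwz rfl⟩).1
  simp only [hAdvance_empty_segment] at h1
  rw [hwc, abs_of_pos (by linarith [r.lt₁]), abs_of_nonneg (by linarith)] at h1
  have hb1 : b.1 = z.1 := le_antisymm hbz.1 (by linarith)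
  -- the region between the two segments contains the diagonal from `c` to `z`
  have hcz : segment ℝ c z ⊆ ω := by
    intro p hp
    obtain ⟨t, ht, hp1, hp2⟩ := mem_segment_iff.1 hp
    have q₁ : (p.1, c.2 + t * (b.2 - c.2)) ∈ ω := hvis.inside
      (mem_segment_iff.2 ⟨t, ht, by rw [hb1]; exact hp1, rfl⟩)
    have q₂ : (p.1, w.2 + t * (z.2 - w.2)) ∈ ω := hwz
      (mem_segment_iff.2 ⟨t, ht, by rw [hwc]; exact hp1, rfl⟩)
    have ht0 := ht.1
    have ht1 := ht.2
    have hb2 := hbz.2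
    refine h.vert (y := p.2) q₁ q₂ ?_ ?_ <;> rw [hp2]
    · nlinarith
    · nlinarith
  have h2 := (hmax (c, z) ⟨h.low_mem, rfl, r.isVisibilityEdge h h.low_mem rfl hcz rfl⟩).2 (by
    simp only [hAdvance_empty_segment, hb1])
  simp only [advanceTowards, if_pos h.lt₂.le] at h2
  rw [max_eq_right (by linarith [r.lt₂]), max_eq_right (by linarith)] at h2
  exact Prod.ext hb1 (le_antisymm hbz.2 (by linarith))

/-- Two lines, the first one above `c` and the second one below `c`, have a convex combination that
passes through `c`. It stays in `ω` as long as both of them do. -/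
lemma Stair.exists_line_through_corner (h : Stair ω c d) {m k n j x₀ al ab : ℝ}
    (hl : ∀ x ∈ Icc c.1 al, (x, m * x + k) ∈ ω) (hb : ∀ x ∈ Icc x₀ ab, (x, n * x + j) ∈ ω)
    (hx₀ : c.1 ≤ x₀) (hx₀ω : (x₀, c.2) ∈ ω) (hn₀ : n * x₀ + j = c.2) (hm : 0 ≤ m) (hn : 0 < n)
    (hk : c.2 ≤ m * c.1 + k) : ∃ r : ℝ, 0 ≤ r ∧ r ≤ 1 ∧ (r = 0 → m * c.1 + k = c.2) ∧ ∃ M K,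
      0 ≤ M ∧ M * c.1 + K = c.2 ∧ (∀ x, M * x + K = (m * x + k) + r * (n * x + j - (m * x + k))) ∧
      ∀ x, c.1 ≤ x → x ≤ al → x ≤ ab → (x, M * x + K) ∈ ω := by
  have hj : n * c.1 + j ≤ c.2 := by nlinarith
  obtain ⟨r, hr0, hr1, hr⟩ : ∃ r : ℝ, 0 ≤ r ∧ r ≤ 1 ∧
      (m * c.1 + k) + r * (n * c.1 + j - (m * c.1 + k)) = c.2 := by
    rcases hk.eq_or_lt with hk | hk
    · exact ⟨0, le_rfl, zero_le_one, by linarith⟩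
    · have hpos : 0 < m * c.1 + k - (n * c.1 + j) := by linarith
      refine ⟨(m * c.1 + k - c.2) / (m * c.1 + k - (n * c.1 + j)), div_nonneg (by linarith) hpos.le,
        (div_le_one hpos).2 (by linarith), ?_⟩
      have := div_mul_cancel₀ (m * c.1 + k - c.2) hpos.ne'
      linarith
  have hM : 0 ≤ (1 - r) * m + r * n :=
    add_nonneg (mul_nonneg (by linarith) hm) (mul_nonneg hr0 hn.le)
  have hform : ∀ x, ((1 - r) * m + r * n) * x + ((1 - r) * k + r * j) =
      (m * x + k) + r * (n * x + j - (m * x + k)) := fun x => by ring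
  have hcM : ((1 - r) * m + r * n) * c.1 + ((1 - r) * k + r * j) = c.2 := by rw [hform, hr]
  refine ⟨r, hr0, hr1, fun h0 => by rw [h0] at hr; linarith, _, _, hM, hcM, hform,
    fun x hcx hxl hxb => ?_⟩
  have h1 := hl x ⟨hcx, hxl⟩
  have h1' := (h.bounds h1).2.2.1
  simp only at h1'
  rcases le_total x₀ x with hx | hx
  · have h2 := hb x ⟨hx, hxb⟩
    rw [hform]
    rcases le_total (m * x + k) (n * x + j) with h3 | h3
    · exact h.vert h1 h2 (by linarith [mul_nonneg hr0 (sub_nonneg.2 h3)])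
        (by linarith [mul_nonneg (sub_nonneg.2 hr1) (sub_nonneg.2 h3)])
    · exact h.vert h2 h1 (by linarith [mul_nonneg (sub_nonneg.2 hr1) (sub_nonneg.2 h3)])
        (by linarith [mul_nonneg hr0 (sub_nonneg.2 h3)])
  · have h2 : (x, c.2) ∈ ω := h.horiz h.low_mem hx₀ω hcx hx
    refine h.vert h2 h1 ?_ ?_
    · linarith [mul_nonneg hM (sub_nonneg.2 hcx)]
    · have h3 : n * x + j ≤ m * x + k := by nlinarith
      rw [hform]
      linarith [mul_nonneg hr0 (sub_nonneg.2 h3)]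

lemma segment_from_corner {A : Set Plane} {c q : Plane} {M K : ℝ} (hc : M * c.1 + K = c.2)
    (hq : M * q.1 + K = q.2) (hcq : c.1 ≤ q.1) (hs : ∀ x ∈ Icc c.1 q.1, (x, M * x + K) ∈ A) :
    segment ℝ c q ⊆ A := by
  have := segment_subset_of_graph hcq hs
  rwa [hc, hq] at this

/-- If less of the horizontal extent of `ω` can be seen from the left side than from the bottom
side, then `c` sees as far as the whole left side. -/
lemma LeftReach.seen_of_lt {zl zb : Plane} (h : Stair ω c d) (rl : LeftReach ω c d zl)
    {w : Plane} (hw : w ∈ ω) (hwc : w.2 = c.2) (hwz : segment ℝ w zb ⊆ ω) (hlt : w.1 < zb.1)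
    (hlt' : c.2 < zb.2) (hz : zl.1 < zb.1) : segment ℝ c zl ⊆ ω := by
  obtain ⟨w', hw', hwc', hwz'⟩ := rl.seen
  have hrl := rl.lt₁
  obtain ⟨m, k, hm₁, hm₂, hl⟩ := graph_of_segment_subset (by rw [hwc']; exact rl.lt₁) hwz'
  obtain ⟨n, j, hn₁, hn₂, hb⟩ := graph_of_segment_subset hlt hwz
  rw [hwc'] at hl hm₁
  rw [hwc] at hn₁
  have hw'b := h.bounds hw'
  have hm0 : 0 ≤ m := by
    have h1 := (rl.max w' hw' hwc' w' (by simpa using hw')).2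
    by_contra hcon
    push Not at hcon
    nlinarith
  have hn0 : 0 < n := by
    by_contra hcon
    push Not at hcon
    nlinarith
  obtain ⟨r, hr0, hr1, hr, M, K, hM, hc, hform, hin⟩ := h.exists_line_through_corner hl hb
    (h.bounds hw).1 (by rw [← hwc]; exact hw) hn₁.symm hm0 hn0 (by linarith)
  have hcz : segment ℝ c (zl.1, M * zl.1 + K) ⊆ ω := segment_from_corner hc rfl hrl.le
    fun x hx => hin x hx.1 hx.2 (hx.2.trans hz.le)
  have hle := (rl.max c h.low_mem rfl _ hcz).2
  simp only at hle
  have hform' := hform zl.1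
  rcases hle.eq_or_lt with hle | hle
  · have e : (zl.1, M * zl.1 + K) = zl := Prod.ext rfl hle
    rwa [e] at hcz
  -- otherwise the line through `c` leads farther to the right than anything seen from the left
  exfalso
  have hgap : 0 < m * zl.1 + k - (n * zl.1 + j) := by
    by_contra hcon
    push Not at hcon
    have : 0 ≤ r * (n * zl.1 + j - (m * zl.1 + k)) := mul_nonneg hr0 (by linarith)
    linarith
  have hgap' : 0 ≤ M * zl.1 + K - (n * zl.1 + j) := by
    rw [hform']
    nlinarith
  obtain ⟨δ, hδ, hδ₁, hδ₂, hδ₃⟩ : ∃ δ > 0, zl.1 + δ ≤ zb.1 ∧ M * (zl.1 + δ) + K ≤ zl.2 ∧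
      δ * n ≤ m * zl.1 + k - (n * zl.1 + j) := by
    have h1 : 0 < zb.1 - zl.1 := sub_pos.2 hz
    have h2 : 0 < (zl.2 - (M * zl.1 + K)) / (M + 1) := div_pos (by linarith) (by linarith)
    have h3 : 0 < (m * zl.1 + k - (n * zl.1 + j)) / n := div_pos hgap hn0
    refine ⟨min (zb.1 - zl.1) (min _ _), lt_min h1 (lt_min h2 h3), ?_, ?_, ?_⟩
    · linarith [min_le_left (zb.1 - zl.1) (min ((zl.2 - (M * zl.1 + K)) / (M + 1))
        ((m * zl.1 + k - (n * zl.1 + j)) / n))]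
    · have h4 := (min_le_right (zb.1 - zl.1) (min ((zl.2 - (M * zl.1 + K)) / (M + 1))
        ((m * zl.1 + k - (n * zl.1 + j)) / n))).trans (min_le_left _ _)
      rw [le_div_iff₀ (by linarith)] at h4
      have h5 := lt_min h1 (lt_min h2 h3)
      nlinarith
    · have h4 := (min_le_right (zb.1 - zl.1) (min ((zl.2 - (M * zl.1 + K)) / (M + 1))
        ((m * zl.1 + k - (n * zl.1 + j)) / n))).trans (min_le_right _ _)
      rwa [le_div_iff₀ hn0] at h4
  have hzl : zl ∈ ω := hwz' (right_mem_segment _ _ _)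
  have hfar : segment ℝ c (zl.1 + δ, M * (zl.1 + δ) + K) ⊆ ω := by
    refine segment_from_corner hc rfl (by simp only; linarith) fun x hx => ?_
    simp only at hx
    rcases le_total x zl.1 with hxz | hxz
    · exact hin x hx.1 hxz (by linarith)
    have hMx : M * x + K ≤ zl.2 := by nlinarith [hx.2]
    have hMc : c.2 ≤ M * x + K := by nlinarith [hx.1]
    rcases le_total w.1 x with hwx | hwx
    · have h1 := hb x ⟨hwx, by linarith [hx.2]⟩
      have h2 : n * x + j ≤ M * x + K := by
        have h3 : 0 ≤ m * x + k - (n * x + j) := by nlinarith [hx.2]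
        rw [hform]
        nlinarith
      exact h.vert h1 (h.upper_right hzl h1 hxz (by linarith)) h2 hMx
    · have h1 : (x, c.2) ∈ ω :=
        h.horiz h.low_mem (by rw [← hwc]; exact hw) hx.1 hwx
      exact h.vert h1 (h.upper_right hzl h1 hxz (by linarith)) hMc hMx
  have := (rl.max c h.low_mem rfl _ hfar).1
  simp only at this
  linarith

/-- The corner `c` sees as far as the whole left side of `ω`, or as far as the whole bottom
side. -/
lemma Stair.seen_from_corner {zl zb : Plane} (h : Stair ω c d) (rl : LeftReach ω c d zl)
    (rb : LeftReach (swapL '' ω) (swapL c) (swapL d) (swapL zb)) :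
    segment ℝ c zl ⊆ ω ∨ segment ℝ c zb ⊆ ω := by
  have key : ∀ {ω c d zl}, Stair ω c d → LeftReach ω c d zl → (d.1, c.2) ∈ ω →
      segment ℝ c zl ⊆ ω := by
    intro ω c d zl h rl hd
    obtain ⟨w', hw', hwc', hwz'⟩ := rl.seen
    have hw'b := h.bounds hw'
    intro p hp
    obtain ⟨t, ht, hp1, hp2⟩ := mem_segment_iff.1 hp
    have q₂ : (p.1, w'.2 + t * (zl.2 - w'.2)) ∈ ω := hwz'
      (mem_segment_iff.2 ⟨t, ht, by rw [hwc']; exact hp1, rfl⟩)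
    have hb := h.bounds q₂
    have q₁ : (p.1, c.2) ∈ ω := h.horiz h.low_mem hd hb.1 hb.2.1
    have ht0 := ht.1
    have ht1 := ht.2
    refine h.vert (y := p.2) q₁ q₂ ?_ ?_ <;> rw [hp2]
    · nlinarith [rl.lt₂]
    · nlinarith
  rcases rb.above with hd | hab
  · exact Or.inl (key h rl (mem_swapL_image.1 hd))
  rcases rl.above with hd | hal
  · right
    have h1 : segment ℝ (swapL c) (swapL zb) ⊆ swapL '' ω :=
      key h.swap rb (mem_swapL_image.2 hd)
    exact segment_subset_swapL_image.1 h1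
  obtain ⟨w₁, hw₁, hwc₁, hwz₁⟩ := rl.seen
  obtain ⟨w₂, hw₂, hwc₂, hwz₂⟩ := rb.seen
  have hlt₁ := hal w₁ hw₁ hwc₁
  have hlt₂ := hab w₂ hw₂ hwc₂
  have hrb := rb.lt₁
  rw [mem_swapL_image] at hw₂
  have e₂ : swapL (swapL w₂) = w₂ := rfl
  rw [← e₂] at hwz₂
  rw [segment_subset_swapL_image] at hwz₂
  rcases lt_or_ge zl.1 zb.1 with hz₁ | hz₁
  · exact Or.inl (rl.seen_of_lt h hw₂ hwc₂ hwz₂ hlt₂ hrb hz₁)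
  rcases lt_or_ge zb.2 zl.2 with hz₂ | hz₂
  · right
    have h1 := rb.seen_of_lt (zb := swapL zl) (w := swapL w₁) h.swap
      (mem_image_of_mem _ hw₁) hwc₁ (segment_subset_swapL_image.2 hwz₁) hlt₁ rl.lt₁ hz₂
    exact segment_subset_swapL_image.1 h1
  -- the segment from the bottom ends above the one from the left
  obtain ⟨m, k, hm₁, hm₂, hl⟩ := graph_of_segment_subset (by rw [hwc₁]; exact rl.lt₁) hwz₁
  obtain ⟨n, j, hn₁, hn₂, hb⟩ := graph_of_segment_subset (a := swapL w₂) hlt₂ hwz₂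
  simp only [swapL_apply] at hn₁ hn₂ hb hwc₂ hlt₂ hrb
  rw [hwc₁] at hl hm₁
  rw [hwc₂] at hn₁
  rw [hwc₂] at hw₂
  have hw₁b := h.bounds hw₁
  have hw₂b := h.bounds hw₂
  have hrl := rl.lt₁
  simp only at hw₂b
  have hm0 : 0 ≤ m := by
    by_contra hcon
    push Not at hcon
    nlinarith
  have hn0 : 0 < n := by
    by_contra hcon
    push Not at hcon
    nlinarith
  obtain ⟨r, hr0, hr1, hr, M, K, hM, hc, hform, hin⟩ := h.exists_line_through_corner hl hb
    hw₂b.1 hw₂ hn₁.symm hm0 hn0 (by linarith)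
  have hcb : c.1 < zb.1 := by linarith
  have hzb : zb ∈ ω := hwz₂ (right_mem_segment _ _ _)
  have hσb : m * zb.1 + k ≤ zb.2 := by linarith [mul_le_mul_of_nonneg_left hz₁ hm0]
  have hℓb : M * zb.1 + K ≤ zb.2 := by
    rw [hform, ← hn₂]
    linarith [mul_nonneg (sub_nonneg.2 hr1) (sub_nonneg.2 hσb)]
  have hσc : n * c.1 + j ≤ m * c.1 + k := by
    linarith [mul_le_mul_of_nonneg_left hw₂b.1 hn0.le]
  have hmn : m ≤ n := by
    by_contra hcon
    push Not at hcon
    linarith [mul_pos (sub_pos.2 hcon) (sub_pos.2 hcb)]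
  have hord : ∀ x, zb.1 ≤ x → m * x + k ≤ n * x + j := fun x hx => by
    linarith [mul_nonneg (sub_nonneg.2 hmn) (sub_nonneg.2 hx)]
  have hMmono : ∀ x y, x ≤ y → M * x + K ≤ M * y + K := fun x y hxy => by
    linarith [mul_le_mul_of_nonneg_left hxy hM]
  -- beyond the end of the segment from the bottom, up to the height of that end
  have hbeyond : ∀ x, zb.1 ≤ x → x ≤ zl.1 → M * x + K ≤ zb.2 → (x, M * x + K) ∈ ω := by
    intro x hx₁ hx₂ hx₃
    have h1 := hl x ⟨by linarith, hx₂⟩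
    have h2 := hord x hx₁
    have h3 : m * x + k ≤ M * x + K := by
      rw [hform]
      linarith [mul_nonneg hr0 (sub_nonneg.2 h2)]
    exact h.vert h1 (h.upper_right hzb h1 hx₁ (by linarith)) h3 hx₃
  rcases le_or_gt (M * zl.1 + K) zb.2 with hend | hend
  · left
    have hcz : segment ℝ c (zl.1, M * zl.1 + K) ⊆ ω := segment_from_corner hc rfl hrl.le
      fun x hx => by
        rcases le_total x zb.1 with hxb | hxb
        · exact hin x hx.1 hx.2 hxb
        · exact hbeyond x hxb hx.2 ((hMmono _ _ hx.2).trans hend)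
    have hle := (rl.max c h.low_mem rfl _ hcz).2
    simp only at hle
    have h2 := hord zl.1 hz₁
    have h3 : zl.2 ≤ M * zl.1 + K := by
      rw [hform, ← hm₂]
      rw [← hm₂] at h2
      linarith [mul_nonneg hr0 (sub_nonneg.2 h2)]
    have e : (zl.1, M * zl.1 + K) = zl := Prod.ext rfl (le_antisymm hle h3)
    rwa [e] at hcz
  · right
    have hM0 : 0 < M := by
      by_contra hcon
      push Not at hcon
      nlinarith
    obtain ⟨x, hx⟩ : ∃ x, x = (zb.2 - K) / M := ⟨_, rfl⟩
    have hxM : M * x + K = zb.2 := by rw [hx]; field_simp; ring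
    have hx₁ : zb.1 ≤ x := le_of_mul_le_mul_left (by linarith : M * zb.1 ≤ M * x) hM0
    have hx₂ : x ≤ zl.1 := le_of_mul_le_mul_left (by linarith : M * x ≤ M * zl.1) hM0
    have hcz : segment ℝ c (x, zb.2) ⊆ ω := segment_from_corner hc hxM (by simp only; linarith)
      fun t ht => by
        simp only at ht
        rcases le_total t zb.1 with hxb | hxb
        · exact hin t ht.1 (by linarith [ht.2]) hxb
        · exact hbeyond t hxb (by linarith [ht.2]) (hxM ▸ hMmono _ _ ht.2)
    have hle := (rb.max (swapL c) (mem_image_of_mem _ h.low_mem) rfl (swapL (x, zb.2))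
      (segment_subset_swapL_image.2 hcz)).2
    have e : (x, zb.2) = zb := Prod.ext (le_antisymm hle hx₁) rfl
    rwa [e] at hcz

/-! ### Symmetries -/

/-- The reflection of the first coordinate. -/
def flipL : Plane ≃L[ℝ] Plane := (ContinuousLinearEquiv.neg ℝ).prodCongr (.refl ℝ ℝ)

@[simp] lemma flipL_apply (p : Plane) : flipL p = (-p.1, p.2) := rfl

/-- The images of the members of a family of sets. -/
def mapSets (φ : Plane ≃L[ℝ] Plane) (S : Set (Set Plane)) : Set (Set Plane) :=
  (fun s => φ '' s) '' S

/-- A linear involution of the plane that preserves all the notions of the procedure, except that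
it may exchange horizontal and vertical. -/
structure IsSymm (φ : Plane ≃L[ℝ] Plane) : Prop where
  invol : ∀ p, φ (φ p) = p
  box : ∀ a b : Plane, ∃ a' b', φ '' Icc a b = Icc a' b'
  paths : ∀ p q, ∀ γ ∈ shortPaths p q, φ '' γ ∈ shortPaths (φ p) (φ q)
  maximal : ∀ ω S f s, IsMaximalFrontierEdge ω S f s →
    IsMaximalFrontierEdge (φ '' ω) (mapSets φ S) (φ '' f) (φ '' s)
  corner : ∀ ω c d s, c.1 ≠ d.1 → c.2 ≠ d.2 → CornerEdge ω c d s →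
    CornerEdge (φ '' ω) (φ c) (φ d) (φ '' s)

section Transport

variable {φ : Plane ≃L[ℝ] Plane} {ω f s : Set Plane} {S : Set (Set Plane)}

lemma image_image_of_invol (hφ : ∀ p, φ (φ p) = p) (A : Set Plane) : φ '' (φ '' A) = A := by
  rw [image_image]
  simp [hφ]

lemma mem_image_of_invol (hφ : ∀ p, φ (φ p) = p) {A : Set Plane} {p : Plane} :
    p ∈ φ '' A ↔ φ p ∈ A :=
  ⟨by rintro ⟨q, hq, rfl⟩; rwa [hφ], fun h => ⟨_, h, hφ p⟩⟩

lemma mapSets_mapSets (hφ : ∀ p, φ (φ p) = p) (S : Set (Set Plane)) :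
    mapSets φ (mapSets φ S) = S := by
  rw [mapSets, mapSets, image_image]
  simp [image_image_of_invol hφ]

lemma sUnion_mapSets (φ : Plane ≃L[ℝ] Plane) (S : Set (Set Plane)) :
    ⋃₀ mapSets φ S = φ '' ⋃₀ S := by
  rw [mapSets, sUnion_image, sUnion_eq_biUnion, image_iUnion₂]

lemma mapSets_edges (φ : Plane ≃L[ℝ] Plane) (l : List (Set Plane)) :
    edges (l.map (φ '' ·)) = mapSets φ (edges l) := by
  ext s
  simp [edges, mapSets]

lemma image_segment_of_equiv (φ : Plane ≃L[ℝ] Plane) (a b : Plane) :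
    φ '' segment ℝ a b = segment ℝ (φ a) (φ b) :=
  image_segment ℝ φ.toLinearEquiv.toLinearMap.toAffineMap a b

lemma IsLineSegment.image (φ : Plane ≃L[ℝ] Plane) (h : IsLineSegment s) :
    IsLineSegment (φ '' s) := by
  obtain ⟨a, b, hab, rfl⟩ := h
  exact ⟨φ a, φ b, φ.injective.ne hab, image_segment_of_equiv φ a b⟩

lemma isVisibilityEdge_image (hφ : ∀ p, φ (φ p) = p) (h : IsVisibilityEdge ω s) :
    IsVisibilityEdge (φ '' ω) (φ '' s) := by
  refine ⟨h.segment.image φ, image_mono h.inside, fun t ht htω hst => ?_⟩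
  have h1 := image_mono (f := φ) htω
  have h2 := image_mono (f := φ) hst
  rw [image_image_of_invol hφ] at h1 h2
  rw [← h.maximal _ (ht.image φ) h1 h2, image_image_of_invol hφ]

lemma interior_image_equiv (φ : Plane ≃L[ℝ] Plane) (A : Set Plane) :
    interior (φ '' A) = φ '' interior A := (φ.toHomeomorph.image_interior A).symm

lemma IsSymm.boundingBox_image (hφ : IsSymm φ) (A : Set Plane) :
    boundingBox (φ '' A) = φ '' boundingBox A := by
  have key : ∀ A, ∀ p ∈ boundingBox A, φ p ∈ boundingBox (φ '' A) := by
    rintro A p hp R ⟨⟨a, b, rfl⟩, hR⟩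
    obtain ⟨a', b', he⟩ := hφ.box a b
    have h1 := image_mono (f := φ) hR
    rw [image_image_of_invol hφ.invol] at h1
    rw [← mem_image_of_invol hφ.invol, he]
    exact hp _ ⟨⟨a', b', rfl⟩, he ▸ h1⟩
  ext p
  rw [mem_image_of_invol hφ.invol]
  constructor
  · intro hp
    have := key _ p hp
    rwa [image_image_of_invol hφ.invol] at this
  · intro hp
    have := key _ _ hp
    rwa [hφ.invol] at this

lemma IsSymm.isFrontierOf_image (hφ : IsSymm φ) (h : IsFrontierOf ω S f) :
    IsFrontierOf (φ '' ω) (mapSets φ S) (φ '' f) := by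
  obtain ⟨x, hx, rfl⟩ := h
  have e : frontier (boundingBox (⋃₀ mapSets φ S)) ∩ interior (φ '' ω) =
      φ '' (frontier (boundingBox (⋃₀ S)) ∩ interior ω) := by
    rw [sUnion_mapSets, hφ.boundingBox_image, interior_image_equiv, image_inter φ.injective]
    congr 1
    exact (φ.toHomeomorph.image_frontier _).symm
  refine ⟨φ x, e ▸ mem_image_of_mem φ hx, ?_⟩
  rw [e]
  have h1 := φ.toHomeomorph.image_connectedComponentIn hx
  have h2 := φ.toHomeomorph.image_closure
    (connectedComponentIn (frontier (boundingBox (⋃₀ S)) ∩ interior ω) x)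
  rw [h1] at h2
  exact h2

lemma IsSymm.isFrontierOf_image_iff (hφ : IsSymm φ) :
    IsFrontierOf (φ '' ω) (mapSets φ S) (φ '' f) ↔ IsFrontierOf ω S f := by
  refine ⟨fun h => ?_, hφ.isFrontierOf_image⟩
  have := hφ.isFrontierOf_image h
  rwa [image_image_of_invol hφ.invol, image_image_of_invol hφ.invol,
    mapSets_mapSets hφ.invol] at this

lemma IsSymm.isSkeleton_image (hφ : IsSymm φ) (h : IsSkeleton ω S) :
    IsSkeleton (φ '' ω) (mapSets φ S) := by
  refine ⟨?_, ?_, fun p q hp hq hpq γ hγ => ?_⟩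
  · rintro _ ⟨s, hs, rfl⟩
    exact (h.segments s hs).image φ
  · rintro _ ⟨s, hs, rfl⟩
    exact image_mono (h.inside s hs)
  · have hint : ∀ r, r ∉ interior (φ '' ω) → φ r ∉ interior ω := by
      intro r hr hr'
      rw [interior_image_equiv, mem_image_of_invol hφ.invol] at hr
      exact hr hr'
    obtain ⟨s, hs, x, hx, hxs⟩ := h.meets (φ p) (φ q) (hint p hp) (hint q hq) (by
      intro γ' hγ'
      have h1 := hφ.paths _ _ _ hγ'
      rw [hφ.invol, hφ.invol] at h1
      obtain ⟨x, hx, hxω⟩ := hpq _ h1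
      rw [interior_image_equiv, mem_image_of_invol hφ.invol] at hxω
      rw [mem_image_of_invol hφ.invol] at hx
      exact ⟨φ x, hx, hxω⟩) _ (hφ.paths _ _ _ hγ)
    rw [mem_image_of_invol hφ.invol] at hx
    exact ⟨_, mem_image_of_mem _ hs, φ x, hx, mem_image_of_mem φ hxs⟩

lemma encard_mapSets (hφ : ∀ p, φ (φ p) = p) (S : Set (Set Plane)) :
    (mapSets φ S).encard = S.encard := by
  refine Function.Injective.encard_image (fun a b hab => ?_) S
  have := congrArg (φ '' ·) hab
  simpa [image_image_of_invol hφ] using this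

lemma IsSymm.isMinimumSkeleton_of_image (hφ : IsSymm φ)
    (h : IsMinimumSkeleton (φ '' ω) (mapSets φ S)) : IsMinimumSkeleton ω S := by
  refine ⟨?_, ?_, fun T hT => ?_⟩
  · have := hφ.isSkeleton_image h.skeleton
    rwa [image_image_of_invol hφ.invol, mapSets_mapSets hφ.invol] at this
  · have := h.finite.image (φ '' ·)
    change (mapSets φ (mapSets φ S)).Finite at this
    rwa [mapSets_mapSets hφ.invol] at this
  · have := h.minimum _ (hφ.isSkeleton_image hT)
    rwa [encard_mapSets hφ.invol, encard_mapSets hφ.invol] at this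

lemma isLexMax_frontierEdges_image (hφ : ∀ p, φ (φ p) = p) {g k g' k' : Set Plane → ℝ}
    (hg : ∀ t, g' (φ '' t) = g t) (hk : ∀ t, k' (φ '' t) = k t)
    (h : IsLexMax (frontierEdges ω f) g k s) :
    IsLexMax (frontierEdges (φ '' ω) (φ '' f)) g' k' (φ '' s) := by
  obtain ⟨⟨hv, x, hxs, hxf⟩, hmax⟩ := h
  refine ⟨⟨isVisibilityEdge_image hφ hv, φ x, mem_image_of_mem _ hxs, mem_image_of_mem _ hxf⟩, ?_⟩
  rintro t ⟨ht, y, hyt, hyf⟩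
  have h1 := isVisibilityEdge_image hφ ht
  rw [image_image_of_invol hφ] at h1
  rw [mem_image_of_invol hφ] at hyf
  have h2 := hmax (φ '' t) ⟨h1, φ y, mem_image_of_mem _ hyt, hyf⟩
  have e : φ '' (φ '' t) = t := image_image_of_invol hφ t
  rw [← hg, ← hg, ← hk, ← hk, e] at h2
  exact h2

end Transport

lemma hAdvance_swap (S : Set (Set Plane)) (s : Set Plane) :
    hAdvance (mapSets swapL S) (swapL '' s) = vAdvance S s := by
  rw [hAdvance, vAdvance, sUnion_mapSets, image_image, image_image]
  rfl

lemma vAdvance_swap (S : Set (Set Plane)) (s : Set Plane) :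
    vAdvance (mapSets swapL S) (swapL '' s) = hAdvance S s := by
  rw [hAdvance, vAdvance, sUnion_mapSets, image_image, image_image]
  rfl

lemma vAdvance_flip (S : Set (Set Plane)) (s : Set Plane) :
    vAdvance (mapSets flipL S) (flipL '' s) = vAdvance S s := by
  rw [vAdvance, vAdvance, sUnion_mapSets, image_image, image_image]
  rfl

lemma hAdvance_flip (S : Set (Set Plane)) (s : Set Plane) :
    hAdvance (mapSets flipL S) (flipL '' s) = hAdvance S s := by
  have e : ∀ A : Set Plane, Prod.fst '' (flipL '' A) = -(Prod.fst '' A) := by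
    intro A
    rw [image_image, ← image_neg_eq_neg, image_image]
    rfl
  rw [hAdvance, hAdvance, sUnion_mapSets, e, e, ← Measure.measure_neg volume]
  congr 2
  ext x
  simp

lemma mapSets_empty (φ : Plane ≃L[ℝ] Plane) : mapSets φ ∅ = ∅ := image_empty _

lemma bottomMax_iff_swap {ω : Set Plane} {c d : Plane} {a b : Plane} :
    BottomMax ω c d (a, b) ↔ LeftMax (swapL '' ω) (swapL c) (swapL d) (swapL a, swapL b) := by
  have hs : ∀ p, swapL (swapL p) = p := fun p => rfl
  have hv : ∀ a b : Plane, vAdvance ∅ (segment ℝ a b) =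
      hAdvance ∅ (segment ℝ (swapL a) (swapL b)) := by
    intro a b
    rw [← swapL_image_segment, ← hAdvance_swap, mapSets_empty]
  have hC : ∀ t : Plane × Plane, (t.1 ∈ ω ∧ t.1.2 = c.2 ∧ IsVisibilityEdge ω (segment ℝ t.1 t.2)) ↔
      (swapL t.1 ∈ swapL '' ω ∧ (swapL t.1).1 = (swapL c).1 ∧
        IsVisibilityEdge (swapL '' ω) (segment ℝ (swapL t.1) (swapL t.2))) := by
    intro t
    rw [mem_image_of_invol hs, hs, ← swapL_image_segment]
    refine and_congr_right fun _ => and_congr_right fun _ =>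
      ⟨isVisibilityEdge_image hs, fun h => ?_⟩
    have := isVisibilityEdge_image hs h
    rwa [image_image_of_invol hs, image_image_of_invol hs] at this
  simp only [BottomMax, LeftMax, IsLexMax, mem_ofPred_eq, hv]
  constructor
  · rintro ⟨h1, h2⟩
    refine ⟨(hC (a, b)).1 h1, fun t ht => ?_⟩
    exact h2 (swapL t.1, swapL t.2) ((hC (swapL t.1, swapL t.2)).2 ht)
  · rintro ⟨h1, h2⟩
    refine ⟨(hC (a, b)).2 h1, fun t ht => ?_⟩
    exact h2 (swapL t.1, swapL t.2) ((hC t).1 ht)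

lemma leftMax_iff_swap {ω : Set Plane} {c d : Plane} {a b : Plane} :
    LeftMax ω c d (a, b) ↔ BottomMax (swapL '' ω) (swapL c) (swapL d) (swapL a, swapL b) := by
  rw [bottomMax_iff_swap, swapL_image_swapL_image]
  rfl

lemma isSymm_swapL : IsSymm swapL where
  invol _ := rfl
  box a b := by
    refine ⟨swapL a, swapL b, ?_⟩
    ext p
    rw [mem_swapL_image]
    simp only [mem_Icc, Prod.le_def, swapL_apply]
    tauto
  paths p q γ hγ := by
    obtain ⟨k, hk, rfl⟩ := hγ
    refine ⟨swapL k, ?_, ?_⟩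
    · rcases hk with rfl | rfl
      · exact Or.inr rfl
      · exact Or.inl rfl
    · rw [image_union, swapL_image_segment, swapL_image_segment]
  maximal ω S f s h := by
    have hs : ∀ p, swapL (swapL p) = p := fun p => rfl
    have hv : IsVertical f ↔ IsHorizontal (swapL '' f) := by
      simp only [IsVertical, IsHorizontal, forall_mem_image]
      rfl
    have hh : IsHorizontal f ↔ IsVertical (swapL '' f) := by
      simp only [IsVertical, IsHorizontal, forall_mem_image]
      rfl
    rw [IsMaximalFrontierEdge, hv, hh] at h
    rw [IsMaximalFrontierEdge]
    have h1 := isLexMax_frontierEdges_image (ω := ω) (f := f) (s := s) hs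
      (vAdvance_swap S) (hAdvance_swap S)
    have h2 := isLexMax_frontierEdges_image (ω := ω) (f := f) (s := s) hs
      (hAdvance_swap S) (vAdvance_swap S)
    rcases h with ⟨hf, h⟩ | ⟨hf, h⟩ | ⟨hf, hf', h | h⟩
    · exact Or.inr (Or.inl ⟨hf, h1 h⟩)
    · exact Or.inl ⟨hf, h2 h⟩
    · exact Or.inr (Or.inr ⟨hf', hf, Or.inr (h1 h)⟩)
    · exact Or.inr (Or.inr ⟨hf', hf, Or.inl (h2 h)⟩)
  corner ω c d s _ _ h := by
    obtain ⟨b, rfl, h⟩ := h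
    refine ⟨swapL b, swapL_image_segment c b, ?_⟩
    rcases h with h | h
    · exact Or.inr (leftMax_iff_swap.1 h)
    · exact Or.inl (bottomMax_iff_swap.1 h)

lemma isSymm_flipL : IsSymm flipL where
  invol p := by simp
  box a b := by
    refine ⟨(-b.1, a.2), (-a.1, b.2), ?_⟩
    ext p
    rw [mem_image_of_invol (fun p => by simp)]
    simp only [mem_Icc, Prod.le_def, flipL_apply]
    constructor <;> rintro ⟨⟨h1, h2⟩, h3, h4⟩ <;> refine ⟨⟨?_, h2⟩, ?_, h4⟩ <;> linarith
  paths p q γ hγ := by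
    obtain ⟨k, hk, rfl⟩ := hγ
    refine ⟨flipL k, ?_, ?_⟩
    · rcases hk with rfl | rfl
      · exact Or.inl rfl
      · exact Or.inr rfl
    · rw [image_union, image_segment_of_equiv, image_segment_of_equiv]
  maximal ω S f s h := by
    have hs : ∀ p, flipL (flipL p) = p := fun p => by simp
    have hv : IsVertical f ↔ IsVertical (flipL '' f) := by
      constructor
      · rintro h _ ⟨p, hp, rfl⟩ _ ⟨q, hq, rfl⟩
        simp [h p hp q hq]
      · intro h p hp q hq
        simpa using h _ (mem_image_of_mem _ hp) _ (mem_image_of_mem _ hq)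
    have hh : IsHorizontal f ↔ IsHorizontal (flipL '' f) := by
      simp only [IsHorizontal, forall_mem_image]
      rfl
    rw [IsMaximalFrontierEdge, hv, hh] at h
    have h1 := isLexMax_frontierEdges_image (ω := ω) (f := f) (s := s) hs
      (hAdvance_flip S) (vAdvance_flip S)
    have h2 := isLexMax_frontierEdges_image (ω := ω) (f := f) (s := s) hs
      (vAdvance_flip S) (hAdvance_flip S)
    exact h.imp (And.imp_right h1) (Or.imp (And.imp_right h2)
      (And.imp_right (And.imp_right (Or.imp h1 h2))))
  corner ω c d s hc₁ _ h := by
    have hs : ∀ p, flipL (flipL p) = p := fun p => by simp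
    have hvis : ∀ {a b : Plane}, IsVisibilityEdge (flipL '' ω) (segment ℝ a b) →
        IsVisibilityEdge ω (segment ℝ (flipL a) (flipL b)) := by
      intro a b h
      have := isVisibilityEdge_image hs h
      rwa [image_image_of_invol hs, image_segment_of_equiv] at this
    have hvis' : ∀ {a b : Plane}, IsVisibilityEdge ω (segment ℝ a b) →
        IsVisibilityEdge (flipL '' ω) (segment ℝ (flipL a) (flipL b)) := by
      intro a b h
      have := isVisibilityEdge_image hs h
      rwa [image_segment_of_equiv] at this
    have hh : ∀ a b : Plane, hAdvance ∅ (segment ℝ (flipL a) (flipL b)) =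
        hAdvance ∅ (segment ℝ a b) := by
      intro a b
      rw [← image_segment_of_equiv, ← hAdvance_flip ∅ (segment ℝ a b), mapSets_empty]
    have hv : ∀ a b : Plane, vAdvance ∅ (segment ℝ (flipL a) (flipL b)) =
        vAdvance ∅ (segment ℝ a b) := by
      intro a b
      rw [← image_segment_of_equiv, ← vAdvance_flip ∅ (segment ℝ a b), mapSets_empty]
    have ha : ∀ x y : ℝ, advanceTowards (-c.1) (-d.1) (-x) (-y) = advanceTowards c.1 d.1 x y := by
      intro x y
      rcases lt_or_gt_of_ne hc₁ with h | h
      · rw [advanceTowards, advanceTowards, if_neg (by linarith), if_pos h.le]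
        congr 1; ring
      · rw [advanceTowards, advanceTowards, if_pos (by linarith), if_neg (by linarith)]
        congr 1; ring
    obtain ⟨b, rfl, h⟩ := h
    refine ⟨flipL b, image_segment_of_equiv _ _ _, h.imp ?_ ?_⟩
    · rintro ⟨⟨h1, h2, h3⟩, hmax⟩
      refine ⟨⟨mem_image_of_mem _ h1, rfl, hvis' h3⟩, ?_⟩
      rintro ⟨x, y⟩ ⟨h4, h5, h6⟩
      have h7 := hmax (flipL x, flipL y) ⟨(mem_image_of_invol hs).1 h4,
        by simp only at h5 ⊢; rw [flipL_apply, h5, flipL_apply, neg_neg], hvis h6⟩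
      simp only [hh] at h7 ⊢
      exact h7
    · rintro ⟨⟨h1, h2, h3⟩, hmax⟩
      refine ⟨⟨mem_image_of_mem _ h1, rfl, hvis' h3⟩, ?_⟩
      rintro ⟨x, y⟩ ⟨h4, h5, h6⟩
      have h7 := hmax (flipL x, flipL y) ⟨(mem_image_of_invol hs).1 h4, h5, hvis h6⟩
      have ha' := ha (-x.1) (-y.1)
      rw [neg_neg, neg_neg] at ha'
      simp only [hv] at h7 ⊢
      simp only [flipL_apply, ha] at h7 ⊢
      rw [← ha'] at h7
      exact h7

/-! ### One step of the procedure -/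

/-- The two projections of the union of `S` are those of the box with corners `c` and `z`. -/
structure Boxed (c z : Plane) (S : Set (Set Plane)) : Prop where
  fst : Prod.fst '' ⋃₀ S = Icc c.1 z.1
  snd : Prod.snd '' ⋃₀ S = Icc c.2 z.2

lemma boundingBox_eq_Icc {A : Set Plane} {c z : Plane} (hA : A ⊆ Icc c z)
    (h₁ : c.1 ∈ Prod.fst '' A) (h₂ : z.1 ∈ Prod.fst '' A) (h₃ : c.2 ∈ Prod.snd '' A)
    (h₄ : z.2 ∈ Prod.snd '' A) : boundingBox A = Icc c z := by
  refine Subset.antisymm (fun p hp => hp _ ⟨⟨c, z, rfl⟩, hA⟩) ?_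
  rintro p ⟨hp₁, hp₂⟩ R ⟨⟨a, b, rfl⟩, hR⟩
  obtain ⟨q₁, hq₁, e₁⟩ := h₁
  obtain ⟨q₂, hq₂, e₂⟩ := h₂
  obtain ⟨q₃, hq₃, e₃⟩ := h₃
  obtain ⟨q₄, hq₄, e₄⟩ := h₄
  refine ⟨⟨(e₁ ▸ (hR hq₁).1.1).trans hp₁.1, (e₃ ▸ (hR hq₃).1.2).trans hp₁.2⟩,
    ⟨hp₂.1.trans (e₂ ▸ (hR hq₂).2.1), hp₂.2.trans (e₄ ▸ (hR hq₄).2.2)⟩⟩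

lemma Boxed.boundingBox_eq {c z : Plane} {S : Set (Set Plane)} (b : Boxed c z S)
    (h₁ : c.1 ≤ z.1) (h₂ : c.2 ≤ z.2) : boundingBox (⋃₀ S) = Icc c z := by
  refine boundingBox_eq_Icc (fun p hp => ?_) ?_ ?_ ?_ ?_
  · have hp₁ : p.1 ∈ Icc c.1 z.1 := b.fst ▸ mem_image_of_mem _ hp
    have hp₂ : p.2 ∈ Icc c.2 z.2 := b.snd ▸ mem_image_of_mem _ hp
    exact ⟨⟨hp₁.1, hp₂.1⟩, ⟨hp₁.2, hp₂.2⟩⟩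
  · rw [b.fst]; exact left_mem_Icc.2 h₁
  · rw [b.fst]; exact right_mem_Icc.2 h₁
  · rw [b.snd]; exact left_mem_Icc.2 h₂
  · rw [b.snd]; exact right_mem_Icc.2 h₂

lemma Boxed.subset_Iic {c z : Plane} {S : Set (Set Plane)} (b : Boxed c z S) {p : Plane}
    (hp : p ∈ ⋃₀ S) : c ≤ p ∧ p ≤ z := by
  have hp₁ : p.1 ∈ Icc c.1 z.1 := b.fst ▸ mem_image_of_mem _ hp
  have hp₂ : p.2 ∈ Icc c.2 z.2 := b.snd ▸ mem_image_of_mem _ hp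
  exact ⟨⟨hp₁.1, hp₂.1⟩, ⟨hp₁.2, hp₂.2⟩⟩

lemma Boxed.swap {c z : Plane} {S : Set (Set Plane)} (b : Boxed c z S) :
    Boxed (swapL c) (swapL z) (mapSets swapL S) := by
  constructor
  · rw [sUnion_mapSets, image_image]
    exact b.snd
  · rw [sUnion_mapSets, image_image]
    exact b.fst

lemma mem_frontier_Icc {c z p : Plane} (h₁ : c.1 ≤ z.1) (h₂ : c.2 ≤ z.2) :
    p ∈ frontier (Icc c z) ↔
      p ∈ Icc c z ∧ (p.1 = c.1 ∨ p.1 = z.1 ∨ p.2 = c.2 ∨ p.2 = z.2) := by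
  rw [Icc_prod_eq, frontier_prod_eq, frontier_Icc h₁, frontier_Icc h₂, closure_Icc, closure_Icc]
  simp only [mem_union, mem_prod, mem_Icc, mem_insert_iff, mem_singleton_iff]
  constructor
  · rintro (⟨h, e | e⟩ | ⟨e | e, h⟩)
    · exact ⟨⟨h, by rw [e]; exact ⟨le_rfl, h₂⟩⟩, by simp [e]⟩
    · exact ⟨⟨h, by rw [e]; exact ⟨h₂, le_rfl⟩⟩, by simp [e]⟩
    · exact ⟨⟨by rw [e]; exact ⟨le_rfl, h₁⟩, h⟩, by simp [e]⟩
    · exact ⟨⟨by rw [e]; exact ⟨h₁, le_rfl⟩, h⟩, by simp [e]⟩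
  · rintro ⟨⟨h, h'⟩, e | e | e | e⟩
    · exact Or.inr ⟨Or.inl e, h'⟩
    · exact Or.inr ⟨Or.inr e, h'⟩
    · exact Or.inl ⟨h, Or.inl e⟩
    · exact Or.inl ⟨h, Or.inr e⟩

/-- The part of a projection of a segment that is not covered by `S`, when the segment starts
within the range of `S`. -/
lemma exists_advance {π : Plane →ₗ[ℝ] ℝ} {S : Set (Set Plane)} {t : Set Plane} {l r : ℝ}
    (hS : π '' ⋃₀ S = Icc l r) (ht : IsLineSegment t) (hl : ∀ p ∈ t, l ≤ π p)
    (hr : ∃ p ∈ t, π p ≤ r) : ∃ p ∈ t, (∀ q ∈ t, π q ≤ π p) ∧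
      (volume (π '' t \ π '' ⋃₀ S)).toReal = max 0 (π p - r) := by
  obtain ⟨a, b, -, rfl⟩ := ht
  have e : π '' segment ℝ a b = Icc (min (π a) (π b)) (max (π a) (π b)) :=
    (image_segment ℝ π.toAffineMap a b).trans (segment_eq_uIcc _ _)
  obtain ⟨p, hp, hpe⟩ : max (π a) (π b) ∈ π '' segment ℝ a b := by
    rw [e]; exact right_mem_Icc.2 min_le_max
  have hmin : l ≤ min (π a) (π b) :=
    le_min (hl _ (left_mem_segment _ _ _)) (hl _ (right_mem_segment _ _ _))
  refine ⟨p, hp, fun q hq => ?_, ?_⟩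
  · have : π q ∈ π '' segment ℝ a b := mem_image_of_mem _ hq
    rw [e] at this
    exact hpe ▸ this.2
  · obtain ⟨q, hq, hqr⟩ := hr
    have hq' : π q ∈ π '' segment ℝ a b := mem_image_of_mem _ hq
    rw [e] at hq'
    have e2 : π '' segment ℝ a b \ π '' ⋃₀ S = Ioc r (π p) := by
      rw [e, hS, hpe]
      ext x
      simp only [mem_sdiff, mem_Icc, mem_Ioc, not_and, not_le]
      exact ⟨fun ⟨⟨h1, h2⟩, h3⟩ => ⟨h3 (hmin.trans h1), h2⟩,
        fun ⟨h1, h2⟩ => ⟨⟨(hq'.1.trans hqr).trans h1.le, h2⟩, fun _ => h1⟩⟩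
    rw [e2, Real.volume_Ioc, ENNReal.toReal_ofReal', max_comm]

lemma Boxed.exists_hAdvance {c z : Plane} {S : Set (Set Plane)} (b : Boxed c z S)
    {t : Set Plane} (ht : IsLineSegment t) (hc : ∀ p ∈ t, c.1 ≤ p.1) (hz : ∃ p ∈ t, p.1 ≤ z.1) :
    ∃ p ∈ t, (∀ q ∈ t, q.1 ≤ p.1) ∧ hAdvance S t = max 0 (p.1 - z.1) :=
  exists_advance (π := LinearMap.fst ℝ ℝ ℝ) b.fst ht hc hz

lemma Boxed.exists_vAdvance {c z : Plane} {S : Set (Set Plane)} (b : Boxed c z S)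
    {t : Set Plane} (ht : IsLineSegment t) (hc : ∀ p ∈ t, c.2 ≤ p.2) (hz : ∃ p ∈ t, p.2 ≤ z.2) :
    ∃ p ∈ t, (∀ q ∈ t, q.2 ≤ p.2) ∧ vAdvance S t = max 0 (p.2 - z.2) :=
  exists_advance (π := LinearMap.snd ℝ ℝ ℝ) b.snd ht hc hz

lemma IsLineSegment.isCompact {t : Set Plane} (ht : IsLineSegment t) : IsCompact t := by
  obtain ⟨a, b, -, rfl⟩ := ht
  rw [segment_eq_image']
  exact isCompact_Icc.image (by fun_prop)

/-- If finitely many segments cover all vertical lines slightly to the right of `x = a`, then one of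
them starts on that line and leads to the right. -/
lemma exists_limit_from_right {T : Set (Set Plane)} (hT : T.Finite)
    (hseg : ∀ t ∈ T, IsLineSegment t) {a b : ℝ} (hab : a < b)
    (hcov : ∀ x ∈ Ioo a b, ∃ t ∈ T, ∃ p ∈ t, p.1 = x) :
    ∃ t ∈ T, ∃ p ∈ t, p.1 = a ∧ ∀ ε > 0, ∃ q ∈ t, a < q.1 ∧ |q.2 - p.2| < ε := by
  have h1 : ∃ t ∈ T, ∃ᶠ x in 𝓝[>] a, ∃ p ∈ t, p.1 = x := by
    by_contra hcon
    push Not at hcon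
    have h2 : ∀ᶠ x in 𝓝[>] a, ∀ t ∈ T, ∀ p ∈ t, p.1 ≠ x :=
      (Filter.eventually_all_finite hT).2 fun t ht => by
        simpa [Filter.not_frequently] using hcon t ht
    have h3 : ∀ᶠ x in 𝓝[>] a, x ∈ Ioo a b := Ioo_mem_nhdsGT hab
    obtain ⟨x, hx, hx'⟩ := (h2.and h3).exists
    obtain ⟨t, ht, p, hp, hpx⟩ := hcov x hx'
    exact hx t ht p hp hpx
  obtain ⟨t, ht, hfr⟩ := h1
  have h2 : ∀ n : ℕ, ∃ p ∈ t, a < p.1 ∧ p.1 < a + 1 / ((n : ℝ) + 1) := by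
    intro n
    have h3 : ∀ᶠ x in 𝓝[>] a, x ∈ Ioo a (a + 1 / ((n : ℝ) + 1)) :=
      Ioo_mem_nhdsGT (by have : (0 : ℝ) < 1 / ((n : ℝ) + 1) := by positivity
                         linarith)
    obtain ⟨x, ⟨p, hp, hpx⟩, hx⟩ := (hfr.and_eventually h3).exists
    exact ⟨p, hp, by rw [hpx]; exact hx.1, by rw [hpx]; exact hx.2⟩
  choose q hq hq1 hq2 using h2
  obtain ⟨p, hp, φ, hφ, hlim⟩ := (hseg t ht).isCompact.tendsto_subseq hq
  have hl1 := (continuous_fst.tendsto p).comp hlim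
  have hl2 := (continuous_snd.tendsto p).comp hlim
  have hq0 : Filter.Tendsto (fun n => (q (φ n)).1) Filter.atTop (𝓝 a) := by
    have h4 : Filter.Tendsto (fun n : ℕ => a + 1 / ((n : ℝ) + 1)) Filter.atTop (𝓝 a) := by
      simpa using (tendsto_one_div_add_atTop_nhds_zero_nat (𝕜 := ℝ)).const_add a
    exact tendsto_of_tendsto_of_tendsto_of_le_of_le tendsto_const_nhds
      (h4.comp hφ.tendsto_atTop) (fun n => (hq1 _).le) (fun n => (hq2 _).le)
  refine ⟨t, ht, p, hp, tendsto_nhds_unique hl1 hq0, fun ε hε => ?_⟩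
  have h5 := (Metric.tendsto_atTop.1 hl2) ε hε
  obtain ⟨N, hN⟩ := h5
  exact ⟨q (φ N), hq _, hq1 _, by simpa [Real.dist_eq] using hN N le_rfl⟩

/-- A skeleton meets every vertical line that passes between the extreme corners: the vertical chord
of the box on this line crosses the interior of `ω`. -/
lemma Stair.skeleton_covers {ω : Set Plane} {c d : Plane} (h : Stair ω c d)
    {T : Set (Set Plane)} (hT : IsSkeleton ω T) {x : ℝ} (hx : x ∈ Ioo c.1 d.1) :
    ∃ t ∈ T, ∃ p ∈ t, p.1 = x := by
  obtain ⟨y, hy⟩ := h.dense₁ x (by rw [uIcc_of_le h.lt₁.le]; exact ⟨hx.1.le, hx.2.le⟩) hx.1.ne'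
    hx.2.ne
  have hyb := h.bounds_int hy
  simp only at hyb
  have hsub : ((x, y) : Plane) ∈ segment ℝ ((x, c.2) : Plane) (x, d.2) := by
    have h0 : 0 < d.2 - c.2 := by linarith
    exact mem_segment_iff.2 ⟨(y - c.2) / (d.2 - c.2), ⟨div_nonneg (by linarith) h0.le,
      (div_le_one h0).2 (by linarith)⟩, by simp, by simp only; rw [div_mul_cancel₀ _ h0.ne']; ring⟩
  obtain ⟨t, ht, p, hp, hpt⟩ := hT.meets (x, c.2) (x, d.2)
    (fun hi => absurd (h.bounds_int hi).2.2.1 (lt_irrefl _))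
    (fun hi => absurd (h.bounds_int hi).2.2.2 (lt_irrefl _)) (by
      rintro γ ⟨k, rfl | rfl, rfl⟩
      · exact ⟨_, Or.inl hsub, hy⟩
      · exact ⟨_, Or.inr hsub, hy⟩) _ ⟨(x, d.2), Or.inl rfl, rfl⟩
  refine ⟨t, ht, p, hpt, ?_⟩
  rcases hp with hp | hp
  · obtain ⟨r, -, h1, -⟩ := mem_segment_iff.1 hp
    simpa using h1
  · obtain ⟨r, -, h1, -⟩ := mem_segment_iff.1 hp
    simpa using h1

/-- What a step from the corner `z` to the corner `z'` with the new edge `s` achieves. Either `s`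
rises to `z'`, or the box is already as high, or as wide, as `ω` and `s` reaches the opposite
side. -/
structure StepEdge (ω : Set Plane) (d z z' : Plane) (s : Set Plane) : Prop where
  vis : IsVisibilityEdge ω s
  le : ∀ p ∈ s, p ≤ z'
  start : ∃ w ∈ s, w ≤ z
  reach₁ : z'.1 = z.1 ∨ ∃ p ∈ s, p.1 = z'.1
  reach₂ : z'.2 = z.2 ∨ ∃ p ∈ s, p.2 = z'.2
  kind : (z' ∈ s ∧ ∃ w ∈ s, w.1 < z'.1 ∧ w.2 < z'.2) ∨
    (z' = d ∧ ((z.2 = d.2 ∧ ∃ w ∈ s, w.1 ≤ z.1) ∨ (z.1 = d.1 ∧ ∃ w ∈ s, w.2 ≤ z.2)))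

/-- A step of the procedure moves the corner of the box from `z` to `z'`, whichever maximal edge is
chosen, and every finite skeleton has a segment that stays below `z'`, but not below `z`. -/
structure StepResult (ω : Set Plane) (d z : Plane) (S : Set (Set Plane)) (z' : Plane) :
    Prop where
  mem : z' ∈ ω
  le : z ≤ z'
  ne : z ≠ z'
  frontier : ∃! f, IsFrontierOf ω S f
  exists_edge : ∃ f s, IsFrontierOf ω S f ∧ IsMaximalFrontierEdge ω S f s ∧ z' ∈ s
  edge : ∀ f s, IsFrontierOf ω S f → IsMaximalFrontierEdge ω S f s → StepEdge ω d z z' s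
  cut : ∀ T, T.Finite → IsSkeleton ω T → ∃ t ∈ T, ¬ t ⊆ Iic z ∧ t ⊆ Iic z'

namespace VState

variable {ω : Set Plane} {c d z : Plane} {S : Set (Set Plane)}

lemma frontier_inter (v : VState ω c d z) (h : Stair ω c d) :
    frontier (Icc c z) ∩ interior ω = interior ω ∩ {p | p.1 = z.1} := by
  obtain ⟨y₀, hy₀, hy⟩ := v.below
  ext p
  rw [mem_inter_iff, mem_frontier_Icc v.lt₁.le v.lt₂.le, mem_inter_iff, mem_ofPred_eq]
  constructor
  · rintro ⟨⟨⟨hcp, hpz⟩, hp⟩, hi⟩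
    have hb := h.bounds_int hi
    refine ⟨hi, ?_⟩
    rcases hp with e | e | e | e
    · linarith
    · exact e
    · linarith
    · -- an interior point on the upper side of the box would make its corner interior
      exfalso
      have h1 : (z.1, p.2) ∈ interior ω :=
        h.upper_right_int hi (hy y₀ le_rfl hy₀) hpz.1 (by linarith)
      rw [e] at h1
      obtain ⟨ε, hε, hsq⟩ := mem_interior_iff_square.1 h1
      have h2 := v.top _ (hsq z.1 (z.2 + ε / 2) (by simpa using hε)
        (by rw [add_sub_cancel_left, abs_of_pos (by positivity)]; linarith))
      linarith
  · rintro ⟨hi, e⟩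
    have hb := h.bounds_int hi
    refine ⟨⟨⟨⟨hb.1.le, hb.2.2.1.le⟩, ⟨e.le, v.top _ ?_⟩⟩, Or.inr (Or.inl e)⟩, hi⟩
    rw [← e]
    exact interior_subset hi

lemma isFrontierOf_iff (v : VState ω c d z) (h : Stair ω c d) (b : Boxed c z S) {f : Set Plane} :
    IsFrontierOf ω S f ↔ f = vGate ω z := by
  rw [IsFrontierOf, b.boundingBox_eq v.lt₁.le v.lt₂.le, v.frontier_inter h]
  have hconn := (h.convex_chord z.1).isPreconnected
  obtain ⟨y₀, hy₀, hy⟩ := v.below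
  constructor
  · rintro ⟨x, hx, rfl⟩
    rw [hconn.connectedComponentIn hx]
    rfl
  · rintro rfl
    refine ⟨(z.1, y₀), ⟨hy y₀ le_rfl hy₀, rfl⟩, ?_⟩
    rw [hconn.connectedComponentIn ⟨hy y₀ le_rfl hy₀, rfl⟩]
    rfl

lemma isMaximal_iff (v : VState ω c d z) {s : Set Plane} :
    IsMaximalFrontierEdge ω S (vGate ω z) s ↔
      IsLexMax (frontierEdges ω (vGate ω z)) (hAdvance S) (vAdvance S) s := by
  have hv : IsVertical (vGate ω z) := fun p hp q hq =>
    (fst_of_mem_vGate hp).trans (fst_of_mem_vGate hq).symm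
  have hh : ¬ IsHorizontal (vGate ω z) := by
    obtain ⟨y₀, hy₀, hy⟩ := v.below
    intro hcon
    have := hcon (z.1, y₀) (subset_closure ⟨hy y₀ le_rfl hy₀, rfl⟩) z v.mem_vGate
    simp only at this
    linarith
  constructor
  · rintro (⟨-, h⟩ | ⟨hf, -⟩ | ⟨hf, -⟩)
    · exact h
    · exact absurd hf hh
    · exact absurd hv hf
  · exact fun h => Or.inl ⟨hv, h⟩

/-- The next corner of the box, from a state with a vertical frontier. -/
lemma exists_next (v : VState ω c d z) (h : Stair ω c d) : ∃ z', z ≤ z' ∧ z.1 < z'.1 ∧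
    (∃ w ∈ vGate ω z, segment ℝ w z' ⊆ ω) ∧
    (∀ t, IsLineSegment t → t ⊆ ω → (t ∩ vGate ω z).Nonempty → ∀ p ∈ t, p ≤ z') ∧
    ((z.2 < z'.2) ∨ (z.2 = d.2 ∧ z' = d)) := by
  obtain ⟨z', hw, hmax, hz1, hz2⟩ := (v.gate h).exists_reach h
  have hz'ω : z' ∈ ω := by
    obtain ⟨w, -, hw⟩ := hw
    exact hw (right_mem_segment _ _ _)
  have hb := h.bounds hz'ω
  have hseg : ∀ t, IsLineSegment t → t ⊆ ω → (t ∩ vGate ω z).Nonempty → ∀ p ∈ t, p ≤ z' := by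
    rintro _ ⟨a, b, -, rfl⟩ htω ⟨w, hw, hwg⟩ p hp
    exact hmax w hwg p ((segment_subset_of_mem hw hp).trans htω)
  rcases (h.bounds v.mem).2.2.2.eq_or_lt with e | hlt
  · have h1 : segment ℝ z d ⊆ ω := by
      have hd : (d.1, z.2) ∈ ω := by rw [e]; exact h.high_mem
      have h2 := segment_subset_of_graph (A := ω) (m := 0) (k := z.2) (x₀ := z.1) (x₁ := d.1)
        v.lt_right.le (fun t ht => by simpa using h.horiz v.mem hd ht.1 ht.2)
      rw [zero_mul, zero_mul, zero_add] at h2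
      rwa [show ((d.1, z.2) : Plane) = d from Prod.ext rfl e] at h2
    have h3 := hmax z v.mem_vGate d h1
    have h4 : z' = d := Prod.ext (le_antisymm hb.2.1 h3.1) (le_antisymm hb.2.2.2 h3.2)
    refine ⟨z', ⟨hz1, hz2⟩, ?_, hw, hseg, Or.inr ⟨e, h4⟩⟩
    rw [h4]
    exact v.lt_right
  · obtain ⟨y₀, hy₀, hy⟩ := v.below
    obtain ⟨w, hw', q, hq, hq1, hq2⟩ := (v.gate h).exists_rising h v.lt₂ hlt hy₀
      (subset_closure ⟨hy y₀ le_rfl hy₀, rfl⟩)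
    have h3 := hmax w hw' q hq
    exact ⟨z', ⟨hz1, hz2⟩, hq1.trans_le h3.1, hw, hseg, Or.inl (hq2.trans_le h3.2)⟩

theorem stepResult (v : VState ω c d z) (h : Stair ω c d) (b : Boxed c z S) :
    ∃ z', StepResult ω d z S z' := by
  obtain ⟨z', hzz, hlt, ⟨w, hwg, hwz⟩, hle, hkind⟩ := v.exists_next h
  have hw1 : w.1 = z.1 := fst_of_mem_vGate hwg
  have hwne : w ≠ z' := fun e => by rw [← e, hw1] at hlt; exact lt_irrefl _ hlt
  have hgz : ∀ p ∈ vGate ω z, p ≤ z := fun p hp => by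
    have h1 := fst_of_mem_vGate hp
    exact ⟨h1.le, v.top _ (by rw [← h1]; exact vGate_subset h z hp)⟩
  have hadv : ∀ t, IsLineSegment t → t ⊆ ω → (t ∩ vGate ω z).Nonempty →
      (∃ p ∈ t, (∀ q ∈ t, q.1 ≤ p.1) ∧ hAdvance S t = max 0 (p.1 - z.1)) ∧
      (∃ p ∈ t, (∀ q ∈ t, q.2 ≤ p.2) ∧ vAdvance S t = max 0 (p.2 - z.2)) := by
    rintro t ht htω ⟨r, hrt, hrg⟩
    exact ⟨b.exists_hAdvance ht (fun p hp => (h.bounds (htω hp)).1) ⟨r, hrt, (hgz r hrg).1⟩,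
      b.exists_vAdvance ht (fun p hp => (h.bounds (htω hp)).2.2.1) ⟨r, hrt, (hgz r hrg).2⟩⟩
  -- some visibility edge attains both coordinates of `z'`, so it is maximal
  obtain ⟨s₀, hs₀, hs₀sub⟩ := exists_visibilityEdge h.compact ⟨w, z', hwne, rfl⟩ hwz
  have hs₀g : (s₀ ∩ vGate ω z).Nonempty := ⟨w, hs₀sub (left_mem_segment _ _ _), hwg⟩
  have hz's₀ : z' ∈ s₀ := hs₀sub (right_mem_segment _ _ _)
  have hs₀h : hAdvance S s₀ = z'.1 - z.1 := by
    obtain ⟨⟨p, hp, hpm, e⟩, -⟩ := hadv s₀ hs₀.segment hs₀.inside hs₀g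
    rw [e, le_antisymm (hle _ hs₀.segment hs₀.inside hs₀g p hp).1 (hpm _ hz's₀),
      max_eq_right (by linarith)]
  have hs₀v : vAdvance S s₀ = z'.2 - z.2 := by
    obtain ⟨-, ⟨p, hp, hpm, e⟩⟩ := hadv s₀ hs₀.segment hs₀.inside hs₀g
    rw [e, le_antisymm (hle _ hs₀.segment hs₀.inside hs₀g p hp).2 (hpm _ hz's₀),
      max_eq_right (by linarith [hzz.2])]
  have hs₀max : IsLexMax (frontierEdges ω (vGate ω z)) (hAdvance S) (vAdvance S) s₀ := by
    refine ⟨⟨hs₀, hs₀g⟩, ?_⟩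
    rintro t ⟨ht, htg⟩
    obtain ⟨⟨p, hp, -, e⟩, ⟨q, hq, -, e'⟩⟩ := hadv t ht.segment ht.inside htg
    rw [e, e', hs₀h, hs₀v]
    have h1 := hle t ht.segment ht.inside htg
    exact ⟨max_le (by linarith) (by linarith [(h1 p hp).1]),
      fun _ => max_le (by linarith [hzz.2]) (by linarith [(h1 q hq).2])⟩
  have hfr : IsFrontierOf ω S (vGate ω z) := (v.isFrontierOf_iff h b).2 rfl
  refine ⟨z', hwz (right_mem_segment _ _ _), hzz, fun e => by rw [← e] at hlt; exact lt_irrefl _ hlt,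
    ⟨_, hfr, fun f hf => (v.isFrontierOf_iff h b).1 hf⟩,
    ⟨_, s₀, hfr, v.isMaximal_iff.2 hs₀max, hz's₀⟩, fun f s hf hs => ?_, fun T hTf hT => ?_⟩
  · rw [(v.isFrontierOf_iff h b).1 hf, v.isMaximal_iff] at hs
    obtain ⟨⟨hvis, hsg⟩, hmax⟩ := hs
    obtain ⟨⟨p, hp, -, e⟩, ⟨q, hq, -, e'⟩⟩ := hadv s hvis.segment hvis.inside hsg
    have h1 := hle s hvis.segment hvis.inside hsg
    have h2 := hmax s₀ hs₀max.1
    rw [hs₀h, hs₀v, e, e'] at h2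
    have hpz : p.1 = z'.1 := by
      refine le_antisymm (h1 p hp).1 ?_
      rcases le_max_iff.1 h2.1 with h3 | h3 <;> linarith
    have h3 := h2.2 (by rw [hpz, max_eq_right (by linarith)])
    obtain ⟨r, hrs, hrg⟩ := hsg
    have hr1 : r.1 = z.1 := fst_of_mem_vGate hrg
    have hrz := hgz r hrg
    have hqz : z.2 < z'.2 → q.2 = z'.2 := by
      intro hlt2
      refine le_antisymm (h1 q hq).2 ?_
      rcases le_max_iff.1 h3 with h4 | h4 <;> linarith
    have hrise : z.2 < z'.2 → z' ∈ s := by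
      intro hlt2
      have hq2 := hqz hlt2
      -- the highest point of the new edge lies to the right of the frontier
      have hq1 : z.1 < q.1 := by
        by_contra hcon
        push Not at hcon
        have := v.top _ (h.upper_right (hvis.inside hq) v.mem hcon (by linarith))
        linarith
      have hrq : r ≠ q := fun e => by rw [← e, hr1] at hq1; exact lt_irrefl _ hq1
      obtain ⟨⟨u, u', -, hsu⟩, -, -⟩ := hvis
      rw [hsu] at hrs hq hp
      obtain ⟨α, β, -, -, hpar⟩ := segment_param hrs hq hrq
      obtain ⟨t, -, ht⟩ := (hpar p).1 hp
      have hp1 : p.1 = r.1 + t * (q.1 - r.1) := by rw [ht]; simp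
      have hp2 : p.2 = r.2 + t * (q.2 - r.2) := by rw [ht]; simp
      have h4 := (h1 p (hsu ▸ hp)).2
      have h5 := (h1 q (hsu ▸ hq)).1
      have hr2 := hrz.2
      have ht1 : t ≤ 1 := by
        by_contra hcon
        push Not at hcon
        nlinarith
      have ht2 : 1 ≤ t := by
        by_contra hcon
        push Not at hcon
        nlinarith
      have ht3 : t = 1 := le_antisymm ht1 ht2
      rw [ht3] at hp1
      have : q = z' := Prod.ext (by linarith) hq2
      rw [hsu, ← this]
      exact hq
    refine ⟨hvis, h1, ⟨r, hrs, hrz⟩, Or.inr ⟨p, hp, hpz⟩, ?_, ?_⟩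
    · rcases hzz.2.eq_or_lt with h4 | h4
      · exact Or.inl h4.symm
      · exact Or.inr ⟨q, hq, hqz h4⟩
    · rcases hkind with h4 | ⟨h4, h5⟩
      · exact Or.inl ⟨hrise h4, r, hrs, by linarith, by linarith [hrz.2]⟩
      · exact Or.inr ⟨h5, Or.inl ⟨h4, r, hrs, hr1.le⟩⟩
  · obtain ⟨t, ht, p, hp, hp1, hlim⟩ := exists_limit_from_right hTf hT.segments v.lt_right
      (fun x hx => h.skeleton_covers hT ⟨v.lt₁.trans hx.1, hx.2⟩)
    have htω := hT.inside t ht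
    have hpg : p ∈ vGate ω z := v.mem_vGate_of_limit h hp1 (htω hp) fun ε hε => by
      obtain ⟨q, hq, h1, h2⟩ := hlim ε hε
      exact ⟨q, htω hq, h1, h2⟩
    refine ⟨t, ht, fun hsub => ?_, fun q hq => hle t (hT.segments t ht) htω ⟨p, hp, hpg⟩ q hq⟩
    obtain ⟨q, hq, h1, -⟩ := hlim 1 one_pos
    exact absurd (hsub hq).1 (not_le.2 h1)

end VState

lemma StepEdge.of_swap {ω : Set Plane} {d z z' : Plane} {s : Set Plane}
    (e : StepEdge (swapL '' ω) (swapL d) (swapL z) (swapL z') (swapL '' s)) :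
    StepEdge ω d z z' s where
  vis := by
    have := isVisibilityEdge_image isSymm_swapL.invol e.vis
    rwa [swapL_image_swapL_image, swapL_image_swapL_image] at this
  le p hp := by
    have := e.le _ (mem_image_of_mem _ hp)
    exact ⟨this.2, this.1⟩
  start := by
    obtain ⟨_, ⟨w, hw, rfl⟩, hle⟩ := e.start
    exact ⟨w, hw, ⟨hle.2, hle.1⟩⟩
  reach₁ := e.reach₂.imp_right fun ⟨_, ⟨w, hw, hw'⟩, h⟩ => ⟨w, hw, by rw [← hw'] at h; exact h⟩
  reach₂ := e.reach₁.imp_right fun ⟨_, ⟨w, hw, hw'⟩, h⟩ => ⟨w, hw, by rw [← hw'] at h; exact h⟩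
  kind := by
    have hinj : ∀ p q : Plane, swapL p = swapL q → p = q := fun p q h => swapL.injective h
    rcases e.kind with ⟨h1, _, ⟨w, hw, rfl⟩, h2, h3⟩ | ⟨h1, ⟨h2, _, ⟨w, hw, rfl⟩, h3⟩ |
      ⟨h2, _, ⟨w, hw, rfl⟩, h3⟩⟩
    · exact Or.inl ⟨mem_swapL_image.1 h1, w, hw, h3, h2⟩
    · exact Or.inr ⟨hinj _ _ h1, Or.inr ⟨h2, w, hw, h3⟩⟩
    · exact Or.inr ⟨hinj _ _ h1, Or.inl ⟨h2, w, hw, h3⟩⟩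

theorem HState.stepResult {ω : Set Plane} {c d z : Plane} {S : Set (Set Plane)}
    (v : HState ω c d z) (h : Stair ω c d) (b : Boxed c z S) : ∃ z', StepResult ω d z S z' := by
  have hs := isSymm_swapL
  obtain ⟨z'', r⟩ := VState.stepResult v h.swap b.swap
  obtain ⟨z', rfl⟩ : ∃ z', z'' = swapL z' := ⟨swapL z'', rfl⟩
  have hIic : ∀ (t : Set Plane) (q : Plane), swapL '' t ⊆ Iic (swapL q) → t ⊆ Iic q :=
    fun t q ht p hp => ⟨(ht (mem_image_of_mem _ hp)).2, (ht (mem_image_of_mem _ hp)).1⟩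
  refine ⟨z', mem_swapL_image.1 r.mem, ⟨r.le.2, r.le.1⟩, fun e => r.ne (congrArg swapL e), ?_, ?_,
    fun f s hf hm => ?_, fun T hTf hT => ?_⟩
  · obtain ⟨f, hf, huniq⟩ := r.frontier
    refine ⟨swapL '' f, ?_, fun g hg => ?_⟩
    · have := hs.isFrontierOf_image hf
      rwa [swapL_image_swapL_image, mapSets_mapSets hs.invol] at this
    · rw [← huniq _ (hs.isFrontierOf_image hg), swapL_image_swapL_image]
  · obtain ⟨f, s, hf, hm, hz⟩ := r.exists_edge
    refine ⟨swapL '' f, swapL '' s, ?_, ?_, mem_swapL_image.2 hz⟩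
    · have := hs.isFrontierOf_image hf
      rwa [swapL_image_swapL_image, mapSets_mapSets hs.invol] at this
    · have := hs.maximal _ _ _ _ hm
      rwa [swapL_image_swapL_image, mapSets_mapSets hs.invol] at this
  · exact (r.edge _ _ (hs.isFrontierOf_image hf) (hs.maximal _ _ _ _ hm)).of_swap
  · obtain ⟨_, ⟨t, ht, rfl⟩, h1, h2⟩ := r.cut _ (hTf.image _) (hs.isSkeleton_image hT)
    refine ⟨t, ht, fun hsub => h1 ?_, hIic t z' h2⟩
    rintro _ ⟨p, hp, rfl⟩
    exact ⟨(hsub hp).2, (hsub hp).1⟩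

/-! ### Cuts and skeletons -/

/-- A member of `S` meets the boundary of the quadrant below and to the left of `ζ`. -/
def MeetsLower (S : Set (Set Plane)) (ζ : Plane) : Prop :=
  ∃ v ∈ ⋃₀ S, v ≤ ζ ∧ (v.1 = ζ.1 ∨ v.2 = ζ.2)

/-- A member of `S` meets the boundary of the quadrant above and to the right of `ζ`. -/
def MeetsUpper (S : Set (Set Plane)) (ζ : Plane) : Prop :=
  ∃ v ∈ ⋃₀ S, ζ ≤ v ∧ (v.1 = ζ.1 ∨ v.2 = ζ.2)

lemma IsLineSegment.isPreconnected {t : Set Plane} (ht : IsLineSegment t) : IsPreconnected t := by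
  obtain ⟨a, b, -, rfl⟩ := ht
  exact (convex_segment a b).isPreconnected

lemma IsLineSegment.meets_lower {t : Set Plane} (ht : IsLineSegment t) {p q ζ : Plane}
    (hp : p ∈ t) (hpζ : p ≤ ζ) (hq : q ∈ t) (hqζ : ¬ q ≤ ζ) :
    ∃ v ∈ t, v ≤ ζ ∧ (v.1 = ζ.1 ∨ v.2 = ζ.2) := by
  have h1 : max (p.1 - ζ.1) (p.2 - ζ.2) ≤ 0 :=
    max_le (sub_nonpos.2 hpζ.1) (sub_nonpos.2 hpζ.2)
  have h2 : 0 ≤ max (q.1 - ζ.1) (q.2 - ζ.2) := by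
    by_contra hcon
    push Not at hcon
    rw [max_lt_iff] at hcon
    exact hqζ ⟨by linarith [hcon.1], by linarith [hcon.2]⟩
  obtain ⟨v, hv, hv0⟩ := ht.isPreconnected.intermediate_value hp hq
    (f := fun v : Plane => max (v.1 - ζ.1) (v.2 - ζ.2)) (by fun_prop) ⟨h1, h2⟩
  simp only at hv0
  have h3 := le_max_left (v.1 - ζ.1) (v.2 - ζ.2)
  have h4 := le_max_right (v.1 - ζ.1) (v.2 - ζ.2)
  refine ⟨v, hv, ⟨by linarith, by linarith⟩, ?_⟩
  rcases max_choice (v.1 - ζ.1) (v.2 - ζ.2) with h5 | h5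
  · left; linarith
  · right; linarith

lemma IsLineSegment.meets_upper {t : Set Plane} (ht : IsLineSegment t) {p q ζ : Plane}
    (hp : p ∈ t) (hpζ : ζ ≤ p) (hq : q ∈ t) (hqζ : ¬ ζ ≤ q) :
    ∃ v ∈ t, ζ ≤ v ∧ (v.1 = ζ.1 ∨ v.2 = ζ.2) := by
  have h1 : max (ζ.1 - p.1) (ζ.2 - p.2) ≤ 0 :=
    max_le (sub_nonpos.2 hpζ.1) (sub_nonpos.2 hpζ.2)
  have h2 : 0 ≤ max (ζ.1 - q.1) (ζ.2 - q.2) := by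
    by_contra hcon
    push Not at hcon
    rw [max_lt_iff] at hcon
    exact hqζ ⟨by linarith [hcon.1], by linarith [hcon.2]⟩
  obtain ⟨v, hv, hv0⟩ := ht.isPreconnected.intermediate_value hp hq
    (f := fun v : Plane => max (ζ.1 - v.1) (ζ.2 - v.2)) (by fun_prop) ⟨h1, h2⟩
  simp only at hv0
  have h3 := le_max_left (ζ.1 - v.1) (ζ.2 - v.2)
  have h4 := le_max_right (ζ.1 - v.1) (ζ.2 - v.2)
  refine ⟨v, hv, ⟨by linarith, by linarith⟩, ?_⟩
  rcases max_choice (ζ.1 - v.1) (ζ.2 - v.2) with h5 | h5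
  · left; linarith
  · right; linarith

/-- The upper cuts that a skeleton has to meet: those through an interior corner `κ` whose two ends
`(x, κ.2)` and `(κ.1, y)` are outside the interior of `ω`, but not both on extreme edges. The cut is
moved a little into the direction of the lower left, so that it avoids boundary edges. -/
def UpperCuts (ω : Set Plane) (d : Plane) (S : Set (Set Plane)) : Prop :=
  ∀ κ ∈ interior ω, ∀ x y, κ.1 ≤ x → κ.2 ≤ y → (x, κ.2) ∉ interior ω → (κ.1, y) ∉ interior ω →
    (x < d.1 ∨ y < d.2) → ∃ ε₀ > 0, ∀ ε, 0 < ε → ε < ε₀ → MeetsUpper S (κ.1 - ε, κ.2 - ε)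

/-- A compact set that comes arbitrarily close to a closed set meets it. -/
lemma nonempty_of_close {K C : Set Plane} (hK : IsCompact K) (hC : IsClosed C) {ε₀ : ℝ}
    (hε₀ : 0 < ε₀) (h : ∀ ε, 0 < ε → ε < ε₀ → ∃ v ∈ K, ∃ u ∈ C, |v.1 - u.1| ≤ ε ∧ |v.2 - u.2| ≤ ε) :
    (C ∩ K).Nonempty := by
  by_contra hcon
  rw [not_nonempty_iff_eq_empty, inter_comm, ← disjoint_iff_inter_eq_empty] at hcon
  obtain ⟨δ, hδ, hdis⟩ := hcon.exists_thickenings hK hC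
  have h0 : 0 < min ε₀ δ / 2 := by have := lt_min hε₀ hδ; positivity
  obtain ⟨v, hv, u, hu, h1, h2⟩ := h (min ε₀ δ / 2) h0 (by linarith [min_le_left ε₀ δ])
  have h3 : dist v u < δ := by
    rw [Prod.dist_eq, Real.dist_eq, Real.dist_eq, max_lt_iff]
    constructor <;> linarith [min_le_right ε₀ δ]
  exact hdis.le_bot ⟨Metric.mem_thickening_iff.2 ⟨v, hv, by simpa using hδ⟩,
    Metric.mem_thickening_iff.2 ⟨u, hu, h3⟩⟩ |>.elim

lemma mem_segment_horizontal {x₁ x₂ x y : ℝ} (h₁ : x₁ ≤ x) (h₂ : x ≤ x₂) :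
    ((x, y) : Plane) ∈ segment ℝ ((x₁, y) : Plane) (x₂, y) := by
  rcases (h₁.trans h₂).eq_or_lt with e | hlt
  · have : x = x₁ := le_antisymm (by linarith) h₁
    rw [this]
    exact left_mem_segment _ _ _
  · have h0 : 0 < x₂ - x₁ := sub_pos.2 hlt
    exact mem_segment_iff.2 ⟨(x - x₁) / (x₂ - x₁), ⟨div_nonneg (by linarith) h0.le,
      (div_le_one h0).2 (by linarith)⟩, by simp only; rw [div_mul_cancel₀ _ h0.ne']; ring, by simp⟩

lemma mem_segment_vertical {y₁ y₂ x y : ℝ} (h₁ : y₁ ≤ y) (h₂ : y ≤ y₂) :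
    ((x, y) : Plane) ∈ segment ℝ ((x, y₁) : Plane) (x, y₂) := by
  have h3 := mem_image_of_mem swapL (mem_segment_horizontal (y := x) h₁ h₂)
  rw [swapL_image_segment] at h3
  exact h3

lemma mem_segment_horizontal_iff {x₁ x₂ y : ℝ} {p : Plane}
    (hp : p ∈ segment ℝ ((x₁, y) : Plane) (x₂, y)) : p.2 = y ∧ p.1 ∈ uIcc x₁ x₂ := by
  obtain ⟨t, ht, h1, h2⟩ := mem_segment_iff.1 hp
  refine ⟨by simpa using h2, ?_⟩
  rw [← segment_eq_uIcc, segment_eq_image']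
  exact ⟨t, ht, by simp [h1]⟩

lemma mem_segment_vertical_iff {y₁ y₂ x : ℝ} {p : Plane}
    (hp : p ∈ segment ℝ ((x, y₁) : Plane) (x, y₂)) : p.1 = x ∧ p.2 ∈ uIcc y₁ y₂ := by
  have h1 := mem_image_of_mem swapL hp
  rw [swapL_image_segment] at h1
  exact mem_segment_horizontal_iff h1

lemma isClosed_segment (a b : Plane) : IsClosed (segment ℝ a b) := by
  rw [segment_eq_image']
  exact (isCompact_Icc.image (by fun_prop)).isClosed

section Cuts

variable {ω : Set Plane} {c d : Plane} {S : Set (Set Plane)}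

/-- A family that meets all lower cuts meets every horizontal segment that crosses the interior and
has its ends outside the interior. -/
lemma Stair.meets_horizontal (h : Stair ω c d) (hK : IsCompact (⋃₀ S)) (hS : ⋃₀ S ⊆ ω)
    (hlow : ∀ ζ, c ≤ ζ → ¬ d ≤ ζ → MeetsLower S ζ) {x₁ x₂ ξ y : ℝ} (hξ : (ξ, y) ∈ interior ω)
    (h₁ : x₁ ≤ ξ) (h₂ : ξ ≤ x₂) (hx₁ : (x₁, y) ∉ interior ω) (hx₂ : (x₂, y) ∉ interior ω) :
    (segment ℝ ((x₁, y) : Plane) (x₂, y) ∩ ⋃₀ S).Nonempty := by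
  have hb := h.bounds_int hξ
  simp only at hb
  refine nonempty_of_close hK (isClosed_segment _ _) (sub_pos.2 hb.2.2.2) fun ε hε hε' => ?_
  obtain ⟨v, hv, hvζ, hv'⟩ := hlow (x₂ + ε, y + ε) ⟨by simp only; linarith, by simp only; linarith⟩
    (fun hd => by have := hd.2; simp only at this; linarith)
  have hv1 := hvζ.1
  have hv2 := hvζ.2
  simp only at hv1 hv2 hv'
  have hvω := hS hv
  have hbox : x₁ ≤ v.1 ∧ y ≤ v.2 := by
    rcases hv' with e | e
    · refine ⟨by linarith, ?_⟩
      by_contra hcon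
      push Not at hcon
      exact hx₂ (h.upper_side_int hvω hξ hcon h₂ (by linarith))
    · refine ⟨?_, by linarith⟩
      by_contra hcon
      push Not at hcon
      exact hx₁ (h.lower_side_int hvω hξ (by simp only; linarith) h₁ hcon)
  refine ⟨v, hv, (min v.1 x₂, y), mem_segment_horizontal (le_min hbox.1 (h₁.trans h₂))
    (min_le_right _ _), ?_, ?_⟩
  · simp only
    rw [abs_of_nonneg (by linarith [min_le_left v.1 x₂])]
    rcases min_choice v.1 x₂ with e | e <;> rw [e] <;> linarith
  · simp only
    rw [abs_of_nonneg (by linarith)]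
    linarith

lemma Stair.meets_vertical (h : Stair ω c d) (hK : IsCompact (⋃₀ S)) (hS : ⋃₀ S ⊆ ω)
    (hlow : ∀ ζ, c ≤ ζ → ¬ d ≤ ζ → MeetsLower S ζ) {y₁ y₂ ξ x : ℝ} (hξ : (x, ξ) ∈ interior ω)
    (h₁ : y₁ ≤ ξ) (h₂ : ξ ≤ y₂) (hy₁ : (x, y₁) ∉ interior ω) (hy₂ : (x, y₂) ∉ interior ω) :
    (segment ℝ ((x, y₁) : Plane) (x, y₂) ∩ ⋃₀ S).Nonempty := by
  have hb := h.bounds_int hξ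
  simp only at hb
  refine nonempty_of_close hK (isClosed_segment _ _) (sub_pos.2 hb.2.1) fun ε hε hε' => ?_
  obtain ⟨v, hv, hvζ, hv'⟩ := hlow (x + ε, y₂ + ε) ⟨by simp only; linarith, by simp only; linarith⟩
    (fun hd => by have := hd.1; simp only at this; linarith)
  have hv1 := hvζ.1
  have hv2 := hvζ.2
  simp only at hv1 hv2 hv'
  have hvω := hS hv
  have hbox : x ≤ v.1 ∧ y₁ ≤ v.2 := by
    rcases hv' with e | e
    · refine ⟨by linarith, ?_⟩
      by_contra hcon
      push Not at hcon
      exact hy₁ (h.left_side_int hvω hξ (by simp only; linarith) h₁ hcon)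
    · refine ⟨?_, by linarith⟩
      by_contra hcon
      push Not at hcon
      exact hy₂ (h.right_side_int hvω hξ hcon h₂ (by linarith))
  refine ⟨v, hv, (x, min v.2 y₂), mem_segment_vertical (le_min hbox.2 (h₁.trans h₂))
    (min_le_right _ _), ?_, ?_⟩
  · simp only
    rw [abs_of_nonneg (by linarith)]
    linarith
  · simp only
    rw [abs_of_nonneg (by linarith [min_le_left v.2 y₂])]
    rcases min_choice v.2 y₂ with e | e <;> rw [e] <;> linarith

/-- The path that leaves `p` horizontally and reaches `q` vertically meets a family that meets all
lower cuts and the necessary upper cuts. -/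
lemma Stair.meets_path (h : Stair ω c d) (hK : IsCompact (⋃₀ S)) (hS : ⋃₀ S ⊆ ω)
    (hlow : ∀ ζ, c ≤ ζ → ¬ d ≤ ζ → MeetsLower S ζ) (hup : UpperCuts ω d S) {p₁ p₂ q₁ q₂ : ℝ}
    (hp : (p₁, p₂) ∉ interior ω) (hq : (q₁, q₂) ∉ interior ω)
    (h₁ : ((segment ℝ ((p₁, p₂) : Plane) (q₁, p₂) ∪ segment ℝ ((q₁, p₂) : Plane) (q₁, q₂)) ∩
      interior ω).Nonempty)
    (h₂ : ((segment ℝ ((p₁, p₂) : Plane) (p₁, q₂) ∪ segment ℝ ((p₁, q₂) : Plane) (q₁, q₂)) ∩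
      interior ω).Nonempty) :
    ((segment ℝ ((p₁, p₂) : Plane) (q₁, p₂) ∪ segment ℝ ((q₁, p₂) : Plane) (q₁, q₂)) ∩
      ⋃₀ S).Nonempty := by
  by_cases hκ : (q₁, p₂) ∈ interior ω
  swap
  · -- one of the two legs crosses the interior completely
    rw [union_inter_distrib_right, union_nonempty]
    obtain ⟨r, hr | hr, hri⟩ := h₁
    · left
      obtain ⟨e, hr1⟩ := mem_segment_horizontal_iff hr
      have hri' : (r.1, p₂) ∈ interior ω := by rw [← e]; exact hri
      rcases le_total p₁ q₁ with hle | hle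
      · rw [uIcc_of_le hle] at hr1
        exact h.meets_horizontal hK hS hlow hri' hr1.1 hr1.2 hp hκ
      · rw [uIcc_of_ge hle] at hr1
        rw [segment_symm]
        exact h.meets_horizontal hK hS hlow hri' hr1.1 hr1.2 hκ hp
    · right
      obtain ⟨e, hr1⟩ := mem_segment_vertical_iff hr
      have hri' : (q₁, r.2) ∈ interior ω := by rw [← e]; exact hri
      rcases le_total p₂ q₂ with hle | hle
      · rw [uIcc_of_le hle] at hr1
        exact h.meets_vertical hK hS hlow hri' hr1.1 hr1.2 hκ hq
      · rw [uIcc_of_ge hle] at hr1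
        rw [segment_symm]
        exact h.meets_vertical hK hS hlow hri' hr1.1 hr1.2 hq hκ
  have hclosed : IsClosed (segment ℝ ((p₁, p₂) : Plane) (q₁, p₂) ∪
      segment ℝ ((q₁, p₂) : Plane) (q₁, q₂)) :=
    (isClosed_segment _ _).union (isClosed_segment _ _)
  have hb := h.bounds_int hκ
  simp only at hb
  rcases le_total p₁ q₁ with hx | hx <;> rcases le_total q₂ p₂ with hy | hy
  · -- from the left to below
    refine nonempty_of_close hK hclosed (sub_pos.2 hb.2.1) fun ε hε hε' => ?_
    obtain ⟨v, hv, hvζ, hv'⟩ := hlow (q₁ + ε, p₂ + ε)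
      ⟨by simp only; linarith, by simp only; linarith⟩
      (fun hd => by have := hd.1; simp only at this; linarith)
    have hv1 := hvζ.1
    have hv2 := hvζ.2
    simp only at hv1 hv2 hv'
    have hvω := hS hv
    rcases hv' with e | e
    · have hqv : q₂ ≤ v.2 := by
        by_contra hcon
        push Not at hcon
        exact hq (h.left_side_int hvω hκ (by simp only; linarith) hy hcon)
      refine ⟨v, hv, (q₁, min v.2 p₂), Or.inr ?_, ?_, ?_⟩
      · rw [segment_symm]
        exact mem_segment_vertical (le_min hqv hy) (min_le_right _ _)
      · rw [e, add_sub_cancel_left, abs_of_pos hε]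
      · simp only
        rw [abs_of_nonneg (by linarith [min_le_left v.2 p₂])]
        rcases min_choice v.2 p₂ with e | e <;> rw [e] <;> linarith
    · have hpv : p₁ ≤ v.1 := by
        by_contra hcon
        push Not at hcon
        exact hp (h.lower_side_int hvω hκ (by simp only; linarith) hx hcon)
      refine ⟨v, hv, (min v.1 q₁, p₂), Or.inl
        (mem_segment_horizontal (le_min hpv hx) (min_le_right _ _)), ?_, ?_⟩
      · simp only
        rw [abs_of_nonneg (by linarith [min_le_left v.1 q₁])]
        rcases min_choice v.1 q₁ with e | e <;> rw [e] <;> linarith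
      · rw [e, add_sub_cancel_left, abs_of_pos hε]
  · -- from the left to above: the other path misses the interior
    exfalso
    obtain ⟨r, hr | hr, hri⟩ := h₂
    · obtain ⟨e, hr1⟩ := mem_segment_vertical_iff hr
      rw [uIcc_of_le hy] at hr1
      have hri' : (p₁, r.2) ∈ interior ω := by rw [← e]; exact hri
      exact hp (h.lower_left_int hri' hκ hx hr1.1)
    · obtain ⟨e, hr1⟩ := mem_segment_horizontal_iff hr
      rw [uIcc_of_le hx] at hr1
      have hri' : (r.1, q₂) ∈ interior ω := by rw [← e]; exact hri
      exact hq (h.upper_right_int hri' hκ hr1.2 hy)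
  · -- from the right to below: the other path misses the interior
    exfalso
    obtain ⟨r, hr | hr, hri⟩ := h₂
    · obtain ⟨e, hr1⟩ := mem_segment_vertical_iff hr
      rw [uIcc_of_ge hy] at hr1
      have hri' : (p₁, r.2) ∈ interior ω := by rw [← e]; exact hri
      exact hp (h.upper_right_int hκ hri' hx hr1.2)
    · obtain ⟨e, hr1⟩ := mem_segment_horizontal_iff hr
      rw [uIcc_of_ge hx] at hr1
      have hri' : (r.1, q₂) ∈ interior ω := by rw [← e]; exact hri
      exact hq (h.lower_left_int hκ hri' hr1.1 hy)
  · -- from the right to above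
    have hex : p₁ < d.1 ∨ q₂ < d.2 := by
      obtain ⟨r, hr | hr, hri⟩ := h₂
      · left
        rw [← (mem_segment_vertical_iff hr).1]
        exact (h.bounds_int hri).2.1
      · right
        rw [← (mem_segment_horizontal_iff hr).1]
        exact (h.bounds_int hri).2.2.2
    obtain ⟨ε₀, hε₀, hcut⟩ := hup _ hκ p₁ q₂ hx hy hp hq hex
    refine nonempty_of_close hK hclosed hε₀ fun ε hε hε' => ?_
    obtain ⟨v, hv, hvζ, hv'⟩ := hcut ε hε hε'
    have hv1 := hvζ.1
    have hv2 := hvζ.2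
    simp only at hv1 hv2 hv'
    have hvω := hS hv
    rcases hv' with e | e
    · have hqv : v.2 ≤ q₂ := by
        by_contra hcon
        push Not at hcon
        exact hq (h.right_side_int hvω hκ (by simp only; linarith) hy hcon)
      refine ⟨v, hv, (q₁, max v.2 p₂), Or.inr
        (mem_segment_vertical (le_max_right _ _) (max_le hqv hy)), ?_, ?_⟩
      · rw [e, sub_sub_cancel_left, abs_neg, abs_of_pos hε]
      · simp only
        rw [abs_of_nonpos (by linarith [le_max_left v.2 p₂])]
        rcases max_choice v.2 p₂ with e | e <;> rw [e] <;> linarith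
    · have hpv : v.1 ≤ p₁ := by
        by_contra hcon
        push Not at hcon
        exact hp (h.upper_side_int hvω hκ (by simp only; linarith) hx hcon)
      refine ⟨v, hv, (max v.1 q₁, p₂), Or.inl ?_, ?_, ?_⟩
      · rw [segment_symm]
        exact mem_segment_horizontal (le_max_right _ _) (max_le hpv hx)
      · simp only
        rw [abs_of_nonpos (by linarith [le_max_left v.1 q₁])]
        rcases max_choice v.1 q₁ with e | e <;> rw [e] <;> linarith
      · rw [e, sub_sub_cancel_left, abs_neg, abs_of_pos hε]

/-- A finite family of segments in `ω` that meets all lower cuts and the necessary upper cuts is a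
skeleton. -/
theorem Stair.isSkeleton_of_cuts (h : Stair ω c d) (hfin : S.Finite)
    (hseg : ∀ s ∈ S, IsLineSegment s) (hin : ∀ s ∈ S, s ⊆ ω)
    (hlow : ∀ ζ, c ≤ ζ → ¬ d ≤ ζ → MeetsLower S ζ) (hup : UpperCuts ω d S) :
    IsSkeleton ω S := by
  have hK : IsCompact (⋃₀ S) := by
    rw [sUnion_eq_biUnion]
    exact hfin.isCompact_biUnion fun s hs => (hseg s hs).isCompact
  have hS : ⋃₀ S ⊆ ω := sUnion_subset hin
  refine ⟨hseg, hin, ?_⟩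
  rintro ⟨p₁, p₂⟩ ⟨q₁, q₂⟩ hp hq hpq γ hγ
  have h1 := hpq _ ⟨_, Or.inl rfl, rfl⟩
  have h2 := hpq _ ⟨_, Or.inr rfl, rfl⟩
  have key : (γ ∩ ⋃₀ S).Nonempty := by
    obtain ⟨k, rfl | rfl, rfl⟩ := hγ
    · -- the same path, run backwards
      have e : ∀ k p q : Plane, segment ℝ p k ∪ segment ℝ k q = segment ℝ q k ∪ segment ℝ k p := by
        intro k p q
        rw [union_comm, segment_symm ℝ k q, segment_symm ℝ p k]
      rw [e] at h1 h2 ⊢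
      exact h.meets_path hK hS hlow hup hq hp h1 h2
    · exact h.meets_path hK hS hlow hup hp hq h2 h1
  obtain ⟨x, hx, s, hs, hxs⟩ := key
  exact ⟨s, hs, x, hx, hxs⟩

end Cuts

/-! ### The invariant of the procedure -/

/-- The choices of the procedure, described without reference to the boundary polygon. -/
def AbsSelects (ω : Set Plane) (c d : Plane) (l : List (Set Plane)) (s : Set Plane) : Prop :=
  (l = [] ∧ CornerEdge ω c d s) ∨
  (l ≠ [] ∧ ∃ f, IsFrontierOf ω (edges l) f ∧ IsMaximalFrontierEdge ω (edges l) f s)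

/-- The states that the procedure can reach, described without reference to the boundary
polygon. -/
inductive AbsRun (ω : Set Plane) (c d : Plane) : List (Set Plane) → Prop
  | start : AbsRun ω c d []
  | step (l : List (Set Plane)) (s : Set Plane) : AbsRun ω c d l → ¬ Terminated ω d l →
      AbsSelects ω c d l s → AbsRun ω c d (s :: l)

lemma edges_cons (s : Set Plane) (l : List (Set Plane)) : edges (s :: l) = insert s (edges l) := by
  ext t
  simp [edges]

/-- The invariant of a state `l` whose bounding box has the corners `c` and `z`. The chosen edges
meet all lower cuts that pass below or to the left of `z`. Every finite skeleton has at least as many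
segments that stay below `z` as edges were chosen. Either there is a frontier at `z`, and the chosen
edges meet all upper cuts that pass below or to the left of `z`, or `z` is the opposite extreme
corner, and all the upper cuts that a skeleton needs are met. -/
structure Invariant (ω : Set Plane) (c d : Plane) (l : List (Set Plane)) (z : Plane) : Prop where
  mem : z ∈ ω
  lt₁ : c.1 < z.1
  lt₂ : c.2 < z.2
  boxed : Boxed c z (edges l)
  vis : ∀ s ∈ edges l, IsVisibilityEdge ω s
  lower : ∀ ζ, c ≤ ζ → ¬ z ≤ ζ → MeetsLower (edges l) ζ
  count : ∀ T, T.Finite → IsSkeleton ω T →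
    ∃ F : Finset (Set Plane), (↑F : Set (Set Plane)) ⊆ T ∧ F.card = l.length ∧ ∀ t ∈ F, t ⊆ Iic z
  phase : ((VState ω c d z ∨ HState ω c d z) ∧ ∀ ζ, ζ ≤ z → ¬ ζ ≤ c → MeetsUpper (edges l) ζ) ∨
    (z = d ∧ UpperCuts ω d (edges l))

section

variable {ω : Set Plane} {c d : Plane}

/-- The upper end of a maximal edge at `c` bounds some segment of every finite skeleton: one that
starts on the left side, because all that can be seen from there lies below this end. -/
lemma LeftMax.spec (h : Stair ω c d) {z : Plane} (hz : LeftMax ω c d (c, z)) :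
    c.1 < z.1 ∧ c.2 < z.2 ∧ IsVisibilityEdge ω (segment ℝ c z) ∧
      ∀ T, T.Finite → IsSkeleton ω T → ∃ t ∈ T, t ⊆ Iic z := by
  obtain ⟨z', r⟩ := h.exists_leftReach
  obtain rfl := r.eq_of_leftMax h hz
  refine ⟨r.lt₁, r.lt₂, hz.1.2.2, fun T hTf hT => ?_⟩
  obtain ⟨t, ht, p, hp, hp1, -⟩ := exists_limit_from_right hTf hT.segments h.lt₁
    (fun x hx => h.skeleton_covers hT hx)
  have htω := hT.inside t ht
  refine ⟨t, ht, fun q hq => r.max p (htω hp) hp1 q ?_⟩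
  obtain ⟨a, b, -, rfl⟩ := hT.segments t ht
  exact (segment_subset_of_mem hp hq).trans htω

lemma CornerEdge.spec (h : Stair ω c d) {s : Set Plane} (hs : CornerEdge ω c d s) :
    ∃ z, s = segment ℝ c z ∧ c.1 < z.1 ∧ c.2 < z.2 ∧ IsVisibilityEdge ω s ∧
      ∀ T, T.Finite → IsSkeleton ω T → ∃ t ∈ T, t ⊆ Iic z := by
  obtain ⟨z, rfl, hz | hz⟩ := hs
  · exact ⟨z, rfl, hz.spec h⟩
  · obtain ⟨h1, h2, h3, h4⟩ := (bottomMax_iff_swap.1 hz).spec h.swap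
    refine ⟨z, rfl, h2, h1, ?_, fun T hTf hT => ?_⟩
    · have := isVisibilityEdge_image isSymm_swapL.invol h3
      rwa [swapL_image_swapL_image, swapL_image_segment] at this
    · obtain ⟨_, ⟨t, ht, rfl⟩, hsub⟩ := h4 _ (hTf.image _) (isSymm_swapL.isSkeleton_image hT)
      exact ⟨t, ht, fun p hp => ⟨(hsub (mem_image_of_mem _ hp)).2,
        (hsub (mem_image_of_mem _ hp)).1⟩⟩

lemma Stair.exists_cornerEdge (h : Stair ω c d) : ∃ s, CornerEdge ω c d s := by
  obtain ⟨zl, rl⟩ := h.exists_leftReach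
  obtain ⟨z, rb⟩ := h.swap.exists_leftReach
  obtain ⟨zb, rfl⟩ : ∃ zb, z = swapL zb := ⟨swapL z, rfl⟩
  rcases h.seen_from_corner rl rb with hs | hs
  · exact ⟨_, zl, rfl, Or.inl (rl.leftMax h hs)⟩
  · exact ⟨_, zb, rfl, Or.inr (bottomMax_iff_swap.2
      (rb.leftMax h.swap (segment_subset_swapL_image.2 hs)))⟩

lemma MeetsLower.insert {S : Set (Set Plane)} {ζ : Plane} (hm : MeetsLower S ζ) (s : Set Plane) :
    MeetsLower (insert s S) ζ := by
  obtain ⟨v, hv, h⟩ := hm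
  exact ⟨v, sUnion_subset_sUnion (subset_insert _ _) hv, h⟩

lemma MeetsUpper.insert {S : Set (Set Plane)} {ζ : Plane} (hm : MeetsUpper S ζ) (s : Set Plane) :
    MeetsUpper (insert s S) ζ := by
  obtain ⟨v, hv, h⟩ := hm
  exact ⟨v, sUnion_subset_sUnion (subset_insert _ _) hv, h⟩

/-- An edge that rises to the corner `z` of the box leads to the next state of the procedure, or
ends the procedure. -/
lemma Stair.phase_of_rising (h : Stair ω c d) {S : Set (Set Plane)} {s : Set Plane}
    (hs : IsVisibilityEdge ω s) {w z : Plane} (hw : w ∈ s) (hz : z ∈ s) (hwz₁ : w.1 < z.1)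
    (hwz₂ : w.2 < z.2) (hle : ∀ p ∈ s, p ≤ z)
    (hup : ∀ ζ, ζ ≤ z → ¬ ζ ≤ c → MeetsUpper S ζ) :
    ((VState ω c d z ∨ HState ω c d z) ∧ ∀ ζ, ζ ≤ z → ¬ ζ ≤ c → MeetsUpper S ζ) ∨
      (z = d ∧ UpperCuts ω d S) := by
  by_cases hzd : z = d
  · refine Or.inr ⟨hzd, fun κ hκ x y _ _ _ _ _ => ?_⟩
    have hb := h.bounds_int hκ
    refine ⟨κ.1 - c.1, sub_pos.2 hb.1, fun ε hε hε' => hup _ ?_ fun hc => ?_⟩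
    · rw [hzd]
      exact ⟨by simp only; linarith, by simp only; linarith⟩
    · have := hc.1
      simp only at this
      linarith
  · exact Or.inl ⟨h.nextState hs hw hz hwz₁ hwz₂ hle hzd, hup⟩

lemma Invariant.first (h : Stair ω c d) {s : Set Plane} (hs : CornerEdge ω c d s) :
    ∃ z ∈ s, Invariant ω c d [s] z := by
  obtain ⟨z, rfl, h1, h2, hvis, hT⟩ := hs.spec h
  have e : edges [segment ℝ c z] = {segment ℝ c z} := by ext; simp [edges]
  have hle : ∀ p ∈ segment ℝ c z, p ≤ z := by
    intro p hp
    obtain ⟨t, ht, e1, e2⟩ := mem_segment_iff.1 hp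
    have ht1 := ht.2
    exact ⟨by rw [e1]; nlinarith, by rw [e2]; nlinarith⟩
  refine ⟨z, right_mem_segment _ _ _, hvis.inside (right_mem_segment _ _ _), h1, h2, ?_, ?_, ?_,
    fun T hTf hTs => ?_, ?_⟩
  · rw [e]
    constructor
    · rw [sUnion_singleton, ← uIcc_of_le h1.le, ← segment_eq_uIcc]
      exact image_segment ℝ (LinearMap.fst ℝ ℝ ℝ).toAffineMap c z
    · rw [sUnion_singleton, ← uIcc_of_le h2.le, ← segment_eq_uIcc]
      exact image_segment ℝ (LinearMap.snd ℝ ℝ ℝ).toAffineMap c z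
  · rw [e]
    rintro _ rfl
    exact hvis
  · rw [e]
    intro ζ hc hz
    obtain ⟨v, hv, h3⟩ := hvis.segment.meets_lower (left_mem_segment _ _ _) hc
      (right_mem_segment _ _ _) hz
    exact ⟨v, ⟨_, rfl, hv⟩, h3⟩
  · obtain ⟨t, ht, hsub⟩ := hT T hTf hTs
    exact ⟨{t}, by simpa using ht, by simp, by simpa using hsub⟩
  · refine h.phase_of_rising hvis (left_mem_segment _ _ _) (right_mem_segment _ _ _) h1 h2 hle ?_
    rw [e]
    intro ζ hz hc
    obtain ⟨v, hv, h3⟩ := hvis.segment.meets_upper (right_mem_segment _ _ _) hz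
      (left_mem_segment _ _ _) hc
    exact ⟨v, ⟨_, rfl, hv⟩, h3⟩

lemma image_sUnion_insert {π : Plane → ℝ} (hπ : Continuous π) {S : Set (Set Plane)} {s : Set Plane}
    {l r r' : ℝ} (hS : π '' ⋃₀ S = Icc l r) (hs : IsLineSegment s) (hl : ∀ p ∈ s, l ≤ π p)
    (hr : ∀ p ∈ s, π p ≤ r') (hrr : r ≤ r') (hw : ∃ w ∈ s, π w ≤ r)
    (hreach : r' = r ∨ ∃ p ∈ s, π p = r') : π '' ⋃₀ insert s S = Icc l r' := by
  rw [sUnion_insert, image_union, hS]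
  refine Subset.antisymm (union_subset ?_ (Icc_subset_Icc le_rfl hrr)) fun x hx => ?_
  · rintro _ ⟨p, hp, rfl⟩
    exact ⟨hl p hp, hr p hp⟩
  · rcases le_or_gt x r with hxr | hxr
    · exact Or.inr ⟨hx.1, hxr⟩
    · rcases hreach with rfl | ⟨p, hp, rfl⟩
      · exact absurd hx.2 (not_le.2 hxr)
      · obtain ⟨w, hw, hwr⟩ := hw
        exact Or.inl (hs.isPreconnected.intermediate_value hw hp hπ.continuousOn
          ⟨hwr.trans hxr.le, hx.2⟩)

variable {l : List (Set Plane)} {z : Plane}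

lemma Invariant.stepResult (h : Stair ω c d) (i : Invariant ω c d l z) (hz : z ≠ d) :
    ∃ z', StepResult ω d z (edges l) z' := by
  rcases i.phase with ⟨hv | hv, -⟩ | ⟨hzd, -⟩
  · exact hv.stepResult h i.boxed
  · exact HState.stepResult hv h i.boxed
  · exact absurd hzd hz

/-- A last edge that does not rise to `d`, because the box is already as high as `ω`: it reaches the
right side of `ω`, and an upper cut that is not met before has an end that is not on this side, so
the edge passes above it. The same holds with the coordinates exchanged. -/
lemma Invariant.upperCuts_of_reach (h : Stair ω c d) (i : Invariant ω c d l z)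
    (hup : ∀ ζ, ζ ≤ z → ¬ ζ ≤ c → MeetsUpper (edges l) ζ) {s : Set Plane}
    (e : StepEdge ω d z d s)
    (hk : (z.2 = d.2 ∧ ∃ w ∈ s, w.1 ≤ z.1) ∨ (z.1 = d.1 ∧ ∃ w ∈ s, w.2 ≤ z.2)) :
    UpperCuts ω d (insert s (edges l)) := by
  intro κ hκ x y hx hy hxi hyi hxy
  have hb := h.bounds_int hκ
  refine ⟨min (κ.1 - c.1) (κ.2 - c.2), lt_min (sub_pos.2 hb.1) (sub_pos.2 hb.2.2.1),
    fun ε hε hε' => ?_⟩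
  rw [lt_min_iff] at hε'
  have hc : ¬ ((κ.1 - ε, κ.2 - ε) : Plane) ≤ c := fun hc => by
    have := hc.1
    simp only at this
    linarith
  by_cases hζ : ((κ.1 - ε, κ.2 - ε) : Plane) ≤ z
  · exact (hup _ hζ hc).insert s
  have key : ∃ p ∈ s, ((κ.1 - ε, κ.2 - ε) : Plane) ≤ p ∧
      ∃ w ∈ s, ¬ ((κ.1 - ε, κ.2 - ε) : Plane) ≤ w := by
    rcases hk with ⟨hzd, w, hw, hwz⟩ | ⟨hzd, w, hw, hwz⟩
    · have h1 : z.1 < κ.1 - ε := by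
        by_contra hcon
        exact hζ ⟨not_lt.1 hcon, by simp only; linarith⟩
      have hx' : x < d.1 := by
        refine hxy.resolve_right fun hy' => hyi ?_
        exact h.right_side_int i.mem hκ (by linarith) hy (by linarith)
      obtain ⟨p, hp, hpd⟩ := e.reach₁.resolve_left (by linarith)
      refine ⟨p, hp, ⟨by simp only; linarith, ?_⟩, w, hw, fun hcon => ?_⟩
      · by_contra hcon
        simp only [not_le] at hcon
        exact hxi (h.upper_side_int (e.vis.inside hp) hκ (by linarith) hx (by linarith))
      · have := hcon.1
        simp only at this
        linarith
    · have h1 : z.2 < κ.2 - ε := by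
        by_contra hcon
        exact hζ ⟨by simp only; linarith, not_lt.1 hcon⟩
      have hy' : y < d.2 := by
        refine hxy.resolve_left fun hx' => hxi ?_
        exact h.upper_side_int i.mem hκ (by linarith) hx (by linarith)
      obtain ⟨p, hp, hpd⟩ := e.reach₂.resolve_left (by linarith)
      refine ⟨p, hp, ⟨?_, by simp only; linarith⟩, w, hw, fun hcon => ?_⟩
      · by_contra hcon
        simp only [not_le] at hcon
        exact hyi (h.right_side_int (e.vis.inside hp) hκ (by linarith) hy (by linarith))
      · have := hcon.2
        simp only at this
        linarith
  obtain ⟨p, hp, hpζ, w, hw, hwζ⟩ := key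
  obtain ⟨v, hv, h3⟩ := e.vis.segment.meets_upper hp hpζ hw hwζ
  exact ⟨v, ⟨s, mem_insert _ _, hv⟩, h3⟩

/-- Any maximal edge for the current frontier preserves the invariant. -/
lemma Invariant.next (h : Stair ω c d) (i : Invariant ω c d l z) (hz : z ≠ d) {z' : Plane}
    (r : StepResult ω d z (edges l) z') {f s : Set Plane} (hf : IsFrontierOf ω (edges l) f)
    (hs : IsMaximalFrontierEdge ω (edges l) f s) : Invariant ω c d (s :: l) z' := by
  have e := r.edge f s hf hs
  obtain ⟨w, hw, hwz⟩ := e.start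
  have hup : ∀ ζ, ζ ≤ z → ¬ ζ ≤ c → MeetsUpper (edges l) ζ := by
    rcases i.phase with h1 | h1
    · exact h1.2
    · exact absurd h1.1 hz
  refine ⟨r.mem, i.lt₁.trans_le r.le.1, i.lt₂.trans_le r.le.2, ?_, ?_, ?_, ?_, ?_⟩
  · rw [edges_cons]
    exact ⟨image_sUnion_insert continuous_fst i.boxed.fst e.vis.segment
        (fun p hp => (h.bounds (e.vis.inside hp)).1) (fun p hp => (e.le p hp).1) r.le.1
        ⟨w, hw, hwz.1⟩ e.reach₁,
      image_sUnion_insert continuous_snd i.boxed.snd e.vis.segment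
        (fun p hp => (h.bounds (e.vis.inside hp)).2.2.1) (fun p hp => (e.le p hp).2) r.le.2
        ⟨w, hw, hwz.2⟩ e.reach₂⟩
  · rw [edges_cons]
    rintro t (rfl | ht)
    · exact e.vis
    · exact i.vis t ht
  · rw [edges_cons]
    intro ζ hc hz'
    by_cases hzζ : z ≤ ζ
    · obtain ⟨q, hq, hqζ⟩ : ∃ q ∈ s, ¬ q ≤ ζ := by
        rw [Prod.le_def, not_and_or, not_le, not_le] at hz'
        rcases hz' with h1 | h1
        · obtain ⟨q, hq, hq1⟩ := e.reach₁.resolve_left (by linarith [hzζ.1])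
          exact ⟨q, hq, fun hcon => by linarith [hcon.1]⟩
        · obtain ⟨q, hq, hq1⟩ := e.reach₂.resolve_left (by linarith [hzζ.2])
          exact ⟨q, hq, fun hcon => by linarith [hcon.2]⟩
      obtain ⟨v, hv, h3⟩ := e.vis.segment.meets_lower hw (hwz.trans hzζ) hq hqζ
      exact ⟨v, ⟨s, mem_insert _ _, hv⟩, h3⟩
    · exact (i.lower ζ hc hzζ).insert s
  · -- the segment of `T` that stays below `z'` but not below `z` is a new one
    intro T hTf hT
    classical
    obtain ⟨F, hFT, hcard, hF⟩ := i.count T hTf hT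
    obtain ⟨t, ht, h1, h2⟩ := r.cut T hTf hT
    have htF : t ∉ F := fun hcon => h1 (hF t hcon)
    refine ⟨insert t F, ?_, by rw [Finset.card_insert_of_notMem htF, hcard, List.length_cons], ?_⟩
    · rw [Finset.coe_insert]
      exact insert_subset ht hFT
    · intro u hu
      rcases Finset.mem_insert.1 hu with rfl | hu
      · exact h2
      · exact (hF u hu).trans (Iic_subset_Iic.2 r.le)
  · rw [edges_cons]
    rcases e.kind with ⟨hz's, w', hw', h1, h2⟩ | ⟨rfl, hk⟩
    · refine h.phase_of_rising e.vis hw' hz's h1 h2 e.le fun ζ hζ hc => ?_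
      by_cases hζz : ζ ≤ z
      · exact (hup ζ hζz hc).insert s
      · obtain ⟨v, hv, h3⟩ := e.vis.segment.meets_upper hz's hζ hw (fun hcon => hζz (hcon.trans hwz))
        exact ⟨v, ⟨s, mem_insert _ _, hv⟩, h3⟩
    · exact Or.inr ⟨rfl, i.upperCuts_of_reach h hup e hk⟩

lemma Invariant.terminated_iff (h : Stair ω c d) (i : Invariant ω c d l z) (hl : l ≠ []) :
    Terminated ω d l ↔ z = d := by
  constructor
  · rintro ⟨-, ht⟩
    by_contra hz
    rcases ht with ht | ht
    · cases l with
      | nil => exact hl rfl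
      | cons s l =>
        have h1 : d ≤ z := (i.boxed.subset_Iic ⟨s, by simp [edges], ht⟩).2
        have h2 := h.bounds i.mem
        exact hz (Prod.ext (le_antisymm h2.2.1 h1.1) (le_antisymm h2.2.2.2 h1.2))
    · obtain ⟨z', r⟩ := i.stepResult h hz
      exact ht r.frontier.exists
  · rintro rfl
    refine ⟨hl, Or.inr ?_⟩
    rintro ⟨f, x, ⟨hx, hxi⟩, -⟩
    rw [i.boxed.boundingBox_eq h.lt₁.le h.lt₂.le, mem_frontier_Icc h.lt₁.le h.lt₂.le] at hx
    have hb := h.bounds_int hxi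
    rcases hx.2 with e | e | e | e <;> linarith

lemma AbsRun.invariant (h : Stair ω c d) (hr : AbsRun ω c d l) (hl : l ≠ []) :
    ∃ z, Invariant ω c d l z := by
  induction hr with
  | start => exact absurd rfl hl
  | step l s hr ht hs ih =>
    rcases hs with ⟨rfl, hs⟩ | ⟨hl', f, hf, hs⟩
    · obtain ⟨z, -, i⟩ := Invariant.first h hs
      exact ⟨z, i⟩
    · obtain ⟨z, i⟩ := ih hl'
      have hz : z ≠ d := fun e => ht ((i.terminated_iff h hl').2 e)
      obtain ⟨z', r⟩ := i.stepResult h hz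
      exact ⟨z', i.next h hz r hf hs⟩

end

/-- The procedure computes a minimum skeleton, whatever choices are made. -/
structure Correct (ω : Set Plane) (c d : Plane) : Prop where
  bounded : ∃ N : ℕ, ∀ l, AbsRun ω c d l → l.length ≤ N
  progress : ∀ l, AbsRun ω c d l → ¬ Terminated ω d l →
    (l ≠ [] → ∃! f, IsFrontierOf ω (edges l) f) ∧ ∃ s, AbsSelects ω c d l s
  reach : ∀ l, AbsRun ω c d l → ¬ Terminated ω d l →
    ∃ m, AbsRun ω c d (m ++ l) ∧ ReachesCorner d (m ++ l)
  minimum : ∀ l, AbsRun ω c d l → Terminated ω d l → IsMinimumSkeleton ω (edges l)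

/-- The invariant gives the correctness of the procedure. Every finite skeleton has at least as many
segments as there are edges in a state, so a finite skeleton bounds the number of steps, and the
edges returned form a minimum skeleton as soon as they form a skeleton. -/
theorem Stair.correct {ω : Set Plane} {c d : Plane} (h : Stair ω c d) {T : Set (Set Plane)}
    (hTf : T.Finite) (hT : IsSkeleton ω T) : Correct ω c d := by
  have hlen : ∀ T, T.Finite → IsSkeleton ω T → ∀ l, AbsRun ω c d l →
      (l.length : ℕ∞) ≤ T.encard := by
    intro T hTf hT l hr
    rcases eq_or_ne l [] with rfl | hl
    · simp
    obtain ⟨z, i⟩ := hr.invariant h hl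
    obtain ⟨F, hFT, hcard, -⟩ := i.count T hTf hT
    rw [← hcard, ← encard_coe_eq_coe_finsetCard]
    exact encard_le_encard hFT
  have hbound : ∀ l, AbsRun ω c d l → l.length ≤ T.ncard := fun l hr => by
    have := hlen T hTf hT l hr
    rw [← hTf.cast_ncard_eq] at this
    exact_mod_cast this
  have hsel : ∀ l, AbsRun ω c d l → ¬ Terminated ω d l → ∃ s, AbsSelects ω c d l s ∧
      ∃ z, Invariant ω c d (s :: l) z ∧ (z = d → d ∈ s) := by
    intro l hr ht
    rcases eq_or_ne l [] with rfl | hl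
    · obtain ⟨s, hs⟩ := h.exists_cornerEdge
      obtain ⟨z, hz, i⟩ := Invariant.first h hs
      exact ⟨s, Or.inl ⟨rfl, hs⟩, z, i, fun e => e ▸ hz⟩
    · obtain ⟨z, i⟩ := hr.invariant h hl
      have hz : z ≠ d := fun e => ht ((i.terminated_iff h hl).2 e)
      obtain ⟨z', r⟩ := i.stepResult h hz
      obtain ⟨f, s, hf, hs, hz'⟩ := r.exists_edge
      exact ⟨s, Or.inr ⟨hl, f, hf, hs⟩, z', i.next h hz r hf hs, fun e => e ▸ hz'⟩
  refine ⟨⟨_, hbound⟩, fun l hr ht => ⟨fun hl => ?_, ?_⟩, ?_, fun l hr ht => ?_⟩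
  · obtain ⟨z, i⟩ := hr.invariant h hl
    obtain ⟨z', r⟩ := i.stepResult h fun e => ht ((i.terminated_iff h hl).2 e)
    exact r.frontier
  · obtain ⟨s, hs, -⟩ := hsel l hr ht
    exact ⟨s, hs⟩
  · -- choosing an edge that contains the next corner of the box each time ends at `d`
    suffices H : ∀ n : ℕ, ∀ l, AbsRun ω c d l → ¬ Terminated ω d l → T.ncard ≤ l.length + n →
        ∃ m, AbsRun ω c d (m ++ l) ∧ ReachesCorner d (m ++ l) from
      fun l hr ht => H T.ncard l hr ht (Nat.le_add_left _ _)
    intro n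
    induction n with
    | zero =>
      intro l hr ht hle
      obtain ⟨s, hs, -⟩ := hsel l hr ht
      have := hbound _ (AbsRun.step l s hr ht hs)
      rw [List.length_cons] at this
      omega
    | succ n ih =>
      intro l hr ht hle
      obtain ⟨s, hs, z, i, hz⟩ := hsel l hr ht
      have hr' := AbsRun.step l s hr ht hs
      by_cases hzd : z = d
      · exact ⟨[s], hr', hz hzd⟩
      · have ht' : ¬ Terminated ω d (s :: l) := fun hcon =>
          hzd ((i.terminated_iff h (List.cons_ne_nil _ _)).1 hcon)
        obtain ⟨m, hm⟩ := ih (s :: l) hr' ht' (by rw [List.length_cons]; omega)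
        exact ⟨m ++ [s], by simpa using hm⟩
  · obtain ⟨z, i⟩ := hr.invariant h ht.1
    obtain rfl := (i.terminated_iff h ht.1).1 ht
    have hfin : (edges l).Finite := List.finite_toSet l
    have hup : UpperCuts ω z (edges l) := by
      rcases i.phase with ⟨hv | hv, -⟩ | h1
      · exact absurd hv.lt_right (lt_irrefl _)
      · exact absurd hv.lt_right (lt_irrefl _)
      · exact h1.2
    refine ⟨h.isSkeleton_of_cuts hfin (fun s hs => (i.vis s hs).segment)
      (fun s hs => (i.vis s hs).inside) i.lower hup, hfin, fun T' hT' => ?_⟩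
    rcases T'.finite_or_infinite with hf | hf
    · refine le_trans ?_ (hlen T' hf hT' l hr)
      classical
      have e : edges l = ↑l.toFinset := by ext; simp [edges]
      rw [e, encard_coe_eq_coe_finsetCard]
      exact_mod_cast l.toFinset_card_le
    · rw [hf.encard_eq]
      exact le_top

/-! ### Invariance of the procedure under symmetries -/

section

variable {φ : Plane ≃L[ℝ] Plane} {ω : Set Plane} {c d : Plane} {l : List (Set Plane)} {s : Set Plane}

lemma IsSymm.reachesCorner_map (hφ : IsSymm φ) :
    ReachesCorner (φ d) (l.map (φ '' ·)) ↔ ReachesCorner d l := by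
  cases l with
  | nil => rfl
  | cons s l =>
    change φ d ∈ φ '' s ↔ d ∈ s
    rw [mem_image_of_invol hφ.invol, hφ.invol]

lemma IsSymm.exists_frontier_image (hφ : IsSymm φ) {S : Set (Set Plane)} :
    (∃ f, IsFrontierOf (φ '' ω) (mapSets φ S) f) ↔ ∃ f, IsFrontierOf ω S f := by
  constructor
  · rintro ⟨f, hf⟩
    refine ⟨φ '' f, hφ.isFrontierOf_image_iff.1 ?_⟩
    rwa [image_image_of_invol hφ.invol]
  · rintro ⟨f, hf⟩
    exact ⟨φ '' f, hφ.isFrontierOf_image hf⟩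

lemma IsSymm.terminated_map (hφ : IsSymm φ) :
    Terminated (φ '' ω) (φ d) (l.map (φ '' ·)) ↔ Terminated ω d l := by
  rw [Terminated, Terminated, hφ.reachesCorner_map, mapSets_edges, hφ.exists_frontier_image, Ne,
    List.map_eq_nil_iff]

lemma IsSymm.absSelects_map (hφ : IsSymm φ) (h₁ : c.1 ≠ d.1) (h₂ : c.2 ≠ d.2)
    (h : AbsSelects ω c d l s) :
    AbsSelects (φ '' ω) (φ c) (φ d) (l.map (φ '' ·)) (φ '' s) := by
  rcases h with ⟨rfl, h⟩ | ⟨hl, f, hf, hs⟩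
  · exact Or.inl ⟨rfl, hφ.corner _ _ _ _ h₁ h₂ h⟩
  · refine Or.inr ⟨by simpa using hl, φ '' f, ?_, ?_⟩
    · rw [mapSets_edges]
      exact hφ.isFrontierOf_image hf
    · rw [mapSets_edges]
      exact hφ.maximal _ _ _ _ hs

lemma IsSymm.absRun_map (hφ : IsSymm φ) (h₁ : c.1 ≠ d.1) (h₂ : c.2 ≠ d.2) (h : AbsRun ω c d l) :
    AbsRun (φ '' ω) (φ c) (φ d) (l.map (φ '' ·)) := by
  induction h with
  | start => exact AbsRun.start
  | step l s _ ht hs ih =>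
    exact AbsRun.step _ _ ih (fun hcon => ht (hφ.terminated_map.1 hcon))
      (hφ.absSelects_map h₁ h₂ hs)

lemma Correct.of_image (hφ : IsSymm φ) (h₁ : c.1 ≠ d.1) (h₂ : c.2 ≠ d.2)
    (h₁' : (φ c).1 ≠ (φ d).1) (h₂' : (φ c).2 ≠ (φ d).2) (h : Correct (φ '' ω) (φ c) (φ d)) :
    Correct ω c d := by
  have hinv : ∀ l : List (Set Plane), (l.map (φ '' ·)).map (φ '' ·) = l := by
    intro l
    rw [List.map_map]
    convert List.map_id l using 2
    funext s
    exact image_image_of_invol hφ.invol s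
  have hrun := fun l => hφ.absRun_map (ω := ω) (c := c) (d := d) (l := l) h₁ h₂
  have hrun' := fun l => hφ.absRun_map (ω := φ '' ω) (c := φ c) (d := φ d) (l := l) h₁' h₂'
  simp only [image_image_of_invol hφ.invol, hφ.invol] at hrun'
  refine ⟨?_, fun l hr ht => ⟨fun hl => ?_, ?_⟩, fun l hr ht => ?_, fun l hr ht => ?_⟩
  · obtain ⟨N, hN⟩ := h.bounded
    exact ⟨N, fun l hr => by simpa using hN _ (hrun l hr)⟩
  · obtain ⟨f, hf, huniq⟩ := (h.progress _ (hrun l hr) (fun hcon => ht (hφ.terminated_map.1 hcon))).1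
      (by simpa using hl)
    rw [mapSets_edges] at hf
    refine ⟨φ '' f, ?_, fun g hg => ?_⟩
    · refine hφ.isFrontierOf_image_iff.1 ?_
      rw [image_image_of_invol hφ.invol]
      exact hf
    · have := huniq (φ '' g) (by
        simp only [mapSets_edges]
        exact hφ.isFrontierOf_image hg)
      rw [← this, image_image_of_invol hφ.invol]
  · obtain ⟨s, hs⟩ := (h.progress _ (hrun l hr) (fun hcon => ht (hφ.terminated_map.1 hcon))).2
    have := hφ.absSelects_map h₁' h₂' hs
    rw [hinv, image_image_of_invol hφ.invol, hφ.invol, hφ.invol] at this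
    exact ⟨_, this⟩
  · obtain ⟨m, hm, hd⟩ := h.reach _ (hrun l hr) (fun hcon => ht (hφ.terminated_map.1 hcon))
    have e : (m ++ l.map (φ '' ·)).map (φ '' ·) = m.map (φ '' ·) ++ l := by
      rw [List.map_append, hinv]
    refine ⟨m.map (φ '' ·), e ▸ hrun' _ hm, ?_⟩
    have h3 := hφ.reachesCorner_map.2 hd
    rwa [e, hφ.invol] at h3
  · have h3 := h.minimum _ (hrun l hr) (hφ.terminated_map.2 ht)
    rw [mapSets_edges] at h3
    exact hφ.isMinimumSkeleton_of_image h3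

lemma mem_flipL_image {A : Set Plane} {p : Plane} : p ∈ flipL '' A ↔ (-p.1, p.2) ∈ A :=
  mem_image_of_invol isSymm_flipL.invol

lemma neg_mem_uIcc_neg {a b x : ℝ} : -x ∈ uIcc (-a) (-b) ↔ x ∈ uIcc a b := by
  rw [mem_uIcc, mem_uIcc]
  constructor <;> rintro (⟨h1, h2⟩ | ⟨h1, h2⟩)
  · exact Or.inr ⟨by linarith, by linarith⟩
  · exact Or.inl ⟨by linarith, by linarith⟩
  · exact Or.inr ⟨by linarith, by linarith⟩
  · exact Or.inl ⟨by linarith, by linarith⟩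

lemma neg_mem_uIcc {a b x : ℝ} : -x ∈ uIcc a b ↔ x ∈ uIcc (-a) (-b) := by
  rw [← neg_mem_uIcc_neg, neg_neg]

lemma RectConvex.flip (h : RectConvex ω) : RectConvex (flipL '' ω) where
  compact := h.compact.image flipL.continuous
  regular := by
    have h2 : closure (flipL '' interior ω) = flipL '' closure (interior ω) :=
      (flipL.toHomeomorph.image_closure _).symm
    rw [interior_image_equiv, h2, h.regular]
  path₁ p hp q hq x hx := by
    obtain ⟨y, hy, hm⟩ := h.path₁ _ (mem_flipL_image.1 hp) _ (mem_flipL_image.1 hq) (-x)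
      (neg_mem_uIcc_neg.2 hx)
    exact ⟨y, hy, mem_flipL_image.2 hm⟩
  path₂ p hp q hq y hy := by
    obtain ⟨x, hx, hm⟩ := h.path₂ _ (mem_flipL_image.1 hp) _ (mem_flipL_image.1 hq) y hy
    refine ⟨-x, ?_, mem_flipL_image.2 (by simpa using hm)⟩
    simpa using neg_mem_uIcc_neg.2 hx

lemma PreStair.flip (h : PreStair ω c d) : PreStair (flipL '' ω) (flipL c) (flipL d) where
  toRectConvex := h.toRectConvex.flip
  ne₁ := fun e => h.ne₁ (neg_injective e)
  ne₂ := h.ne₂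
  low_mem := mem_image_of_mem _ h.low_mem
  high_mem := mem_image_of_mem _ h.high_mem
  sub₁ p hp := neg_mem_uIcc.1 (h.sub₁ _ (mem_flipL_image.1 hp) :)
  sub₂ p hp := (h.sub₂ _ (mem_flipL_image.1 hp) :)
  dense₁ x hx h1 h2 := by
    obtain ⟨y, hy⟩ := h.dense₁ (-x) (neg_mem_uIcc.2 hx) (fun e => h1 (by simp [← e]))
      (fun e => h2 (by simp [← e]))
    refine ⟨y, ?_⟩
    rw [interior_image_equiv]
    exact mem_flipL_image.2 hy
  dense₂ y hy h1 h2 := by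
    obtain ⟨x, hx⟩ := h.dense₂ y hy h1 h2
    refine ⟨-x, ?_⟩
    rw [interior_image_equiv]
    exact mem_flipL_image.2 (by simpa using hx)
  side₁ := by
    obtain ⟨x, hx, hm⟩ := h.side₁
    exact ⟨-x, fun e => hx (neg_injective e), mem_flipL_image.2 (by simpa using hm)⟩
  side₂ := by
    obtain ⟨y, hy, hm⟩ := h.side₂
    exact ⟨y, hy, mem_flipL_image.2 (by simpa using hm)⟩

lemma PreStair.correct_of_lt (h : PreStair ω c d) (hlt : c.2 < d.2) {T : Set (Set Plane)}
    (hTf : T.Finite) (hT : IsSkeleton ω T) : Correct ω c d := by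
  rcases lt_or_gt_of_ne h.ne₁ with h1 | h1
  · exact Stair.correct ⟨h, h1, hlt⟩ hTf hT
  · refine Correct.of_image isSymm_flipL h.ne₁ h.ne₂ h.flip.ne₁ h.flip.ne₂ ?_
    exact Stair.correct ⟨h.flip, neg_lt_neg h1, hlt⟩ (hTf.image _) (isSymm_flipL.isSkeleton_image hT)

/-- The position of the extreme corners does not matter: two reflections move `c` to the lower
left. -/
theorem PreStair.correct (h : PreStair ω c d) {T : Set (Set Plane)} (hTf : T.Finite)
    (hT : IsSkeleton ω T) : Correct ω c d := by
  rcases lt_or_gt_of_ne h.ne₂ with h1 | h1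
  · exact h.correct_of_lt h1 hTf hT
  -- reflect in the horizontal axis
  have h2 := h.swap
  have h3 := h2.flip
  have h4 := h3.swap
  have hT2 := isSymm_swapL.isSkeleton_image hT
  have hT3 := isSymm_flipL.isSkeleton_image hT2
  have hT4 := isSymm_swapL.isSkeleton_image hT3
  refine Correct.of_image isSymm_swapL h.ne₁ h.ne₂ h2.ne₁ h2.ne₂ ?_
  refine Correct.of_image isSymm_flipL h2.ne₁ h2.ne₂ h3.ne₁ h3.ne₂ ?_
  refine Correct.of_image isSymm_swapL h3.ne₁ h3.ne₂ h4.ne₁ h4.ne₂ ?_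
  exact h4.correct_of_lt (neg_lt_neg h1) (((hTf.image _).image _).image _) hT4

end

/-! ### Regions with a rectilinear boundary polygon in general position -/

/-- The boundary of `ω` is the union of the axis-parallel segments from `u i` to `v i`, which meet
only in their ends, and no three of these ends lie on a horizontal or vertical line. The cyclic
order of the segments is not recorded. -/
structure Outline {ι : Type} (ω : Set Plane) (u v : ι → Plane) : Prop extends RectConvex ω where
  boundary : frontier ω = ⋃ i, segment ℝ (u i) (v i)
  ne : ∀ i, u i ≠ v i
  axis : ∀ i, (u i).1 = (v i).1 ∨ (u i).2 = (v i).2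
  end_mem : ∀ i, v i ∈ range u
  cross : ∀ i j, i ≠ j → ∀ p ∈ segment ℝ (u i) (v i), p ∈ segment ℝ (u j) (v j) → p ∈ range u
  gen₁ : ∀ p ∈ range u, ∀ q ∈ range u, ∀ r ∈ range u, p.1 = q.1 → q.1 = r.1 →
    p = q ∨ q = r ∨ p = r
  gen₂ : ∀ p ∈ range u, ∀ q ∈ range u, ∀ r ∈ range u, p.2 = q.2 → q.2 = r.2 →
    p = q ∨ q = r ∨ p = r

namespace Outline

variable {ι : Type} {ω : Set Plane} {u v : ι → Plane}

lemma image_boundary {φ : Plane ≃L[ℝ] Plane} (h : Outline ω u v) :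
    frontier (φ '' ω) = ⋃ i, segment ℝ (φ (u i)) (φ (v i)) := by
  have h1 : frontier (φ '' ω) = φ '' frontier ω := (φ.toHomeomorph.image_frontier ω).symm
  rw [h1, h.boundary, image_iUnion]
  exact iUnion_congr fun i => image_segment_of_equiv φ _ _

lemma image_cross {φ : Plane ≃L[ℝ] Plane} (hφ : ∀ p, φ (φ p) = p) (h : Outline ω u v) (i j : ι)
    (hij : i ≠ j) (p : Plane) (hi : p ∈ segment ℝ (φ (u i)) (φ (v i)))
    (hj : p ∈ segment ℝ (φ (u j)) (φ (v j))) : p ∈ range (φ ∘ u) := by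
  rw [← image_segment_of_equiv, mem_image_of_invol hφ] at hi hj
  obtain ⟨k, hk⟩ := h.cross i j hij _ hi hj
  exact ⟨k, by rw [Function.comp_apply, hk, hφ]⟩

lemma swap (h : Outline ω u v) : Outline (swapL '' ω) (swapL ∘ u) (swapL ∘ v) where
  toRectConvex := h.toRectConvex.swap
  boundary := h.image_boundary
  ne i := swapL.injective.ne (h.ne i)
  axis i := (h.axis i).symm
  end_mem i := by
    obtain ⟨j, hj⟩ := h.end_mem i
    exact ⟨j, congrArg swapL hj⟩
  cross := h.image_cross isSymm_swapL.invol
  gen₁ := by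
    rintro _ ⟨i, rfl⟩ _ ⟨j, rfl⟩ _ ⟨k, rfl⟩ h1 h2
    exact (h.gen₂ _ ⟨i, rfl⟩ _ ⟨j, rfl⟩ _ ⟨k, rfl⟩ h1 h2).imp (congrArg swapL)
      (Or.imp (congrArg swapL) (congrArg swapL))
  gen₂ := by
    rintro _ ⟨i, rfl⟩ _ ⟨j, rfl⟩ _ ⟨k, rfl⟩ h1 h2
    exact (h.gen₁ _ ⟨i, rfl⟩ _ ⟨j, rfl⟩ _ ⟨k, rfl⟩ h1 h2).imp (congrArg swapL)
      (Or.imp (congrArg swapL) (congrArg swapL))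

lemma flip (h : Outline ω u v) : Outline (flipL '' ω) (flipL ∘ u) (flipL ∘ v) where
  toRectConvex := h.toRectConvex.flip
  boundary := h.image_boundary
  ne i := flipL.injective.ne (h.ne i)
  axis i := (h.axis i).imp (congrArg Neg.neg) id
  end_mem i := by
    obtain ⟨j, hj⟩ := h.end_mem i
    exact ⟨j, congrArg flipL hj⟩
  cross := h.image_cross isSymm_flipL.invol
  gen₁ := by
    rintro _ ⟨i, rfl⟩ _ ⟨j, rfl⟩ _ ⟨k, rfl⟩ h1 h2
    exact (h.gen₁ _ ⟨i, rfl⟩ _ ⟨j, rfl⟩ _ ⟨k, rfl⟩ (neg_injective h1) (neg_injective h2)).imp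
      (congrArg flipL) (Or.imp (congrArg flipL) (congrArg flipL))
  gen₂ := by
    rintro _ ⟨i, rfl⟩ _ ⟨j, rfl⟩ _ ⟨k, rfl⟩ h1 h2
    exact (h.gen₂ _ ⟨i, rfl⟩ _ ⟨j, rfl⟩ _ ⟨k, rfl⟩ h1 h2).imp
      (congrArg flipL) (Or.imp (congrArg flipL) (congrArg flipL))

lemma edge_subset_frontier (h : Outline ω u v) (i : ι) :
    segment ℝ (u i) (v i) ⊆ frontier ω := by
  rw [h.boundary]
  exact subset_iUnion (fun i => segment ℝ (u i) (v i)) i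

lemma frontier_subset (h : Outline ω u v) : frontier ω ⊆ ω := h.compact.isClosed.frontier_subset

lemma fst_of_mem {a b p : Plane} (hab : a.1 = b.1) (hp : p ∈ segment ℝ a b) : p.1 = a.1 := by
  obtain ⟨t, -, h1, -⟩ := mem_segment_iff.1 hp
  rw [h1, hab]
  ring

lemma snd_of_mem {a b p : Plane} (hab : a.2 = b.2) (hp : p ∈ segment ℝ a b) : p.2 = a.2 := by
  obtain ⟨t, -, -, h1⟩ := mem_segment_iff.1 hp
  rw [h1, hab]
  ring

/-- There is at most one vertical edge on a vertical line. -/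
lemma eq_of_vertical (h : Outline ω u v) {i j : ι} (hi : (u i).1 = (v i).1)
    (hj : (u j).1 = (v j).1) (hij : (u i).1 = (u j).1) : i = j := by
  by_contra hne
  have h1 : u i = u j ∨ v i = u j := by
    rcases h.gen₁ _ ⟨i, rfl⟩ _ (h.end_mem i) _ ⟨j, rfl⟩ hi (hi.symm.trans hij) with e | e | e
    · exact absurd e (h.ne i)
    · exact Or.inr e
    · exact Or.inl e
  have h2 : u i = v j ∨ v i = v j := by
    rcases h.gen₁ _ ⟨i, rfl⟩ _ (h.end_mem i) _ (h.end_mem j) hi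
      (hi.symm.trans (hij.trans hj)) with e | e | e
    · exact absurd e (h.ne i)
    · exact Or.inr e
    · exact Or.inl e
  have hseg : segment ℝ (u i) (v i) = segment ℝ (u j) (v j) := by
    rcases h1 with h1 | h1 <;> rcases h2 with h2 | h2
    · exact absurd (h1.symm.trans h2) (h.ne j)
    · rw [h1, h2]
    · rw [h1, h2, segment_symm]
    · exact absurd (h1.symm.trans h2) (h.ne j)
  have hm := midpoint_mem_segment (𝕜 := ℝ) (u i) (v i)
  have hv := h.cross i j hne _ hm (hseg ▸ hm)
  rcases h.gen₁ _ ⟨i, rfl⟩ _ (h.end_mem i) _ hv hi (hi.symm.trans (fst_of_mem hi hm).symm) with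
    e | e | e
  · exact h.ne i e
  · exact h.ne i ((midpoint_eq_right_iff ℝ).1 e.symm)
  · exact h.ne i ((left_eq_midpoint_iff ℝ).1 e)

lemma exists_top_edge (h : Outline ω u v) {x y : ℝ} (hxy : (x, y) ∈ interior ω)
    (hx : ∀ i, (u i).1 ≠ x) :
    ∃ i, (u i).2 = (v i).2 ∧ y < (u i).2 ∧ (x, (u i).2) ∈ segment ℝ (u i) (v i) := by
  have hcl : IsClosed (ω ∩ {p : Plane | p.1 = x}) :=
    h.compact.isClosed.inter (isClosed_eq continuous_fst continuous_const)
  obtain ⟨q, ⟨hqω, hqx⟩, hq⟩ := (h.compact.of_isClosed_subset hcl inter_subset_left).exists_isMaxOn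
    ⟨(x, y), interior_subset hxy, rfl⟩ (f := Prod.snd) (by fun_prop)
  simp only [mem_ofPred_eq] at hqx
  have hnot : ∀ t, (x, t) ∈ interior ω → t < q.2 := by
    intro t ht
    obtain ⟨ε, hε, hsq⟩ := mem_interior_iff_square.1 ht
    have h1 : t + ε / 2 ≤ q.2 := hq (a := (x, t + ε / 2)) ⟨hsq _ _ (by simpa using hε)
      (by simp only; rw [add_sub_cancel_left, abs_of_pos (by positivity)]; linarith), rfl⟩
    linarith
  have hqe : (x, q.2) = q := Prod.ext hqx.symm rfl
  have hfr : q ∈ frontier ω := ⟨subset_closure hqω, fun hi =>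
    lt_irrefl _ (hnot q.2 (hqe ▸ hi))⟩
  rw [h.boundary, mem_iUnion] at hfr
  obtain ⟨i, hi⟩ := hfr
  have hhor := (h.axis i).resolve_left fun e => hx i ((fst_of_mem e hi).symm.trans hqx)
  have hq2 := snd_of_mem hhor hi
  refine ⟨i, hhor, hq2 ▸ hnot y hxy, ?_⟩
  rw [← hq2, hqe]
  exact hi

lemma exists_bottom_edge (h : Outline ω u v) {x y : ℝ} (hxy : (x, y) ∈ interior ω)
    (hx : ∀ i, (u i).1 ≠ x) :
    ∃ i, (u i).2 = (v i).2 ∧ (u i).2 < y ∧ (x, (u i).2) ∈ segment ℝ (u i) (v i) := by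
  have hcl : IsClosed (ω ∩ {p : Plane | p.1 = x}) :=
    h.compact.isClosed.inter (isClosed_eq continuous_fst continuous_const)
  obtain ⟨q, ⟨hqω, hqx⟩, hq⟩ := (h.compact.of_isClosed_subset hcl inter_subset_left).exists_isMinOn
    ⟨(x, y), interior_subset hxy, rfl⟩ (f := Prod.snd) (by fun_prop)
  simp only [mem_ofPred_eq] at hqx
  have hnot : ∀ t, (x, t) ∈ interior ω → q.2 < t := by
    intro t ht
    obtain ⟨ε, hε, hsq⟩ := mem_interior_iff_square.1 ht
    have h1 : q.2 ≤ t - ε / 2 := hq (a := (x, t - ε / 2)) ⟨hsq _ _ (by simpa using hε)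
      (by simp only; rw [sub_sub_cancel_left, abs_neg, abs_of_pos (by positivity)]; linarith), rfl⟩
    linarith
  have hqe : (x, q.2) = q := Prod.ext hqx.symm rfl
  have hfr : q ∈ frontier ω := ⟨subset_closure hqω, fun hi =>
    lt_irrefl _ (hnot q.2 (hqe ▸ hi))⟩
  rw [h.boundary, mem_iUnion] at hfr
  obtain ⟨i, hi⟩ := hfr
  have hhor := (h.axis i).resolve_left fun e => hx i ((fst_of_mem e hi).symm.trans hqx)
  have hq2 := snd_of_mem hhor hi
  refine ⟨i, hhor, hq2 ▸ hnot y hxy, ?_⟩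
  rw [← hq2, hqe]
  exact hi

section Finite

variable [Finite ι]

/-- A vertical segment in the boundary is part of a vertical edge. -/
lemma exists_vertical_edge (h : Outline ω u v) {x y₀ y₁ : ℝ} (hy : y₀ < y₁)
    (hfr : ∀ y ∈ Icc y₀ y₁, (x, y) ∈ frontier ω) :
    ∃ i, (u i).1 = (v i).1 ∧ (u i).1 = x ∧ ∀ y ∈ Icc y₀ y₁, (x, y) ∈ segment ℝ (u i) (v i) := by
  have hG : (range fun i => (u i).2).Finite := finite_range _
  -- away from finitely many points, the edges that meet the segment are vertical
  have hcov : ∀ y ∈ Icc y₀ y₁, y ∉ range (fun i => (u i).2) →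
      ∃ i, (u i).1 = (v i).1 ∧ (u i).1 = x ∧ (x, y) ∈ segment ℝ (u i) (v i) := by
    intro y hy hyG
    have h1 := hfr y hy
    rw [h.boundary, mem_iUnion] at h1
    obtain ⟨i, hi⟩ := h1
    rcases h.axis i with e | e
    · exact ⟨i, e, (fst_of_mem e hi).symm, hi⟩
    · exact absurd ⟨i, (snd_of_mem e hi).symm⟩ hyG
  obtain ⟨y, hyI, hyG⟩ := (Ioo_infinite hy).exists_notMem_finset hG.toFinset
  rw [Finite.mem_toFinset] at hyG
  obtain ⟨i, hi, hix, -⟩ := hcov y (Ioo_subset_Icc_self hyI) hyG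
  refine ⟨i, hi, hix, ?_⟩
  have hcl : IsClosed ((fun y : ℝ => ((x, y) : Plane)) ⁻¹' segment ℝ (u i) (v i)) :=
    (isClosed_segment _ _).preimage (by fun_prop)
  have hsub : Ioo y₀ y₁ ∩ (range fun i => (u i).2)ᶜ ⊆
      (fun y : ℝ => ((x, y) : Plane)) ⁻¹' segment ℝ (u i) (v i) := by
    rintro t ⟨ht, htG⟩
    obtain ⟨j, hj, hjx, hjt⟩ := hcov t (Ioo_subset_Icc_self ht) htG
    rw [h.eq_of_vertical hi hj (hix.trans hjx.symm)]
    exact hjt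
  have hdense : Dense (range fun i => (u i).2)ᶜ := hG.countable.dense_compl ℝ
  have h1 := (hdense.open_subset_closure_inter (isOpen_Ioo (a := y₀) (b := y₁))).trans
    (hcl.closure_subset_iff.2 hsub)
  have h2 := hcl.closure_subset_iff.2 h1
  rwa [closure_Ioo hy.ne] at h2

/-- If `ω` extends to the left of the line `x = a` and reaches this line, then it contains a
rectangle whose right side is on the line and whose horizontal sides end in horizontal edges. -/
lemma exists_left_box (h : Outline ω u v) {a : ℝ} {p q : Plane} (hp : p ∈ ω) (hq : q ∈ ω)
    (hpa : p.1 < a) (haq : a ≤ q.1) : ∃ x₀ < a, ∃ y₀ y₁, y₀ < y₁ ∧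
      (∀ x ∈ Icc x₀ a, ∀ y ∈ Icc y₀ y₁, (x, y) ∈ ω) ∧
      (∃ i, (u i).2 = (v i).2 ∧ (a, y₀) ∈ segment ℝ (u i) (v i)) ∧
      ∃ i, (u i).2 = (v i).2 ∧ (a, y₁) ∈ segment ℝ (u i) (v i) := by
  have key : ∃ᶠ x in 𝓝[<] a, ∃ ij : ι × ι, (u ij.1).2 = (v ij.1).2 ∧ (u ij.2).2 = (v ij.2).2 ∧
      (u ij.1).2 < (u ij.2).2 ∧ (x, (u ij.1).2) ∈ segment ℝ (u ij.1) (v ij.1) ∧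
      (x, (u ij.2).2) ∈ segment ℝ (u ij.2) (v ij.2) := by
    rw [Filter.frequently_iff]
    intro U hU
    obtain ⟨l, hl, hlU⟩ := mem_nhdsLT_iff_exists_Ioo_subset.1 hU
    have hl' : max l p.1 < a := max_lt hl hpa
    obtain ⟨y, -, hm⟩ := h.path₁ p hp q hq ((max l p.1 + a) / 2) (by
      rw [uIcc_of_le (by linarith)]
      exact ⟨by linarith [le_max_right l p.1], by linarith⟩)
    -- move to the interior, and then away from the vertices
    have hm' := hm
    rw [← h.regular, Metric.mem_closure_iff] at hm'
    obtain ⟨r, hr, hd⟩ := hm' ((a - max l p.1) / 2) (by linarith)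
    rw [dist_comm, Prod.dist_eq, max_lt_iff, Real.dist_eq, Real.dist_eq, abs_lt] at hd
    obtain ⟨⟨hd1, hd2⟩, -⟩ := hd
    simp only at hd1 hd2
    obtain ⟨ε, hε, hsq⟩ := mem_interior_iff_square.1 (by rwa [interior_interior] :
      r ∈ interior (interior ω))
    have hG : (range fun i => (u i).1).Finite := finite_range _
    obtain ⟨x, hx, hxG⟩ := (Ioo_infinite (lt_min (by linarith : r.1 < a)
      (by linarith : r.1 < r.1 + ε))).exists_notMem_finset hG.toFinset
    rw [Finite.mem_toFinset] at hxG
    have hx1 := lt_min_iff.1 hx.2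
    have hxi : (x, r.2) ∈ interior ω := hsq x r.2
      (by rw [abs_of_pos (sub_pos.2 hx.1)]; linarith) (by simpa using hε)
    obtain ⟨i, hi, hiy, hix⟩ := h.exists_bottom_edge hxi fun i e => hxG ⟨i, e⟩
    obtain ⟨j, hj, hjy, hjx⟩ := h.exists_top_edge hxi fun i e => hxG ⟨i, e⟩
    exact ⟨x, hlU ⟨by linarith [le_max_left l p.1, hx.1], hx1.1⟩, (i, j), hi, hj, hiy.trans hjy,
      hix, hjx⟩
  -- there are only finitely many pairs of edges
  obtain ⟨⟨i, j⟩, hij⟩ : ∃ ij : ι × ι, ∃ᶠ x in 𝓝[<] a, (u ij.1).2 = (v ij.1).2 ∧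
      (u ij.2).2 = (v ij.2).2 ∧ (u ij.1).2 < (u ij.2).2 ∧
      (x, (u ij.1).2) ∈ segment ℝ (u ij.1) (v ij.1) ∧
      (x, (u ij.2).2) ∈ segment ℝ (u ij.2) (v ij.2) := by
    by_contra hcon
    simp only [not_exists, Filter.not_frequently] at hcon
    exact key ((Filter.eventually_all.2 hcon).mono fun x hx => not_exists.2 hx)
  simp only at hij
  have hcont : ∀ y : ℝ, Filter.Tendsto (fun x : ℝ => ((x, y) : Plane)) (𝓝[<] a) (𝓝 (a, y)) :=
    fun y => ((by fun_prop : Continuous fun x : ℝ => ((x, y) : Plane)).tendsto a).mono_left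
      nhdsWithin_le_nhds
  have hi := (isClosed_segment (u i) (v i)).mem_of_frequently_of_tendsto
    (hij.mono fun x hx => hx.2.2.2.1) (hcont _)
  have hj := (isClosed_segment (u j) (v j)).mem_of_frequently_of_tendsto
    (hij.mono fun x hx => hx.2.2.2.2) (hcont _)
  obtain ⟨x₀, ⟨e₁, e₂, hlt, h1, h2⟩, hx₀⟩ := (hij.and_eventually self_mem_nhdsWithin).exists
  have hω : ∀ k, segment ℝ (u k) (v k) ⊆ ω := fun k =>
    (h.edge_subset_frontier k).trans h.frontier_subset
  exact ⟨x₀, hx₀, _, _, hlt, fun x hx y hy => h.vert (h.horiz (hω i h1) (hω i hi) hx.1 hx.2)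
    (h.horiz (hω j h2) (hω j hj) hx.1 hx.2) hy.1 hy.2, ⟨i, e₁, hi⟩, j, e₂, hj⟩

/-- A vertical line that separates two points of `ω` meets the interior of `ω`: otherwise a vertical
edge on this line would have a horizontal edge that ends in its relative interior. -/
lemma exists_interior (h : Outline ω u v) {a : ℝ} {p q : Plane} (hp : p ∈ ω) (hq : q ∈ ω)
    (hpa : p.1 < a) (haq : a < q.1) : ∃ y, (a, y) ∈ interior ω := by
  by_contra hcon
  push Not at hcon
  obtain ⟨x₀, hx₀, y₀, y₁, hy, hbox, ⟨i₀, hi₀, hm₀⟩, i₁, hi₁, hm₁⟩ :=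
    h.exists_left_box hp hq hpa haq.le
  obtain ⟨x₁, hx₁, t₀, t₁, ht, hbox', ⟨j₀, hj₀, hn₀⟩, j₁, hj₁, hn₁⟩ :=
    h.flip.exists_left_box (a := -a) (mem_image_of_mem _ hq) (mem_image_of_mem _ hp)
      (neg_lt_neg haq) (neg_le_neg hpa.le)
  have hflip : ∀ y, ∀ j, ((-a, y) : Plane) ∈ segment ℝ ((flipL ∘ u) j) ((flipL ∘ v) j) →
      (a, y) ∈ segment ℝ (u j) (v j) := by
    intro y j hm
    rw [Function.comp_apply, Function.comp_apply, ← image_segment_of_equiv, mem_flipL_image] at hm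
    simpa using hm
  have hm₀' := hflip _ _ hn₀
  have hm₁' := hflip _ _ hn₁
  have hω : ∀ y, (y ∈ Icc y₀ y₁ ∨ y ∈ Icc t₀ t₁) → (a, y) ∈ ω := by
    rintro y (hy | hy)
    · exact hbox a ⟨hx₀.le, le_rfl⟩ y hy
    · have := hbox' (-a) ⟨hx₁.le, le_rfl⟩ y hy
      rw [mem_flipL_image] at this
      simpa using this
  -- a horizontal edge cannot end in the relative interior of a vertical boundary segment
  have key : ∀ l m r : ℝ, l < m → m < r → (a, l) ∈ ω → (a, r) ∈ ω →
      ∀ i, (u i).2 = (v i).2 → (a, m) ∉ segment ℝ (u i) (v i) := by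
    intro l m r hlm hmr hl hr i hi hm
    obtain ⟨k, hk, hka, hseg⟩ := h.exists_vertical_edge (x := a) (hlm.trans hmr) fun y hy =>
      ⟨subset_closure (h.vert hl hr hy.1 hy.2), hcon y⟩
    have hik : i ≠ k := fun e => h.ne k (Prod.ext hk (e ▸ hi))
    have hmk := hseg m ⟨hlm.le, hmr.le⟩
    have hv := h.cross i k hik _ hm hmk
    have hend : ∀ y ∈ Icc l r, y ∈ uIcc (u k).2 (v k).2 := by
      intro y hy
      obtain ⟨t, ht, -, e⟩ := mem_segment_iff.1 (hseg y hy)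
      rw [← segment_eq_uIcc, segment_eq_image']
      exact ⟨t, ht, by simp only [smul_eq_mul]; exact e.symm⟩
    have h1 := hend l ⟨le_rfl, by linarith⟩
    have h2 := hend r ⟨by linarith, le_rfl⟩
    rw [mem_uIcc] at h1 h2
    rcases h.gen₁ _ ⟨k, rfl⟩ _ (h.end_mem k) _ hv hk (hk.symm.trans hka) with e | e | e
    · exact h.ne k e
    · rw [e] at h1 h2
      rcases h1 with h1 | h1 <;> rcases h2 with h2 | h2 <;> simp only at h1 h2 <;> linarith
    · rw [e] at h1 h2
      rcases h1 with h1 | h1 <;> rcases h2 with h2 | h2 <;> simp only at h1 h2 <;> linarith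
  have hy₀ := hω y₀ (Or.inl ⟨le_rfl, hy.le⟩)
  have hy₁ := hω y₁ (Or.inl ⟨hy.le, le_rfl⟩)
  have ht₀ := hω t₀ (Or.inr ⟨le_rfl, ht.le⟩)
  have ht₁ := hω t₁ (Or.inr ⟨ht.le, le_rfl⟩)
  rcases le_or_gt y₁ t₀ with h1 | h1
  · exact key y₀ y₁ t₁ hy (h1.trans_lt ht) hy₀ ht₁ i₁ hi₁ hm₁
  rcases le_or_gt t₁ y₀ with h2 | h2
  · exact key t₀ t₁ y₁ ht (h2.trans_lt hy) ht₀ hy₁ j₁ hj₁ hm₁'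
  -- the rectangles on the two sides have a common part of their sides on the line
  have hlu : max y₀ t₀ < min y₁ t₁ := max_lt (lt_min hy h2) (lt_min h1 ht)
  apply hcon ((max y₀ t₀ + min y₁ t₁) / 2)
  rw [mem_interior_iff_mem_nhds]
  have hnhds : Icc x₀ (-x₁) ×ˢ Icc (max y₀ t₀) (min y₁ t₁) ∈
      𝓝 ((a, (max y₀ t₀ + min y₁ t₁) / 2) : Plane) :=
    prod_mem_nhds (Icc_mem_nhds hx₀ (by linarith)) (Icc_mem_nhds (by linarith) (by linarith))
  refine Filter.mem_of_superset hnhds ?_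
  rintro ⟨x, y⟩ ⟨hx, hy⟩
  simp only at hx hy
  have hyl := max_le_iff.1 hy.1
  have hyu := le_min_iff.1 hy.2
  rcases le_total x a with hxa | hxa
  · exact hbox x ⟨hx.1, hxa⟩ y ⟨hyl.1, hyu.1⟩
  · have h3 := hbox' (-x) ⟨by linarith [hx.2], by linarith⟩ y ⟨hyl.2, hyu.2⟩
    rw [mem_flipL_image] at h3
    simpa using h3

end Finite

end Outline

/-! ### From obstacles to outlines -/

lemma rectDist_triangle (p q r : Plane) : rectDist p r ≤ rectDist p q + rectDist q r := by
  have h1 := abs_sub_le p.1 q.1 r.1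
  have h2 := abs_sub_le p.2 q.2 r.2
  simp only [rectDist]
  linarith

lemma rectDist_of_mem_segment {a b r : Plane} (hr : r ∈ segment ℝ a b) :
    rectDist a r + rectDist r b = rectDist a b := by
  obtain ⟨t, ht, h1, h2⟩ := mem_segment_iff.1 hr
  have ht1 : 0 ≤ 1 - t := sub_nonneg.2 ht.2
  have e1 : a.1 - r.1 = t * (a.1 - b.1) := by rw [h1]; ring
  have e2 : a.2 - r.2 = t * (a.2 - b.2) := by rw [h2]; ring
  have e3 : r.1 - b.1 = (1 - t) * (a.1 - b.1) := by rw [h1]; ring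
  have e4 : r.2 - b.2 = (1 - t) * (a.2 - b.2) := by rw [h2]; ring
  simp only [rectDist, e1, e2, e3, e4, abs_mul, abs_of_nonneg ht.1, abs_of_nonneg ht1]
  ring

lemma rectDist_le_sum (m : ℕ) (u : ℕ → Plane) :
    rectDist (u 0) (u m) ≤ ∑ i ∈ Finset.range m, rectDist (u i) (u (i + 1)) := by
  induction m with
  | zero => simp [rectDist]
  | succ m ih =>
    rw [Finset.sum_range_succ]
    linarith [rectDist_triangle (u 0) (u m) (u (m + 1))]

/-- A polygonal path passes over every coordinate between those of its ends. -/
lemma exists_point_of_path {ω : Set Plane} {x : ℝ} (m : ℕ) (u : ℕ → Plane) (h0 : u 0 ∈ ω)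
    (hseg : ∀ i < m, segment ℝ (u i) (u (i + 1)) ⊆ ω) (hx : x ∈ uIcc (u 0).1 (u m).1) :
    ∃ r ∈ ω, r.1 = x ∧ rectDist (u 0) r + rectDist r (u m) ≤
      ∑ i ∈ Finset.range m, rectDist (u i) (u (i + 1)) := by
  induction m generalizing u with
  | zero => exact ⟨u 0, h0, by rw [uIcc_self] at hx; exact hx.symm, by simp [rectDist]⟩
  | succ m ih =>
    have h01 := hseg 0 (Nat.succ_pos m)
    rw [zero_add] at h01
    rw [Finset.sum_range_succ', zero_add]
    have htail := rectDist_le_sum m fun i => u (i + 1)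
    simp only [zero_add] at htail
    rcases uIcc_subset_uIcc_union_uIcc (b := (u 1).1) hx with hx | hx
    · have e : Prod.fst '' segment ℝ (u 0) (u 1) = uIcc (u 0).1 (u 1).1 :=
        (image_segment ℝ (LinearMap.fst ℝ ℝ ℝ).toAffineMap (u 0) (u 1)).trans
          (segment_eq_uIcc _ _)
      rw [← e] at hx
      obtain ⟨r, hr, hrx⟩ := hx
      refine ⟨r, h01 hr, hrx, ?_⟩
      linarith [rectDist_of_mem_segment hr, rectDist_triangle r (u 1) (u (m + 1))]
    · obtain ⟨r, hr, hrx, hle⟩ := ih (fun i => u (i + 1)) (h01 (right_mem_segment _ _ _))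
        (fun i hi => hseg (i + 1) (Nat.succ_lt_succ hi)) hx
      simp only [zero_add] at hle
      exact ⟨r, hr, hrx, by linarith [rectDist_triangle (u 0) (u 1) r]⟩

lemma mem_uIcc_of_abs_le {a b x : ℝ} (h : |a - x| + |x - b| ≤ |a - b|) : x ∈ uIcc a b := by
  rw [mem_uIcc]
  rcases abs_cases (a - x) with h1 | h1 <;> rcases abs_cases (x - b) with h2 | h2 <;>
    rcases abs_cases (a - b) with h3 | h3 <;>
    first
      | exact Or.inl ⟨by linarith, by linarith⟩
      | exact Or.inr ⟨by linarith, by linarith⟩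

lemma ShortestPathInside.exists_point {ω : Set Plane} {p q : Plane}
    (h : ShortestPathInside ω p q) (hp : p ∈ ω) {x : ℝ} (hx : x ∈ uIcc p.1 q.1) :
    ∃ y ∈ uIcc p.2 q.2, (x, y) ∈ ω := by
  obtain ⟨m, u, rfl, rfl, -, hseg, hsum⟩ := h
  obtain ⟨r, hr, rfl, hle⟩ := exists_point_of_path m u hp hseg hx
  refine ⟨r.2, mem_uIcc_of_abs_le ?_, hr⟩
  rw [hsum] at hle
  simp only [rectDist] at hle
  linarith [abs_sub_le (u 0).1 r.1 (u m).1]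

lemma ShortestPathInside.swap {ω : Set Plane} {p q : Plane} (h : ShortestPathInside ω p q) :
    ShortestPathInside (swapL '' ω) (swapL p) (swapL q) := by
  obtain ⟨m, u, rfl, rfl, haxis, hseg, hsum⟩ := h
  refine ⟨m, fun i => swapL (u i), rfl, rfl, fun i hi => (haxis i hi).symm,
    fun i hi => segment_subset_swapL_image.2 (hseg i hi), ?_⟩
  have e : ∀ a b : Plane, rectDist (swapL a) (swapL b) = rectDist a b := fun a b => add_comm _ _
  simp only [e]
  exact hsum

section

variable {n : ℕ} {P : Polygon Plane n} {ω : Set Plane}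

lemma edgeSet_eq (P : Polygon Plane n) (i : Fin n) :
    P.edgeSet ℝ i = segment ℝ (P i) (P (finRotate n i)) := affineSegment_eq_segment ℝ _ _

lemma IsObstacle.rectConvex (h : IsObstacle P ω) : RectConvex ω where
  compact := h.region.compact
  regular := h.region.regular
  path₁ p hp q hq _ hx := (h.convex p hp q hq).exists_point hp hx
  path₂ p hp q hq y hy := by
    obtain ⟨x, hx, hm⟩ := (h.convex p hp q hq).swap.exists_point (mem_image_of_mem _ hp) hy
    exact ⟨x, hx, mem_swapL_image.1 hm⟩

lemma finRotate_ne_self (hn : 2 ≤ n) (i : Fin n) : finRotate n i ≠ i := by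
  obtain ⟨m, rfl⟩ : ∃ m, n = m + 1 := ⟨n - 1, by omega⟩
  rw [finRotate_apply]
  intro e
  have h1 : (1 : Fin (m + 1)) = 0 := by simpa using e
  rw [Fin.ext_iff, Fin.val_one', Fin.val_zero, Nat.mod_eq_of_lt (by omega)] at h1
  omega

lemma IsObstacle.outline (h : IsObstacle P ω) :
    Outline ω P.vertices (fun i => P (finRotate n i)) where
  toRectConvex := h.rectConvex
  boundary := by
    rw [h.region.boundary, Polygon.boundary]
    exact iUnion_congr fun i => edgeSet_eq P i
  ne i e := finRotate_ne_self (by have := h.region.simple.three_le; omega) i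
    (h.region.simple.injective e).symm
  axis i := (h.rectilinear i).symm
  end_mem i := mem_range_self _
  cross i j hij p hi hj := by
    rw [← edgeSet_eq] at hi hj
    by_cases h1 : finRotate n i = j
    · have h2 := h.region.simple.adjacent i
      rw [h1] at h2
      have h3 : p ∈ ({P j} : Set Plane) := h2 ▸ ⟨hi, hj⟩
      exact ⟨j, h3.symm⟩
    by_cases h1' : finRotate n j = i
    · have h2 := h.region.simple.adjacent j
      rw [h1'] at h2
      have h3 : p ∈ ({P i} : Set Plane) := h2 ▸ ⟨hj, hi⟩
      exact ⟨i, h3.symm⟩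
    exact ((h.region.simple.nonadjacent i j hij h1 h1').le_bot ⟨hi, hj⟩).elim
  gen₁ := by
    rintro _ ⟨i, rfl⟩ _ ⟨j, rfl⟩ _ ⟨k, rfl⟩ h1 h2
    by_contra! hne
    refine h.general_position i j k (fun e => hne.1 (by rw [e])) (fun e => hne.2.1 (by rw [e]))
      (fun e => hne.2.2 (by rw [e])) ?_
    rw [collinear_iff_of_mem (p₀ := P i) (by simp)]
    refine ⟨(0, 1), ?_⟩
    rintro p (rfl | rfl | rfl)
    · exact ⟨0, by simp⟩
    · exact ⟨(P j).2 - (P i).2, by ext <;> simp [h1]⟩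
    · exact ⟨(P k).2 - (P i).2, by ext <;> simp [h1, h2]⟩
  gen₂ := by
    rintro _ ⟨i, rfl⟩ _ ⟨j, rfl⟩ _ ⟨k, rfl⟩ h1 h2
    by_contra! hne
    refine h.general_position i j k (fun e => hne.1 (by rw [e])) (fun e => hne.2.1 (by rw [e]))
      (fun e => hne.2.2 (by rw [e])) ?_
    rw [collinear_iff_of_mem (p₀ := P i) (by simp)]
    refine ⟨(1, 0), ?_⟩
    rintro p (rfl | rfl | rfl)
    · exact ⟨0, by simp⟩
    · exact ⟨(P j).1 - (P i).1, by ext <;> simp [h1]⟩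
    · exact ⟨(P k).1 - (P i).1, by ext <;> simp [h1, h2]⟩

end

/-- The boundary edges form a skeleton: a path that enters the interior of `ω` has to cross the
boundary. -/
lemma Outline.isSkeleton {ι : Type} {ω : Set Plane} {u v : ι → Plane} (h : Outline ω u v) :
    IsSkeleton ω (range fun i => segment ℝ (u i) (v i)) := by
  refine ⟨?_, ?_, fun p q hp _ hpq γ hγ => ?_⟩
  · rintro _ ⟨i, rfl⟩
    exact ⟨_, _, h.ne i, rfl⟩
  · rintro _ ⟨i, rfl⟩
    exact (h.edge_subset_frontier i).trans h.frontier_subset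
  · have hne := hpq γ hγ
    obtain ⟨k, -, rfl⟩ := hγ
    have hconn : IsPreconnected (segment ℝ p k ∪ segment ℝ k q) :=
      (convex_segment p k).isPreconnected.union k (right_mem_segment _ _ _)
        (left_mem_segment _ _ _) (convex_segment k q).isPreconnected
    have hp' : p ∈ segment ℝ p k ∪ segment ℝ k q := Or.inl (left_mem_segment _ _ _)
    have key : ((segment ℝ p k ∪ segment ℝ k q) ∩ frontier ω).Nonempty := by
      by_contra hcon
      rw [not_nonempty_iff_eq_empty] at hcon
      have hout : ∀ r ∈ segment ℝ p k ∪ segment ℝ k q, r ∉ interior ω → r ∈ ωᶜ :=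
        fun r hr hri hrω => (hcon.subset ⟨hr, subset_closure hrω, hri⟩ : r ∈ (∅ : Set Plane))
      obtain ⟨r, -, hri, hrω⟩ := hconn (interior ω) ωᶜ isOpen_interior
        h.compact.isClosed.isOpen_compl
        (fun r hr => (em (r ∈ interior ω)).imp_right (hout r hr)) hne ⟨p, hp', hout p hp' hp⟩
      exact hrω (interior_subset hri)
    obtain ⟨r, hr, hrf⟩ := key
    rw [h.boundary, mem_iUnion] at hrf
    obtain ⟨i, hi⟩ := hrf
    exact ⟨_, ⟨i, rfl⟩, r, hr, hi⟩

/-! ### Extreme corners and staircase obstacles -/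

lemma exists_boundingBox {ω : Set Plane} (hω : IsCompact ω) (hne : ω.Nonempty) :
    ∃ lo hi : Plane, lo ≤ hi ∧ ω ⊆ Icc lo hi ∧ boundingBox ω = Icc lo hi := by
  obtain ⟨p₁, hp₁, h₁⟩ := hω.exists_isMinOn hne (f := Prod.fst) (by fun_prop)
  obtain ⟨p₂, hp₂, h₂⟩ := hω.exists_isMaxOn hne (f := Prod.fst) (by fun_prop)
  obtain ⟨p₃, hp₃, h₃⟩ := hω.exists_isMinOn hne (f := Prod.snd) (by fun_prop)
  obtain ⟨p₄, hp₄, h₄⟩ := hω.exists_isMaxOn hne (f := Prod.snd) (by fun_prop)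
  have hsub : ω ⊆ Icc (p₁.1, p₃.2) (p₂.1, p₄.2) := fun p hp => ⟨⟨h₁ hp, h₃ hp⟩, ⟨h₂ hp, h₄ hp⟩⟩
  exact ⟨(p₁.1, p₃.2), (p₂.1, p₄.2), ⟨(hsub hp₂).1.1, (hsub hp₄).1.2⟩, hsub,
    boundingBox_eq_Icc hsub ⟨p₁, hp₁, rfl⟩ ⟨p₂, hp₂, rfl⟩
    ⟨p₃, hp₃, rfl⟩ ⟨p₄, hp₄, rfl⟩⟩

lemma lt_of_mem_interior {ω : Set Plane} {lo hi p : Plane} (hω : ω ⊆ Icc lo hi)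
    (hp : p ∈ interior ω) : (lo.1 < p.1 ∧ p.1 < hi.1) ∧ lo.2 < p.2 ∧ p.2 < hi.2 := by
  have h := interior_mono hω hp
  rw [Icc_prod_eq, interior_prod_eq, interior_Icc, interior_Icc] at h
  exact h

/-- A horizontal segment in the boundary of a box is part of its lower or its upper side. -/
lemma snd_eq_of_subset_frontier {a b lo hi : Plane} (hab : a.2 = b.2) (hne : a ≠ b)
    (hle : lo ≤ hi) (hsub : segment ℝ a b ⊆ frontier (Icc lo hi)) : a.2 = lo.2 ∨ a.2 = hi.2 := by
  have ha := ((mem_frontier_Icc hle.1 hle.2).1 (hsub (left_mem_segment _ _ _))).1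
  have hb := ((mem_frontier_Icc hle.1 hle.2).1 (hsub (right_mem_segment _ _ _))).1
  have hab₁ : a.1 ≠ b.1 := fun e => hne (Prod.ext e hab)
  have hm : ((1 / 2 * a.1 + 1 / 2 * b.1, a.2) : Plane) ∈ segment ℝ a b :=
    ⟨1 / 2, 1 / 2, by norm_num, by norm_num, by norm_num, by ext <;> simp [← hab]; ring⟩
  have ha₁ := ha.1.1
  have ha₂ := ha.2.1
  have hb₁ := hb.1.1
  have hb₂ := hb.2.1
  rcases ((mem_frontier_Icc hle.1 hle.2).1 (hsub hm)).2 with e | e | e | e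
  · simp only at e
    exact absurd (by linarith) hab₁
  · simp only at e
    exact absurd (by linarith) hab₁
  · exact Or.inl e
  · exact Or.inr e

lemma fst_eq_of_subset_frontier {a b lo hi : Plane} (hab : a.1 = b.1) (hne : a ≠ b)
    (hle : lo ≤ hi) (hsub : segment ℝ a b ⊆ frontier (Icc lo hi)) : a.1 = lo.1 ∨ a.1 = hi.1 := by
  refine snd_eq_of_subset_frontier (a := swapL a) (b := swapL b) (lo := swapL lo) (hi := swapL hi)
    hab (swapL.injective.ne hne) ⟨hle.2, hle.1⟩ fun p hp => ?_
  rw [← swapL_image_segment, mem_swapL_image] at hp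
  have h := (mem_frontier_Icc hle.1 hle.2).1 (hsub hp)
  refine (mem_frontier_Icc (c := swapL lo) (z := swapL hi) hle.2 hle.1).2
    ⟨⟨⟨h.1.1.2, h.1.1.1⟩, ⟨h.1.2.2, h.1.2.1⟩⟩, ?_⟩
  have h2 := h.2
  simp only [swapL_apply] at h2 ⊢
  tauto

namespace Outline

variable {ι : Type} {ω : Set Plane} {u v : ι → Plane}

/-- An edge on a vertical line that does not enter the interior is the whole part of `ω` on this
line. -/
lemma mem_vertical_edge_iff [Finite ι] (h : Outline ω u v) {i : ι} (hi : (u i).1 = (v i).1)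
    (hint : ∀ p ∈ interior ω, p.1 ≠ (u i).1) {p : Plane} :
    p ∈ segment ℝ (u i) (v i) ↔ p ∈ ω ∧ p.1 = (u i).1 := by
  have hω := (h.edge_subset_frontier i).trans h.frontier_subset
  refine ⟨fun hp => ⟨hω hp, fst_of_mem hi hp⟩, fun ⟨hp, hpi⟩ => ?_⟩
  by_cases hpu : p.2 = (u i).2
  · rw [show p = u i from Prod.ext hpi hpu]
    exact left_mem_segment _ _ _
  have hu : u i ∈ ω := hω (left_mem_segment _ _ _)
  have hp' : ((u i).1, p.2) ∈ ω := by rw [← hpi]; exact hp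
  obtain ⟨k, hk, hki, hseg⟩ := h.exists_vertical_edge (x := (u i).1) (min_lt_max.2 hpu)
    fun y hy => ⟨subset_closure (by
      rcases le_total p.2 (u i).2 with hle | hle
      · rw [min_eq_left hle, max_eq_right hle] at hy
        exact h.vert hp' hu hy.1 hy.2
      · rw [min_eq_right hle, max_eq_left hle] at hy
        exact h.vert hu hp' hy.1 hy.2), fun hcon => hint _ hcon rfl⟩
  have := hseg p.2 ⟨min_le_left _ _, le_max_left _ _⟩
  rw [h.eq_of_vertical hi hk hki.symm]
  rwa [← hpi] at this

lemma mem_horizontal_edge_iff [Finite ι] (h : Outline ω u v) {i : ι} (hi : (u i).2 = (v i).2)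
    (hint : ∀ p ∈ interior ω, p.2 ≠ (u i).2) {p : Plane} :
    p ∈ segment ℝ (u i) (v i) ↔ p ∈ ω ∧ p.2 = (u i).2 := by
  have h1 := h.swap.mem_vertical_edge_iff (i := i) (p := swapL p) hi fun q hq =>
    hint _ (mem_interior_swapL_image.1 hq)
  rw [Function.comp_apply, Function.comp_apply, ← swapL_image_segment] at h1
  rw [mem_swapL_image, mem_swapL_image] at h1
  exact h1

/-- A corner of two different edges belongs to a horizontal and to a vertical one. -/
lemma exists_horizontal_vertical (h : Outline ω u v) {p : ι → Prop} {i j : ι} (hij : i ≠ j)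
    (hi : p i) (hj : p j) {c : Plane} (hci : c ∈ segment ℝ (u i) (v i))
    (hcj : c ∈ segment ℝ (u j) (v j)) :
    (∃ k, p k ∧ (u k).2 = (v k).2 ∧ c ∈ segment ℝ (u k) (v k)) ∧
      ∃ k, p k ∧ (u k).1 = (v k).1 ∧ c ∈ segment ℝ (u k) (v k) := by
  rcases h.axis i with hi' | hi' <;> rcases h.axis j with hj' | hj'
  · exact absurd (h.eq_of_vertical hi' hj' ((fst_of_mem hi' hci).symm.trans (fst_of_mem hj' hcj)))
      hij
  · exact ⟨⟨j, hj, hj', hcj⟩, i, hi, hi', hci⟩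
  · exact ⟨⟨i, hi, hi', hci⟩, j, hj, hj', hcj⟩
  · exact absurd (h.swap.eq_of_vertical hi' hj'
      ((snd_of_mem hi' hci).symm.trans (snd_of_mem hj' hcj))) hij

end Outline

section

variable {n : ℕ} {P : Polygon Plane n} {ω : Set Plane} {c d : Plane}

lemma IsObstacle.edge_subset (h : IsObstacle P ω) (i : Fin n) : P.edgeSet ℝ i ⊆ ω := by
  rw [edgeSet_eq]
  exact (h.outline.edge_subset_frontier i).trans h.outline.frontier_subset

lemma IsExtremeCorner.exists_edges (h : IsObstacle P ω) (hc : IsExtremeCorner P ω c) :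
    (∃ i, IsExtremeEdge P ω i ∧ IsHorizontalEdge P i ∧ c ∈ P.edgeSet ℝ i) ∧
      ∃ i, IsExtremeEdge P ω i ∧ IsVerticalEdge P i ∧ c ∈ P.edgeSet ℝ i := by
  obtain ⟨-, i, j, hij, hi, hj, hci, hcj⟩ := hc
  simp only [edgeSet_eq] at hci hcj ⊢
  exact h.outline.exists_horizontal_vertical hij hi hj hci hcj

lemma IsObstacle.snd_of_horizontal (h : IsObstacle P ω) {lo up : Plane} (hle : lo ≤ up)
    (hbox : boundingBox ω = Icc lo up) {i : Fin n} (hext : IsExtremeEdge P ω i)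
    (hi : IsHorizontalEdge P i) (hc : c ∈ P.edgeSet ℝ i) : c.2 = lo.2 ∨ c.2 = up.2 := by
  rw [IsExtremeEdge, hbox, edgeSet_eq] at hext
  rw [edgeSet_eq] at hc
  rw [Outline.snd_of_mem hi hc]
  exact snd_eq_of_subset_frontier hi (h.outline.ne i) hle hext

lemma IsObstacle.fst_of_vertical (h : IsObstacle P ω) {lo up : Plane} (hle : lo ≤ up)
    (hbox : boundingBox ω = Icc lo up) {i : Fin n} (hext : IsExtremeEdge P ω i)
    (hi : IsVerticalEdge P i) (hc : c ∈ P.edgeSet ℝ i) : c.1 = lo.1 ∨ c.1 = up.1 := by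
  rw [IsExtremeEdge, hbox, edgeSet_eq] at hext
  rw [edgeSet_eq] at hc
  rw [Outline.fst_of_mem hi hc]
  exact fst_eq_of_subset_frontier hi (h.outline.ne i) hle hext

lemma IsObstacle.extremeEdges_horizontal (h : IsObstacle P ω) {i : Fin n}
    (hext : IsExtremeEdge P ω i) (hi : IsHorizontalEdge P i) (hc : c ∈ P.edgeSet ℝ i) :
    extremeEdges P ω i =
      {e | e.1 ∈ ω ∧ e.1.2 = c.2 ∧ IsVisibilityEdge ω (segment ℝ e.1 e.2)} := by
  obtain ⟨lo, hi', hle, hsub, hbox⟩ := exists_boundingBox h.region.compact ⟨c, h.edge_subset i hc⟩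
  have hside := h.snd_of_horizontal hle hbox hext hi hc
  rw [edgeSet_eq] at hc
  have hcu := Outline.snd_of_mem hi hc
  ext e
  rw [extremeEdges, mem_ofPred_eq, mem_ofPred_eq, edgeSet_eq,
    h.outline.mem_horizontal_edge_iff hi fun p hp e => ?_, ← hcu, and_assoc]
  have hb := lt_of_mem_interior hsub hp
  rw [← hcu] at e
  rcases hside with e' | e' <;> linarith [hb.2.1, hb.2.2]

lemma IsObstacle.extremeEdges_vertical (h : IsObstacle P ω) {i : Fin n}
    (hext : IsExtremeEdge P ω i) (hi : IsVerticalEdge P i) (hc : c ∈ P.edgeSet ℝ i) :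
    extremeEdges P ω i =
      {e | e.1 ∈ ω ∧ e.1.1 = c.1 ∧ IsVisibilityEdge ω (segment ℝ e.1 e.2)} := by
  obtain ⟨lo, hi', hle, hsub, hbox⟩ := exists_boundingBox h.region.compact ⟨c, h.edge_subset i hc⟩
  have hside := h.fst_of_vertical hle hbox hext hi hc
  rw [edgeSet_eq] at hc
  have hcu := Outline.fst_of_mem hi hc
  ext e
  rw [extremeEdges, mem_ofPred_eq, mem_ofPred_eq, edgeSet_eq,
    h.outline.mem_vertical_edge_iff hi fun p hp e => ?_, ← hcu, and_assoc]
  have hb := lt_of_mem_interior hsub hp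
  rw [← hcu] at e
  rcases hside with e' | e' <;> linarith [hb.1.1, hb.1.2]

lemma IsExtremeCorner.isMaximalCornerEdge_iff (hc : IsExtremeCorner P ω c) (h : IsObstacle P ω)
    {s : Set Plane} : IsMaximalCornerEdge P ω c d s ↔ CornerEdge ω c d s := by
  constructor
  · rintro ⟨i, b, hext, hci, ⟨hi, hmax⟩ | ⟨hi, hmax⟩, rfl⟩
    · rw [h.extremeEdges_horizontal hext hi hci] at hmax
      exact ⟨b, rfl, Or.inr hmax⟩
    · rw [h.extremeEdges_vertical hext hi hci] at hmax
      exact ⟨b, rfl, Or.inl hmax⟩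
  · obtain ⟨⟨i, hext, hi, hci⟩, j, hext', hj, hcj⟩ := hc.exists_edges h
    rintro ⟨b, rfl, hmax | hmax⟩
    · refine ⟨j, b, hext', hcj, Or.inr ⟨hj, ?_⟩, rfl⟩
      rw [h.extremeEdges_vertical hext' hj hcj]
      exact hmax
    · refine ⟨i, b, hext, hci, Or.inl ⟨hi, ?_⟩, rfl⟩
      rw [h.extremeEdges_horizontal hext hi hci]
      exact hmax

/-- The extreme corners are corners of the bounding box, which determines the extent of `ω`. -/
theorem IsStaircase.preStair (h : IsStaircase P ω c d) : PreStair ω c d := by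
  have ho := h.obstacle
  have hout := ho.outline
  have hcc : IsExtremeCorner P ω c := (h.corners c).2 (Or.inl rfl)
  have hcd : IsExtremeCorner P ω d := (h.corners d).2 (Or.inr rfl)
  obtain ⟨⟨i, hi, hih, hci⟩, j, hj, hjv, hcj⟩ := hcc.exists_edges ho
  obtain ⟨⟨i', hi', hih', hdi⟩, j', hj', hjv', hdj⟩ := hcd.exists_edges ho
  have hc := ho.edge_subset i hci
  have hd := ho.edge_subset i' hdi
  obtain ⟨lo, hi₀, hle, hsub, hbox⟩ := exists_boundingBox ho.region.compact ⟨c, hc⟩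
  have hc₁ := ho.fst_of_vertical hle hbox hj hjv hcj
  have hc₂ := ho.snd_of_horizontal hle hbox hi hih hci
  have hd₁ := ho.fst_of_vertical hle hbox hj' hjv' hdj
  have hd₂ := ho.snd_of_horizontal hle hbox hi' hih' hdi
  have hu : ∀ k, P k ∈ ω := fun k => ho.edge_subset k (by
    rw [edgeSet_eq]; exact left_mem_segment _ _ _)
  have huIcc : ∀ {a b l r x : ℝ}, (a = l ∨ a = r) → (b = l ∨ b = r) → a ≠ b → x ∈ Icc l r →
      x ∈ uIcc a b := by
    rintro a b l r x (rfl | rfl) (rfl | rfl) hab hx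
    · exact absurd rfl hab
    · exact Icc_subset_uIcc hx
    · exact Icc_subset_uIcc' hx
    · exact absurd rfl hab
  have hdense : ∀ {ι : Type} [Finite ι] {A : Set Plane} {u v : ι → Plane} {p q : Plane},
      Outline A u v → p ∈ A → q ∈ A → ∀ x ∈ uIcc p.1 q.1, x ≠ p.1 → x ≠ q.1 →
      ∃ y, (x, y) ∈ interior A := by
    intro ι _ A u v p q hA hp hq x hx h1 h2
    rcases mem_uIcc.1 hx with ⟨h3, h4⟩ | ⟨h3, h4⟩
    · exact hA.exists_interior hp hq (lt_of_le_of_ne h3 h1.symm) (lt_of_le_of_ne h4 h2)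
    · exact hA.exists_interior hq hp (lt_of_le_of_ne h3 h2.symm) (lt_of_le_of_ne h4 h1)
  refine ⟨ho.rectConvex, h.opposite.1, h.opposite.2, hc, hd,
    fun p hp => huIcc hc₁ hd₁ h.opposite.1 ⟨(hsub hp).1.1, (hsub hp).2.1⟩,
    fun p hp => huIcc hc₂ hd₂ h.opposite.2 ⟨(hsub hp).1.2, (hsub hp).2.2⟩,
    hdense hout hc hd, fun y hy h1 h2 => ?_, ?_, ?_⟩
  · obtain ⟨x, hx⟩ := hdense hout.swap (mem_image_of_mem _ hc) (mem_image_of_mem _ hd) y hy h1 h2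
    exact ⟨x, mem_interior_swapL_image.1 hx⟩
  · rw [edgeSet_eq] at hci
    have hcu := Outline.snd_of_mem hih hci
    have hne : (P i).1 ≠ (P (finRotate n i)).1 := fun e => hout.ne i (Prod.ext e hih)
    by_cases e : (P i).1 = c.1
    · exact ⟨_, fun e' => hne (e.trans e'.symm), by rw [hcu, hih]; exact hu _⟩
    · exact ⟨_, e, by rw [hcu]; exact hu _⟩
  · rw [edgeSet_eq] at hcj
    have hcu := Outline.fst_of_mem hjv hcj
    have hne : (P j).2 ≠ (P (finRotate n j)).2 := fun e => hout.ne j (Prod.ext hjv e)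
    by_cases e : (P j).2 = c.2
    · exact ⟨_, fun e' => hne (e.trans e'.symm), by rw [hcu, hjv]; exact hu _⟩
    · exact ⟨_, e, by rw [hcu]; exact hu _⟩

lemma IsStaircase.selects_iff (h : IsStaircase P ω c d) {l : List (Set Plane)} {s : Set Plane} :
    Selects P ω c d l s ↔ AbsSelects ω c d l s := by
  rw [Selects, AbsSelects,
    ((h.corners c).2 (Or.inl rfl)).isMaximalCornerEdge_iff (d := d) h.obstacle]

lemma IsStaircase.run_iff (h : IsStaircase P ω c d) {l : List (Set Plane)} :
    Run P ω c d l ↔ AbsRun ω c d l := by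
  constructor
  · intro hr
    induction hr with
    | start => exact AbsRun.start
    | step l s _ ht hs ih => exact AbsRun.step l s ih ht (h.selects_iff.1 hs)
  · intro hr
    induction hr with
    | start => exact Run.start
    | step l s _ ht hs ih => exact Run.step l s ih ht (h.selects_iff.2 hs)

end

end RectSkeleton

end

theorem mainTheorem3 {n : ℕ} (P : Polygon RectSkeleton.Plane n) (ω : Set RectSkeleton.Plane)
    (c₁ c₂ : RectSkeleton.Plane) (hω : RectSkeleton.IsStaircase P ω c₁ c₂) :
    -- the procedure stops after finitely many steps, whatever choices are made
    (∃ N : ℕ, ∀ l, RectSkeleton.Run P ω c₁ c₂ l → l.length ≤ N) ∧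
    -- until it stops, the next edge (and the current frontier) exists
    (∀ l, RectSkeleton.Run P ω c₁ c₂ l → ¬ RectSkeleton.Terminated ω c₂ l →
      (l ≠ [] → ∃! f, RectSkeleton.IsFrontierOf ω (RectSkeleton.edges l) f) ∧
      ∃ s, RectSkeleton.Selects P ω c₁ c₂ l s) ∧
    -- until it stops, the choices can be made so that it stops at the corner `c₂`
    (∀ l, RectSkeleton.Run P ω c₁ c₂ l → ¬ RectSkeleton.Terminated ω c₂ l →
      ∃ m, RectSkeleton.Run P ω c₁ c₂ (m ++ l) ∧ RectSkeleton.ReachesCorner c₂ (m ++ l)) ∧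
    -- when it stops, the chosen edges form a minimum skeleton
    (∀ l, RectSkeleton.Run P ω c₁ c₂ l → RectSkeleton.Terminated ω c₂ l →
      RectSkeleton.IsMinimumSkeleton ω (RectSkeleton.edges l)) := by
  have h := hω.preStair.correct (Set.finite_range _) hω.obstacle.outline.isSkeleton
  simp only [hω.run_iff, hω.selects_iff]
  exact ⟨h.bounded, h.progress, h.reach, h.minimum⟩
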